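/- A prederivator is a strict 2-functor $\mathscr D\colon \mathrm{Cat}^{\mathrm{op}}\to\mathrm{CAT}$ from small categories to (not necessarily small) categories (1-cells are reversed, 2-cells are not); write $u^*\colon\mathscr D(B)\to\mathscr D(A)$ for its value at $u\colon A\to B$. It is a derivator if (Der1) it sends coproducts to products (i.e. the canonical functors $\mathscr D(\coprod_i A_i)\to\prod_i\mathscr D(A_i)$ are equivalences), (Der2) a morphism in $\mathscr D(A)$ is an isomorphism if and only if its images under all evaluations $a^*\colon\mathscr D(A)\to\mathscr D(\mathbb 1)$, $a\in A$, are isomorphisms, (Der3) every $u^*$ has a left adjoint $u_!$ and a right adjoint $u_*$, and (Der4) for $u\colon A\to B$ and $b\in B$ the canonical mates $\pi_!p^*\to b^*u_!$ and $b^*u_*\to\pi_*q^*$ of the comma squares of $(u/b)$ and $(b/u)$ are isomorphisms. It is pointed if $\mathscr D(\mathbb 1)$ has a zero object. For $n\ge 0$ let $[1]^n$ be the $n$-fold power of the poset $[1]=(0\to1)$, put $d(m)=m_1+\dots+m_n$ for $m\in[1]^n$, and let $i_{\le k}$ and $i_{\ge k}$ be the inclusions of the full subcategories of those $m$ with $d(m)\le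 k$, respectively $d(m)\ge k$. For $n\geq 2$, an $n$-cube $X\in\mathscr D([1]^n)$ is strongly cartesian if it lies in the essential image of $(i_{\ge n-1})_*$, and strongly cocartesian if it lies in the essential image of $(i_{\le 1})_!$. A square ($n=2$) is cartesian, respectively cocartesian, if it lies in the essential image of $(i_{\ge1})_*$, respectively $(i_{\le1})_!$. Let $\ulcorner=[1]^2_{\le1}$ and $\lrcorner=[1]^2_{\ge1}$. Define $\Sigma\colon\mathscr D(\mathbb 1)\to\mathscr D(\mathbb 1)$ as the composite of right Kan extension along $(0,0)\colon\mathbb 1\to\ulcorner$, of $(i_{\leq 1})_!$, and of evaluation at $(1,1)$; dually $\Omega$ as the composite of left Kan extension along $(1,1)\colon\mathbb 1\to\lrcorner$, of $(i_{\geq 1})_*$, and of evaluation at $(0,0)$. Define $\mathrm{cof}\colon\mathscr D([1])\to\mathscr D([1])$ as the composite of right Kan extension along the inclusion $[1]\to\ulcorner$ of the edge $(0,0)\to(1,0)$, of $(i_{\leq 1})_!$, and of restriction to the edge $(1,0)\to(1,1)$; dually $\mathrm{fib}$ as the composite of left Kan extension along the inclusion $[1]\to\lrcorner$ of the edge $(1,0)\to(1,1)$,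 of $(i_{\geq 1})_*$, and of restriction to the edge $(0,0)\to(1,0)$. Let $\mathscr D$ be a pointed derivator. Then $\Sigma$ is left adjoint to $\Omega$ and $\mathrm{cof}$ is left adjoint to $\mathrm{fib}$, and the following are equivalent (for every choice of these adjunctions). 1. The adjunction $(\Sigma,\Omega)\colon\mathscr D(\mathbb 1)\rightleftarrows\mathscr D(\mathbb 1)$ is an equivalence, i.e. its unit and counit are isomorphisms. 2. The adjunction $(\mathrm{cof},\mathrm{fib})\colon\mathscr D([1])\rightleftarrows\mathscr D([1])$ is an equivalence, i.e. its unit and counit are isomorphisms. 3. $\mathscr D$ is stable: a square $X\in\mathscr D([1]^2)$ is cartesian if and only if it is cocartesian. 4. For every $n\ge2$, an $n$-cube $X\in\mathscr D([1]^n)$ is strongly cartesian if and only if it is strongly cocartesian. -/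

import Mathlib

open CategoryTheory CategoryTheory.Limits Opposite

universe w v u

noncomputable section

/-! ## Prederivators and derivators -/

set_option linter.checkUnivs false in
/-- A prederivator: a strict 2-functor `Catᵒᵖ ⥤ CAT` from small categories to (possibly large)
categories. In Mathlib `Catᵒᵖ` is the bicategory in which only the 1-cells are reversed. -/
abbrev Prederivator : Type _ := StrictPseudofunctor Cat.{w, w}ᵒᵖ Cat.{v, u}

namespace Prederivator

section Basic

variable (D : Prederivator.{w, v, u})

/-- The category `D(A)` of coherent diagrams of shape `A`. -/
abbrev Dia (A : Type w) [SmallCategory A] : Type u := D.obj (op (Cat.of A))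

/-- The restriction functor `u^* : D(B) ⥤ D(A)` along `u : A ⥤ B`. -/
def res {A B : Type w} [SmallCategory A] [SmallCategory B] (u : A ⥤ B) : D.Dia B ⥤ D.Dia A :=
  (D.map u.toCatHom.op).toFunctor

/-- The transformation `u^* ⟶ v^*` induced by `α : u ⟶ v`. -/
def resMap {A B : Type w} [SmallCategory A] [SmallCategory B] {u v : A ⥤ B} (α : u ⟶ v) :
    D.res u ⟶ D.res v :=
  (D.map₂ (Bicategory.Opposite.op2 (NatTrans.toCatHom₂ α))).toNatTrans

/-- The identification `(u ⋙ v)^* = v^* ⋙ u^*` that is part of the 2-functor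
(an `eqToIso`, by strictness). -/
def resComp {A B C : Type w} [SmallCategory A] [SmallCategory B] [SmallCategory C]
    (u : A ⥤ B) (v : B ⥤ C) : D.res (u ⋙ v) ≅ D.res v ⋙ D.res u :=
  Cat.Hom.toNatIso (D.mapComp v.toCatHom.op u.toCatHom.op)

/-- The terminal category. -/
abbrev Pt : Type w := Discrete PUnit.{w + 1}

/-- The functor `Pt ⥤ A` that corresponds to an object `a` of `A`. -/
abbrev pt {A : Type w} [SmallCategory A] (a : A) : Pt.{w} ⥤ A := Functor.fromPUnit a

/-- The evaluation functor `a^* : D(A) ⥤ D(Pt)`. -/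
abbrev ev {A : Type w} [SmallCategory A] (a : A) : D.Dia A ⥤ D.Dia Pt.{w} := D.res (pt a)

/-- The 2-cell `α : p ⋙ u ⟶ q ⋙ v` in a square of small categories, seen as a 2-cell
`p^* u^* ⟶ q^* v^*` (that is, `D.res u ⋙ D.res p ⟶ D.res v ⋙ D.res q`). -/
def resSquare {E A B C : Type w} [SmallCategory E] [SmallCategory A] [SmallCategory B]
    [SmallCategory C] {p : E ⥤ A} {u : A ⥤ C} {q : E ⥤ B} {v : B ⥤ C} (α : p ⋙ u ⟶ q ⋙ v) :
    D.res u ⋙ D.res p ⟶ D.res v ⋙ D.res q :=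
  (D.resComp p u).inv ≫ D.resMap α ≫ (D.resComp q v).hom

/-- Axiom (Der3): every restriction functor has a left adjoint and a right adjoint. -/
class HasKanExtensions : Prop where
  exists_left : ∀ {A B : Type w} [SmallCategory A] [SmallCategory B] (u : A ⥤ B),
    (D.res u).IsRightAdjoint
  exists_right : ∀ {A B : Type w} [SmallCategory A] [SmallCategory B] (u : A ⥤ B),
    (D.res u).IsLeftAdjoint

attribute [instance] HasKanExtensions.exists_left HasKanExtensions.exists_right

section Kan

variable [D.HasKanExtensions] {A B : Type w} [SmallCategory A] [SmallCategory B]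

/-- The left Kan extension functor `u_!`. -/
def lan (u : A ⥤ B) : D.Dia A ⥤ D.Dia B := (D.res u).leftAdjoint

/-- The right Kan extension functor `u_*`. -/
def ran (u : A ⥤ B) : D.Dia A ⥤ D.Dia B := (D.res u).rightAdjoint

/-- The adjunction `u_! ⊣ u^*`. -/
def lanAdj (u : A ⥤ B) : D.lan u ⊣ D.res u := Adjunction.ofIsRightAdjoint (D.res u)

/-- The adjunction `u^* ⊣ u_*`. -/
def ranAdj (u : A ⥤ B) : D.res u ⊣ D.ran u := Adjunction.ofIsLeftAdjoint (D.res u)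

/-- The mate `π_! p^* ⟶ b^* u_!` of the comma square of `u/b`, where `p : u/b ⥤ A` and
`π : u/b ⥤ Pt` are the projections. -/
def lanMate (u : A ⥤ B) (b : B) :
    D.res (Comma.fst u (pt b)) ⋙ D.lan (Comma.snd u (pt b)) ⟶ D.lan u ⋙ D.ev b :=
  ((mateEquiv (D.lanAdj u) (D.lanAdj (Comma.snd u (pt b)))).symm
    (TwoSquare.mk _ _ _ _ (D.resSquare (Comma.natTrans u (pt b))))).natTrans

/-- The mate `b^* u_* ⟶ π_* q^*` of the comma square of `b/u`, where `q : b/u ⥤ A` and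
`π : b/u ⥤ Pt` are the projections. -/
def ranMate (u : A ⥤ B) (b : B) :
    D.ran u ⋙ D.ev b ⟶ D.res (Comma.snd (pt b) u) ⋙ D.ran (Comma.fst (pt b) u) :=
  (mateEquiv (D.ranAdj u) (D.ranAdj (Comma.fst (pt b) u))
    (TwoSquare.mk _ _ _ _ (D.resSquare (Comma.natTrans (pt b) u)))).natTrans

end Kan

/-- A prederivator is a derivator if it satisfies (Der1)-(Der4); (Der3) is `HasKanExtensions`. -/
class IsDerivator : Prop extends D.HasKanExtensions where
  /-- (Der1): coproducts are sent to products (the canonical functor is an equivalence). -/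
  der1 : ∀ {I : Type w} (A : I → Type w) [∀ i, SmallCategory (A i)],
    (Functor.pi' fun i => D.res (Sigma.incl (C := A) i)).IsEquivalence
  /-- (Der2): isomorphisms are detected pointwise. -/
  der2 : ∀ {A : Type w} [SmallCategory A] {X Y : D.Dia A} (f : X ⟶ Y),
    IsIso f ↔ ∀ a : A, IsIso ((D.ev a).map f)
  /-- (Der4) for left Kan extensions: they are computed pointwise by colimits. -/
  der4_left : ∀ {A B : Type w} [SmallCategory A] [SmallCategory B] (u : A ⥤ B) (b : B),
    IsIso (D.lanMate u b)
  /-- (Der4) for right Kan extensions: they are computed pointwise by limits. -/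
  der4_right : ∀ {A B : Type w} [SmallCategory A] [SmallCategory B] (u : A ⥤ B) (b : B),
    IsIso (D.ranMate u b)

/-- A derivator is pointed if its underlying category `D(Pt)` has a zero object. -/
class IsPointed : Prop where
  hasZeroObject : HasZeroObject (D.Dia Pt.{w})

end Basic

/-! ## Cubes -/

/-- The poset `[1] = (0 → 1)`. -/
def Arr : Type w := ULift.{w} (Fin 2)

namespace Arr

instance : PartialOrder Arr.{w} := inferInstanceAs (PartialOrder (ULift.{w} (Fin 2)))

/-- The element of `[1]` given by an element of `Fin 2`. -/
def mk (x : Fin 2) : Arr.{w} := ULift.up x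

/-- The value `0` or `1` of an element of `[1]`. -/
def val (x : Arr.{w}) : Fin 2 := ULift.down x

end Arr

/-- The poset `[1]^n` with the product order, viewed as a category. -/
def Cube (n : ℕ) : Type w := Fin n → Arr.{w}

namespace Cube

instance (n : ℕ) : PartialOrder (Cube.{w} n) := inferInstanceAs (PartialOrder (Fin n → Arr.{w}))

/-- The cardinality `d(m) = m_1 + ... + m_n`. -/
def d {n : ℕ} (m : Cube.{w} n) : ℕ := ∑ i : Fin n, ((m i).val : ℕ)

/-- The vertex `(a, b)` of the square `[1]^2`. -/
def vertex (a b : Arr.{w}) : Cube.{w} 2 := ![a, b]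

end Cube

/-- The full subcategory `[1]^n_{≤ k}` of `[1]^n`. -/
abbrev CubeLE (n k : ℕ) : Type w := {m : Cube.{w} n // m.d ≤ k}

/-- The full subcategory `[1]^n_{≥ k}` of `[1]^n`. -/
abbrev CubeGE (n k : ℕ) : Type w := {m : Cube.{w} n // k ≤ m.d}

/-- The inclusion `i_{≤ k} : [1]^n_{≤ k} ⥤ [1]^n`. -/
def inclLE (n k : ℕ) : CubeLE.{w} n k ⥤ Cube.{w} n :=
  Monotone.functor (f := Subtype.val) fun _ _ h => h

/-- The inclusion `i_{≥ k} : [1]^n_{≥ k} ⥤ [1]^n`. -/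
def inclGE (n k : ℕ) : CubeGE.{w} n k ⥤ Cube.{w} n :=
  Monotone.functor (f := Subtype.val) fun _ _ h => h

section Cartesian

variable (D : Prederivator.{w, v, u}) [D.HasKanExtensions]

/-- An `n`-cube is cartesian if it lies in the essential image of `(i_{≥ 1})_*`. -/
def IsCartesian {n : ℕ} (X : D.Dia (Cube.{w} n)) : Prop :=
  (D.ran (inclGE.{w} n 1)).essImage X

/-- An `n`-cube is cocartesian if it lies in the essential image of `(i_{≤ n-1})_!`. -/
def IsCocartesian {n : ℕ} (X : D.Dia (Cube.{w} n)) : Prop :=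
  (D.lan (inclLE.{w} n (n - 1))).essImage X

/-- An `n`-cube is strongly cartesian if it lies in the essential image of `(i_{≥ n-1})_*`. -/
def IsStronglyCartesian {n : ℕ} (X : D.Dia (Cube.{w} n)) : Prop :=
  (D.ran (inclGE.{w} n (n - 1))).essImage X

/-- An `n`-cube is strongly cocartesian if it lies in the essential image of `(i_{≤ 1})_!`. -/
def IsStronglyCocartesian {n : ℕ} (X : D.Dia (Cube.{w} n)) : Prop :=
  (D.lan (inclLE.{w} n 1)).essImage X

/-- Stability: a square (an object of `D([1]^2)`) is cartesian iff it is cocartesian. -/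
def IsStable : Prop := ∀ X : D.Dia (Cube.{w} 2), D.IsCartesian X ↔ D.IsCocartesian X

end Cartesian

/-! ## Suspensions, loops, cofibers and fibers

The square `[1]^2` has the source corner `⌜ = [1]^2_{≤ 1}`, obtained by removing `(1,1)`, and the
sink corner `⌟ = [1]^2_{≥ 1}`, obtained by removing `(0,0)`. -/

/-- The corner `⌜` with vertices `(0,0)`, `(1,0)`, `(0,1)`. -/
abbrev SourceCorner : Type w := CubeLE.{w} 2 1

/-- The corner `⌟` with vertices `(1,0)`, `(0,1)`, `(1,1)`. -/
abbrev SinkCorner : Type w := CubeGE.{w} 2 1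

lemma d_vertex (a b : Arr.{w}) : (Cube.vertex a b).d = (a.val : ℕ) + (b.val : ℕ) := by
  simp [Cube.d, Cube.vertex, Fin.sum_univ_two]

lemma vertex_mono {a b a' b' : Arr.{w}} (h : a ≤ a') (h' : b ≤ b') :
    Cube.vertex a b ≤ Cube.vertex a' b' := by
  intro i
  fin_cases i
  · exact h
  · exact h'

/-- The vertex `(0,0)` of `⌜`. -/
def source00 : SourceCorner.{w} :=
  ⟨Cube.vertex (Arr.mk 0) (Arr.mk 0), by rw [d_vertex]; simp [Arr.mk, Arr.val]⟩

/-- The vertex `(1,1)` of `⌟`. -/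
def sink11 : SinkCorner.{w} :=
  ⟨Cube.vertex (Arr.mk 1) (Arr.mk 1), by rw [d_vertex]; simp [Arr.mk, Arr.val]⟩

/-- The functor `[1] ⥤ [1]^2` with image `(0,0) → (1,0)`. -/
def top : Arr.{w} ⥤ Cube.{w} 2 :=
  Monotone.functor (f := fun t => Cube.vertex t (Arr.mk 0)) fun _ _ h => vertex_mono h le_rfl

/-- The functor `[1] ⥤ [1]^2` with image `(1,0) → (1,1)`. -/
def right : Arr.{w} ⥤ Cube.{w} 2 :=
  Monotone.functor (f := fun t => Cube.vertex (Arr.mk 1) t) fun _ _ h => vertex_mono le_rfl h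

/-- The functor `[1] ⥤ ⌜` with image `(0,0) → (1,0)`; it is the inclusion of a sieve. -/
def topSource : Arr.{w} ⥤ SourceCorner.{w} :=
  Monotone.functor
    (f := fun t => ⟨Cube.vertex t (Arr.mk 0), by
      rw [d_vertex]; simpa [Arr.mk, Arr.val] using Nat.le_of_lt_succ t.val.isLt⟩)
    fun _ _ h => vertex_mono h le_rfl

/-- The functor `[1] ⥤ ⌟` with image `(1,0) → (1,1)`; it is the inclusion of a cosieve. -/
def rightSink : Arr.{w} ⥤ SinkCorner.{w} :=
  Monotone.functor
    (f := fun t => ⟨Cube.vertex (Arr.mk 1) t, by rw [d_vertex]; simp [Arr.mk, Arr.val]⟩)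
    fun _ _ h => vertex_mono le_rfl h

section Susp

variable (D : Prederivator.{w, v, u}) [D.HasKanExtensions]

/-- The suspension `Σ : D(Pt) ⥤ D(Pt)`: extend `x` by zero from `(0,0)` to `⌜` (a right Kan
extension along a sieve), form the cocartesian square, and evaluate at `(1,1)`. -/
def susp : D.Dia Pt.{w} ⥤ D.Dia Pt.{w} :=
  D.ran (pt source00) ⋙ D.lan (inclLE.{w} 2 1) ⋙ D.ev (Cube.vertex (Arr.mk 1) (Arr.mk 1))

/-- The loop functor `Ω : D(Pt) ⥤ D(Pt)`: extend `x` by zero from `(1,1)` to `⌟` (a left Kan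
extension along a cosieve), form the cartesian square, and evaluate at `(0,0)`. -/
def loop : D.Dia Pt.{w} ⥤ D.Dia Pt.{w} :=
  D.lan (pt sink11) ⋙ D.ran (inclGE.{w} 2 1) ⋙ D.ev (Cube.vertex (Arr.mk 0) (Arr.mk 0))

/-- The cofiber functor `cof : D([1]) ⥤ D([1])`: put `x → y` on `(0,0) → (1,0)`, extend by zero
to `⌜`, form the cocartesian square, and restrict to `(1,0) → (1,1)`. -/
def cof : D.Dia Arr.{w} ⥤ D.Dia Arr.{w} :=
  D.ran topSource ⋙ D.lan (inclLE.{w} 2 1) ⋙ D.res right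

/-- The fiber functor `fib : D([1]) ⥤ D([1])`: put `y → z` on `(1,0) → (1,1)`, extend by zero
to `⌟`, form the cartesian square, and restrict to `(0,0) → (1,0)`. -/
def fib : D.Dia Arr.{w} ⥤ D.Dia Arr.{w} :=
  D.lan rightSink ⋙ D.ran (inclGE.{w} 2 1) ⋙ D.res top

end Susp

end Prederivator

/-- An adjunction is an (adjoint) equivalence if its unit and its counit are isomorphisms. -/
def AdjunctionIsEquivalence {C : Type*} {E : Type*} [Category* C] [Category* E] {F : C ⥤ E}
    {G : E ⥤ C} (adj : F ⊣ G) : Prop :=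
  IsIso adj.unit ∧ IsIso adj.counit

end

/-! All four conditions say that cocartesian and cartesian squares agree, on larger or smaller
classes of squares. Let `Z` be the squares that vanish at prescribed vertices. Extension by zero
followed by left Kan extension is a fully faithful left adjoint of a restriction functor on `Z`,
with image the cocartesian squares in `Z`; dually, the cartesian squares in `Z` are the image of a
fully faithful right adjoint. Gluing these two adjunctions along `Z` gives `Σ ⊣ Ω` and `cof ⊣ fib`,
and the glued adjunction is an equivalence iff the two images coincide
(`nonempty_adjunction_and_isEquivalence_iff`). So 1 concerns the squares vanishing at `(1,0)` and
`(0,1)`, 2 those vanishing at `(0,1)`, and 3 → 2 → 1 is immediate.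

The substance is 1 → 3, a retract argument (`isRight_of_isLeft` and its dual). Let `X` be
cocartesian and put `M(a,b) = X(a ∨ b)` on `[1]^2 × [1]^2`. Each row `M(a,-)` is `X` or a degenerate
square, hence cocartesian, so `M` maps to the diagram `S` whose rows are the suspension squares of
the values `X(a)`. By 1 the rows of `S` are cartesian, so `M ⟶ S` factors through the diagram `M'`
obtained from `M` by making the rows cartesian. At `b = (0,0)` the map `M ⟶ S` is an isomorphism,
and `X` becomes a retract of `M'(-,(0,0))`. The latter is a limit of the degenerate squares `X(- ∨
b)` with `b ≠ (0,0)`, hence cartesian, and cartesian squares are closed under retracts.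

For 3 → 4, a cube is strongly cocartesian iff all its two-dimensional faces are cocartesian
(`star_iff_faces`); complementation gives the cartesian version. Conversely, 3 is the case `n = 2`
of 4.

Kan extensions are handled through bijections of hom-sets. By (Der4) they become, over a poset, the
vertexwise conditions `IsColimAt X S t` and `IsLimAt X S t`. Two rules then do the combinatorial
work: `S` may be replaced by a (co)reflective subset, and vertices that are already (co)limits over
`S` may be adjoined to `S`. -/

noncomputable section

namespace Prederivator

/-! ### Coherence laws of the 2-functor, componentwise -/

section Coherence

variable (D : Prederivator.{w, v, u})
variable {A B C E : Type w} [SmallCategory A] [SmallCategory B] [SmallCategory C]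
  [SmallCategory E]

@[simp]
lemma resMap_id (f : A ⥤ B) : D.resMap (𝟙 f) = 𝟙 (D.res f) :=
  congrArg Cat.Hom₂.toNatTrans (D.map₂_id f.toCatHom.op)

lemma resMap_comp {f g h : A ⥤ B} (α : f ⟶ g) (β : g ⟶ h) :
    D.resMap (α ≫ β) = D.resMap α ≫ D.resMap β :=
  congrArg Cat.Hom₂.toNatTrans (D.map₂_comp (Bicategory.Opposite.op2 (NatTrans.toCatHom₂ α))
    (Bicategory.Opposite.op2 (NatTrans.toCatHom₂ β)))

lemma resMap_comp_app {f g h : A ⥤ B} (α : f ⟶ g) (β : g ⟶ h) (X : D.Dia B) :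
    (D.resMap (α ≫ β)).app X = (D.resMap α).app X ≫ (D.resMap β).app X := by
  rw [resMap_comp, NatTrans.comp_app]

/-- Restriction along isomorphic functors. -/
def resIso {f g : A ⥤ B} (e : f ≅ g) : D.res f ≅ D.res g where
  hom := D.resMap e.hom
  inv := D.resMap e.inv
  hom_inv_id := by rw [← resMap_comp, e.hom_inv_id, resMap_id]
  inv_hom_id := by rw [← resMap_comp, e.inv_hom_id, resMap_id]

instance {f g : A ⥤ B} (α : f ⟶ g) [IsIso α] : IsIso (D.resMap α) :=
  (D.resIso (asIso α)).isIso_hom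

/-- Restriction along the identity functor. -/
def resId (A : Type w) [SmallCategory A] : D.res (𝟭 A) ≅ 𝟭 (D.Dia A) :=
  Cat.Hom.toNatIso (D.mapId (op (Cat.of A)))

/-- Composition is reversed in `Catᵒᵖ`, so whiskering on the left is governed by the
right-whiskering law of the 2-functor, and vice versa. -/
lemma resMap_whiskerLeft (f : E ⥤ A) {g h : A ⥤ B} (α : g ⟶ h) (X : D.Dia B) :
    (D.resMap (Functor.whiskerLeft f α)).app X ≫ (D.resComp f h).hom.app X =
      (D.resComp f g).hom.app X ≫ (D.res f).map ((D.resMap α).app X) := by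
  have := congrArg (fun t => Cat.Hom₂.toNatTrans t) (D.map₂_whisker_right
    (Bicategory.Opposite.op2 (NatTrans.toCatHom₂ α)) f.toCatHom.op)
  have := congrArg (fun t => t.app X) this
  change (D.resMap (Functor.whiskerLeft f α)).app X = (D.resComp f g).hom.app X ≫
    (D.res f).map ((D.resMap α).app X) ≫ (D.resComp f h).inv.app X at this
  rw [this]
  simp

lemma resMap_whiskerRight {f g : A ⥤ B} (α : f ⟶ g) (h : B ⥤ C) (X : D.Dia C) :
    (D.resMap (Functor.whiskerRight α h)).app X ≫ (D.resComp g h).hom.app X =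
      (D.resComp f h).hom.app X ≫ (D.resMap α).app ((D.res h).obj X) := by
  have := congrArg (fun t => Cat.Hom₂.toNatTrans t) (D.map₂_whisker_left h.toCatHom.op
    (Bicategory.Opposite.op2 (NatTrans.toCatHom₂ α)))
  have := congrArg (fun t => t.app X) this
  change (D.resMap (Functor.whiskerRight α h)).app X = (D.resComp f h).hom.app X ≫
    (D.resMap α).app ((D.res h).obj X) ≫ (D.resComp g h).inv.app X at this
  rw [this]
  simp

lemma resComp_assoc (f : E ⥤ A) (g : A ⥤ B) (h : B ⥤ C) (X : D.Dia C) :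
    (D.resComp (f ⋙ g) h).hom.app X ≫ (D.resComp f g).hom.app ((D.res h).obj X) =
      (D.resComp f (g ⋙ h)).hom.app X ≫ (D.res f).map ((D.resComp g h).hom.app X) := by
  have := congrArg (fun t => Cat.Hom₂.toNatTrans t) (D.mapComp_assoc_left_hom
    h.toCatHom.op g.toCatHom.op f.toCatHom.op)
  have := congrArg (fun t => t.app X) this
  change (D.resComp f (g ⋙ h)).hom.app X ≫ (D.res f).map ((D.resComp g h).hom.app X) =
    (D.resMap (𝟙 (f ⋙ g ⋙ h))).app X ≫ (D.resComp (f ⋙ g) h).hom.app X ≫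
      (D.resComp f g).hom.app ((D.res h).obj X) ≫ 𝟙 _ at this
  rw [this]
  simp

lemma resComp_id_left (f : A ⥤ B) (X : D.Dia B) :
    (D.resComp (𝟭 A) f).hom.app X ≫ (D.resId A).hom.app _ = 𝟙 ((D.res f).obj X) := by
  have := congrArg (fun t => Cat.Hom₂.toNatTrans t) (D.map₂_right_unitor f.toCatHom.op)
  have := congrArg (fun t => t.app X) this
  change (D.resMap (𝟙 f)).app X = (D.resComp (𝟭 A) f).hom.app X ≫
    (D.resId A).hom.app _ ≫ 𝟙 _ at this
  simpa using this.symm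

lemma resComp_id_right (f : A ⥤ B) (X : D.Dia B) :
    (D.resComp f (𝟭 B)).hom.app X ≫ (D.res f).map ((D.resId B).hom.app X) =
      𝟙 ((D.res f).obj X) := by
  have := congrArg (fun t => Cat.Hom₂.toNatTrans t) (D.map₂_left_unitor f.toCatHom.op)
  have := congrArg (fun t => t.app X) this
  change (D.resMap (𝟙 f)).app X = (D.resComp f (𝟭 B)).hom.app X ≫
    (D.res f).map ((D.resId B).hom.app X) ≫ 𝟙 _ at this
  simpa using this.symm

end Coherence

end Prederivator

/-! ### Invertibility of units, counits and adjuncts, tested on hom-sets -/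

namespace CategoryTheory.Adjunction

variable {C : Type*} {E : Type*} [Category* C] [Category* E] {F : C ⥤ E} {G : E ⥤ C}

lemma bijective_comp_of_isIso {X Y Z : C} (f : Y ⟶ Z) [IsIso f] :
    Function.Bijective (fun g : X ⟶ Y => g ≫ f) :=
  (isIso_iff_yoneda_map_bijective f).1 inferInstance X

lemma bijective_precomp_of_isIso {X Y Z : C} (f : X ⟶ Y) [IsIso f] :
    Function.Bijective (fun g : Y ⟶ Z => f ≫ g) :=
  (isIso_iff_coyoneda_map_bijective f).1 inferInstance Z

/-- Followed by composition with the counit, the map in question is the adjunction bijection. -/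
lemma bijective_left_map_of_isIso_counit (adj : F ⊣ G) (W : C) (V : E)
    [IsIso (adj.counit.app V)] :
    Function.Bijective (fun h : W ⟶ G.obj V => F.map h) := by
  refine (Function.Bijective.of_comp_iff'
    (bijective_comp_of_isIso (X := F.obj W) (adj.counit.app V)) _).1 ?_
  have h := (adj.homEquiv W V).symm.bijective
  refine (congrArg Function.Bijective ?_).mpr h
  funext k
  simp [adj.homEquiv_counit]

lemma bijective_right_map_of_isIso_unit (adj : F ⊣ G) (V : C) (W : E)
    [IsIso (adj.unit.app V)] :
    Function.Bijective (fun h : F.obj V ⟶ W => G.map h) := by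
  refine (Function.Bijective.of_comp_iff'
    (bijective_precomp_of_isIso (Z := G.obj W) (adj.unit.app V)) _).1 ?_
  have h := (adj.homEquiv V W).bijective
  refine (congrArg Function.Bijective ?_).mpr h
  funext k
  simp [adj.homEquiv_unit]

/-- Precomposition with the counit, followed by the adjunction bijection, is `G.map`. The resulting
criterion does not mention `F`, so being a Kan extension can be expressed without choosing one. -/
lemma isIso_counit_app_iff_bijective (adj : F ⊣ G) (X : E) :
    IsIso (adj.counit.app X) ↔
      ∀ Y : E, Function.Bijective (fun h : X ⟶ Y => G.map h) := by
  rw [isIso_iff_coyoneda_map_bijective]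
  refine forall_congr' fun Y => ?_
  rw [← Function.Bijective.of_comp_iff' (adj.homEquiv (G.obj X) Y).bijective]
  refine iff_of_eq (congrArg _ ?_)
  ext k
  simp [adj.homEquiv_unit]

lemma isIso_unit_app_iff_bijective (adj : F ⊣ G) (X : C) :
    IsIso (adj.unit.app X) ↔
      ∀ Y : C, Function.Bijective (fun h : Y ⟶ X => F.map h) := by
  rw [isIso_iff_yoneda_map_bijective]
  refine forall_congr' fun Y => ?_
  rw [← Function.Bijective.of_comp_iff' (adj.homEquiv Y (F.obj X)).symm.bijective]
  refine iff_of_eq (congrArg _ ?_)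
  ext k
  simp [adj.homEquiv_counit]

/-- Yoneda again, for an arbitrary adjunct; it is applied to the 2-cell of a comma square, where `f`
becomes a cocone and the criterion its universal property. -/
lemma isIso_homEquiv_symm_iff (adj : F ⊣ G) {X : C} {Z : E} (f : X ⟶ G.obj Z) :
    IsIso ((adj.homEquiv X Z).symm f) ↔
      ∀ Y : E, Function.Bijective (fun h : Z ⟶ Y => f ≫ G.map h) := by
  rw [isIso_iff_coyoneda_map_bijective]
  refine forall_congr' fun Y => ?_
  rw [← Function.Bijective.of_comp_iff' (adj.homEquiv X Y).bijective]
  refine iff_of_eq (congrArg _ ?_)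
  ext k
  simp [adj.homEquiv_unit, adj.homEquiv_counit]

lemma isIso_homEquiv_iff (adj : F ⊣ G) {X : C} {Z : E} (f : F.obj X ⟶ Z) :
    IsIso ((adj.homEquiv X Z) f) ↔
      ∀ Y : C, Function.Bijective (fun h : Y ⟶ X => F.map h ≫ f) := by
  rw [isIso_iff_yoneda_map_bijective]
  refine forall_congr' fun Y => ?_
  rw [← Function.Bijective.of_comp_iff' (adj.homEquiv Y Z).symm.bijective]
  refine iff_of_eq (congrArg _ ?_)
  ext k
  simp [adj.homEquiv_unit, adj.homEquiv_counit]

end CategoryTheory.Adjunction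

namespace Prederivator

/-! ### Adjunctions between small categories, transported to restriction functors -/

section Adjunctions

variable (D : Prederivator.{w, v, u})
variable {A B C E : Type w} [SmallCategory A] [SmallCategory B] [SmallCategory C]
  [SmallCategory E]

/-- A prederivator turns an adjunction `l ⊣ r` into an adjunction `r^* ⊣ l^*`. -/
def resAdj {l : A ⥤ B} {r : B ⥤ A} (adj : l ⊣ r) : D.res r ⊣ D.res l :=
  Adjunction.mkOfUnitCounit
    { unit := (D.resId A).inv ≫ D.resMap adj.unit ≫ (D.resComp l r).hom
      counit := (D.resComp r l).inv ≫ D.resMap adj.counit ≫ (D.resId B).hom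
      left_triangle := by
        ext W
        have h1 := D.resMap_whiskerLeft r adj.unit W
        have h2 := D.resMap_whiskerRight adj.counit r W
        have h3 := D.resComp_assoc r l r W
        have h4 := D.resComp_id_left r W
        have h5 := D.resComp_id_right r W
        have h6 := D.resMap_comp_app (Functor.whiskerLeft r adj.unit)
          (Functor.whiskerRight adj.counit r) W
        -- The right triangle identity of `l ⊣ r`; applying `D` to it yields the left triangle
        -- identity of `r^* ⊣ l^*`.
        have h7 : (Functor.whiskerLeft r adj.unit ≫ Functor.whiskerRight adj.counit r) =
          𝟙 _ := by ext; simp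
        rw [h7, resMap_id] at h6
        have h8 : (D.res r).map ((D.resId A).inv.app W) = (D.resComp r (𝟭 A)).hom.app W := by
          rw [← cancel_mono ((D.res r).map ((D.resId A).hom.app W)), h5, ← Functor.map_comp]
          simp
        simp only [NatTrans.comp_app, Functor.whiskerRight_app, Functor.associator_hom_app,
          Functor.whiskerLeft_app, Functor.map_comp, Category.id_comp, h8, Category.assoc]
        rw [← reassoc_of% h1, ← reassoc_of% h3]
        simp only [Iso.hom_inv_id_app_assoc]
        rw [← reassoc_of% h2]
        erw [h4]
        erw [← reassoc_of% h6]
        simp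
      right_triangle := by
        ext W
        have h1 := D.resMap_whiskerLeft l adj.counit W
        have h2 := D.resMap_whiskerRight adj.unit l W
        have h3 := D.resComp_assoc l r l W
        have h4 := D.resComp_id_left l W
        have h5 := D.resComp_id_right l W
        have h6 := D.resMap_comp_app (Functor.whiskerRight adj.unit l)
          (Functor.whiskerLeft l adj.counit) W
        have h7 : (Functor.whiskerRight adj.unit l ≫ Functor.whiskerLeft l adj.counit) =
          𝟙 _ := by ext; simp
        rw [h7, resMap_id] at h6
        have h8 : (D.resId A).inv.app ((D.res l).obj W) = (D.resComp (𝟭 A) l).hom.app W := by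
          rw [← cancel_mono ((D.resId A).hom.app ((D.res l).obj W)), h4]
          simp
        simp only [NatTrans.comp_app, Functor.whiskerRight_app, Functor.associator_inv_app,
          Functor.whiskerLeft_app, Functor.map_comp, Category.id_comp, h8, Category.assoc]
        rw [← reassoc_of% h2, reassoc_of% h3, ← Functor.map_comp_assoc, Iso.hom_inv_id_app,
          CategoryTheory.Functor.map_id, Category.id_comp, ← reassoc_of% h1]
        erw [h5]
        erw [← reassoc_of% h6]
        simp }

/-- Restriction along a functor `f` with a left adjoint `g` and invertible counit is bijective on
morphisms into objects restricted along `g`. -/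
lemma bijective_res_map_of_leftAdjoint {g : A ⥤ B} {f : B ⥤ A} (adj : g ⊣ f) [IsIso adj.counit]
    (W : D.Dia A) (V : D.Dia B) :
    Function.Bijective (fun h : W ⟶ (D.res g).obj V => (D.res f).map h) := by
  have : IsIso ((D.resAdj adj).counit.app V) := by
    dsimp [resAdj, Adjunction.mkOfUnitCounit]; infer_instance
  exact (D.resAdj adj).bijective_left_map_of_isIso_counit W V

/-- Restriction along a functor `f` with a right adjoint `g` and invertible unit is bijective on
morphisms out of objects restricted along `g`. -/
lemma bijective_res_map_of_rightAdjoint {f : B ⥤ A} {g : A ⥤ B} (adj : f ⊣ g) [IsIso adj.unit]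
    (W : D.Dia A) (V : D.Dia B) :
    Function.Bijective (fun h : (D.res g).obj V ⟶ W => (D.res f).map h) := by
  have : IsIso ((D.resAdj adj).unit.app V) := by
    dsimp [resAdj, Adjunction.mkOfUnitCounit]; infer_instance
  exact (D.resAdj adj).bijective_right_map_of_isIso_unit V W

/-- A terminal object is a right adjoint of the projection to the point. -/
def terminalAdj {K : Type w} [SmallCategory K] {k : K} (hk : IsTerminal k) (π : K ⥤ Pt.{w}) :
    π ⊣ pt k :=
  Adjunction.mkOfUnitCounit
    { unit := { app := fun x => hk.from x, naturality := fun _ _ _ => hk.hom_ext _ _ }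
      counit := { app := fun _ => eqToHom (Subsingleton.elim _ _) }
      left_triangle := by ext x; exact Subsingleton.elim _ _
      right_triangle := by ext x; exact hk.hom_ext _ _ }

/-- An initial object is a left adjoint of the projection to the point. -/
def initialAdj {K : Type w} [SmallCategory K] {k : K} (hk : IsInitial k) (π : K ⥤ Pt.{w}) :
    pt k ⊣ π :=
  Adjunction.mkOfUnitCounit
    { unit := { app := fun _ => eqToHom (Subsingleton.elim _ _) }
      counit := { app := fun x => hk.to x, naturality := fun _ _ _ => hk.hom_ext _ _ }
      left_triangle := by ext x; exact hk.hom_ext _ _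
      right_triangle := by ext x; exact Subsingleton.elim _ _ }

instance {K : Type w} [SmallCategory K] {k : K} (hk : IsTerminal k) (π : K ⥤ Pt.{w}) :
    IsIso (terminalAdj hk π).counit := by
  dsimp [terminalAdj]
  exact NatIso.isIso_of_isIso_app _

instance {K : Type w} [SmallCategory K] {k : K} (hk : IsInitial k) (π : K ⥤ Pt.{w}) :
    IsIso (initialAdj hk π).unit := by
  dsimp [initialAdj]
  exact NatIso.isIso_of_isIso_app _

end Adjunctions

end Prederivator

namespace Prederivator

/-! ### Kan extended diagrams, homotopy colimits and homotopy limits -/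

section Generated

variable (D : Prederivator.{w, v, u})
variable {A B C K K' : Type w} [SmallCategory A] [SmallCategory B] [SmallCategory C]
  [SmallCategory K] [SmallCategory K']

/-- A diagram `X` is left generated along `u` if it is a left Kan extension of its restriction
along `u`. -/
def IsLeft (u : A ⥤ B) (X : D.Dia B) : Prop :=
  ∀ Y : D.Dia B, Function.Bijective (fun f : X ⟶ Y => (D.res u).map f)

/-- A diagram `X` is right generated along `u` if it is a right Kan extension of its restriction
along `u`. -/
def IsRight (u : A ⥤ B) (X : D.Dia B) : Prop :=
  ∀ Y : D.Dia B, Function.Bijective (fun f : Y ⟶ X => (D.res u).map f)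

/-- The morphism `q^* X ⟶ π^* X_t` induced by a cocone `θ` on `q` with vertex `t`. -/
def coconeMap (X : D.Dia B) (q : K ⥤ B) (π : K ⥤ Pt.{w}) (t : B) (θ : q ⟶ π ⋙ pt t) :
    (D.res q).obj X ⟶ (D.res π).obj ((D.ev t).obj X) :=
  (D.resMap θ).app X ≫ (D.resComp π (pt t)).hom.app X

/-- The morphism `π^* X_t ⟶ q^* X` induced by a cone `θ` on `q` with vertex `t`. -/
def coneMap (X : D.Dia B) (q : K ⥤ B) (π : K ⥤ Pt.{w}) (t : B) (θ : π ⋙ pt t ⟶ q) :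
    (D.res π).obj ((D.ev t).obj X) ⟶ (D.res q).obj X :=
  (D.resComp π (pt t)).inv.app X ≫ (D.resMap θ).app X

/-- The value `X_t` is the homotopy colimit of `q^* X`. -/
def IsColim (X : D.Dia B) (q : K ⥤ B) (π : K ⥤ Pt.{w}) (t : B) (θ : q ⟶ π ⋙ pt t) : Prop :=
  ∀ Y : D.Dia Pt.{w}, Function.Bijective
    (fun h : (D.ev t).obj X ⟶ Y => D.coconeMap X q π t θ ≫ (D.res π).map h)

/-- The value `X_t` is the homotopy limit of `q^* X`. -/
def IsLim (X : D.Dia B) (q : K ⥤ B) (π : K ⥤ Pt.{w}) (t : B) (θ : π ⋙ pt t ⟶ q) : Prop :=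
  ∀ Y : D.Dia Pt.{w}, Function.Bijective
    (fun h : Y ⟶ (D.ev t).obj X => (D.res π).map h ≫ D.coneMap X q π t θ)

variable {D}

lemma coconeMap_whiskerLeft (X : D.Dia B) (q : K ⥤ B) (π : K ⥤ Pt.{w}) (t : B)
    (θ : q ⟶ π ⋙ pt t) (f : K' ⥤ K) :
    D.coconeMap X (f ⋙ q) (f ⋙ π) t (Functor.whiskerLeft f θ) ≫ (D.resComp f π).hom.app _ =
      (D.resComp f q).hom.app X ≫ (D.res f).map (D.coconeMap X q π t θ) := by
  have h1 := D.resMap_whiskerLeft f θ X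
  have h2 := D.resComp_assoc f π (pt t) X
  rw [coconeMap, coconeMap, Category.assoc, h2, Functor.map_comp]
  exact (reassoc_of% h1) _

lemma coneMap_whiskerLeft (X : D.Dia B) (q : K ⥤ B) (π : K ⥤ Pt.{w}) (t : B)
    (θ : π ⋙ pt t ⟶ q) (f : K' ⥤ K) :
    (D.resComp f π).hom.app _ ≫ (D.res f).map (D.coneMap X q π t θ) =
      D.coneMap X (f ⋙ q) (f ⋙ π) t (Functor.whiskerLeft f θ) ≫ (D.resComp f q).hom.app X := by
  have h1 := D.resMap_whiskerLeft f θ X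
  have h2 := D.resComp_assoc f π (pt t) X
  rw [← cancel_epi ((D.resComp (f ⋙ π) (pt t)).hom.app X), reassoc_of% h2, ← Functor.map_comp,
    coneMap, coneMap, Category.assoc, Iso.hom_inv_id_app_assoc, Iso.hom_inv_id_app_assoc]
  exact h1.symm

lemma resComp_hom_naturality (f : A ⥤ B) (g : B ⥤ C) {X Y : D.Dia C} (h : X ⟶ Y) :
    (D.res (f ⋙ g)).map h ≫ (D.resComp f g).hom.app Y =
      (D.resComp f g).hom.app X ≫ (D.res f).map ((D.res g).map h) :=
  (D.resComp f g).hom.naturality h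

lemma IsLeft.of_iso {u : A ⥤ B} {X X' : D.Dia B} (h : D.IsLeft u X) (e : X ≅ X') :
    D.IsLeft u X' := by
  intro Y
  have h1 := (h Y).comp (Adjunction.bijective_precomp_of_isIso (Z := Y) e.hom)
  refine (Function.Bijective.of_comp_iff' (Adjunction.bijective_precomp_of_isIso
    (Z := (D.res u).obj Y) ((D.res u).map e.hom)) _).1 ?_
  simpa [Function.comp_def] using h1

lemma IsRight.of_iso {u : A ⥤ B} {X X' : D.Dia B} (h : D.IsRight u X) (e : X ≅ X') :
    D.IsRight u X' := by
  intro Y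
  have h1 := (h Y).comp (Adjunction.bijective_comp_of_isIso (X := Y) e.inv)
  refine (Function.Bijective.of_comp_iff' (Adjunction.bijective_comp_of_isIso
    (X := (D.res u).obj Y) ((D.res u).map e.inv)) _).1 ?_
  simpa [Function.comp_def] using h1

lemma bijective_res_comp_iff (f : A ⥤ B) (g : B ⥤ C) (X Y : D.Dia C) :
    Function.Bijective (fun h : X ⟶ Y => (D.res (f ⋙ g)).map h) ↔
      Function.Bijective (fun h : X ⟶ Y => (D.res f).map ((D.res g).map h)) := by
  rw [← Function.Bijective.of_comp_iff' ((D.resComp f g).app X |>.homCongr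
    ((D.resComp f g).app Y)).bijective]
  refine iff_of_eq (congrArg _ (funext fun h => ?_))
  simp [Iso.homCongr]

/-- Restriction along `f ⋙ g` is restriction along `g` followed by restriction along `f`, and the
second map is bijective by hypothesis. This is transitivity of Kan extensions together with its
cancellation law. -/
lemma isLeft_comp_iff_of_isLeft_res {f : A ⥤ B} {g : B ⥤ C} {X : D.Dia C}
    (h : D.IsLeft f ((D.res g).obj X)) : D.IsLeft (f ⋙ g) X ↔ D.IsLeft g X := by
  refine forall_congr' fun Y => ?_
  rw [bijective_res_comp_iff]
  exact Function.Bijective.of_comp_iff' (h ((D.res g).obj Y)) _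

lemma isRight_comp_iff_of_isRight_res {f : A ⥤ B} {g : B ⥤ C} {X : D.Dia C}
    (h : D.IsRight f ((D.res g).obj X)) : D.IsRight (f ⋙ g) X ↔ D.IsRight g X := by
  refine forall_congr' fun Y => ?_
  rw [bijective_res_comp_iff]
  exact Function.Bijective.of_comp_iff' (h ((D.res g).obj Y)) _

lemma IsRight.of_retract {u : A ⥤ B} {X X' : D.Dia B} (h : D.IsRight u X) (e : Retract X' X) :
    D.IsRight u X' := by
  intro Y
  constructor
  · intro f g hfg
    rw [← cancel_mono e.i]
    refine (h Y).1 ?_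
    simpa using congrArg (· ≫ (D.res u).map e.i) hfg
  · intro k
    obtain ⟨l, hl⟩ := (h Y).2 (k ≫ (D.res u).map e.i)
    refine ⟨l ≫ e.r, ?_⟩
    dsimp only at hl ⊢
    rw [Functor.map_comp, hl, Category.assoc, ← Functor.map_comp, e.retract]
    simp

lemma IsLeft.of_retract {u : A ⥤ B} {X X' : D.Dia B} (h : D.IsLeft u X) (e : Retract X' X) :
    D.IsLeft u X' := by
  intro Y
  constructor
  · intro f g hfg
    rw [← cancel_epi e.r]
    refine (h Y).1 ?_
    simpa using congrArg ((D.res u).map e.r ≫ ·) hfg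
  · intro k
    obtain ⟨l, hl⟩ := (h Y).2 ((D.res u).map e.r ≫ k)
    refine ⟨e.i ≫ l, ?_⟩
    dsimp only at hl ⊢
    rw [Functor.map_comp, hl, ← Category.assoc, ← Functor.map_comp, e.retract]
    simp

/-- Cofinality of the reflective inclusion `f`: the constant diagram `π^* Y` is restricted along the
reflector `g`, so morphisms into it are determined by their restrictions along `f`. -/
lemma isColim_whiskerLeft_iff (X : D.Dia B) (q : K ⥤ B) (π : K ⥤ Pt.{w}) (t : B)
    (θ : q ⟶ π ⋙ pt t) {f : K' ⥤ K} {g : K ⥤ K'} (adj : g ⊣ f) [IsIso adj.counit] :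
    D.IsColim X (f ⋙ q) (f ⋙ π) t (Functor.whiskerLeft f θ) ↔ D.IsColim X q π t θ := by
  refine forall_congr' fun Y => ?_
  have h1 : D.IsRight f ((D.res π).obj Y) := by
    obtain ⟨π', rfl⟩ : ∃ π' : K' ⥤ Pt.{w}, π = g ⋙ π' := ⟨f ⋙ π, Functor.punit_ext' _ _⟩
    exact IsRight.of_iso (fun W => bijective_res_map_of_leftAdjoint D adj W ((D.res π').obj Y))
      ((D.resComp g π').app Y).symm
  rw [← Function.Bijective.of_comp_iff' (h1 _), ← Function.Bijective.of_comp_iff'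
    ((D.resComp f q).app X |>.homCongr ((D.resComp f π).app Y)).symm.bijective]
  refine iff_of_eq (congrArg _ (funext fun h => ?_))
  have h2 := coconeMap_whiskerLeft X q π t θ f
  simp only [Function.comp_apply, Iso.homCongr_symm, Iso.homCongr_apply, Iso.symm_inv,
    Iso.symm_hom, Iso.app_hom, Iso.app_inv, Functor.map_comp, Category.assoc]
  rw [← reassoc_of% h2]
  rw [← reassoc_of% (resComp_hom_naturality (D := D) f π h)]
  simp

lemma isLim_whiskerLeft_iff (X : D.Dia B) (q : K ⥤ B) (π : K ⥤ Pt.{w}) (t : B)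
    (θ : π ⋙ pt t ⟶ q) {f : K' ⥤ K} {g : K ⥤ K'} (adj : f ⊣ g) [IsIso adj.unit] :
    D.IsLim X (f ⋙ q) (f ⋙ π) t (Functor.whiskerLeft f θ) ↔ D.IsLim X q π t θ := by
  refine forall_congr' fun Y => ?_
  have h1 : D.IsLeft f ((D.res π).obj Y) := by
    obtain ⟨π', rfl⟩ : ∃ π' : K' ⥤ Pt.{w}, π = g ⋙ π' := ⟨f ⋙ π, Functor.punit_ext' _ _⟩
    exact IsLeft.of_iso (fun W => bijective_res_map_of_rightAdjoint D adj W ((D.res π').obj Y))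
      ((D.resComp g π').app Y).symm
  rw [← Function.Bijective.of_comp_iff' (h1 _), ← Function.Bijective.of_comp_iff'
    ((D.resComp f π).app Y |>.homCongr ((D.resComp f q).app X)).symm.bijective]
  refine iff_of_eq (congrArg _ (funext fun h => ?_))
  have h2 := coneMap_whiskerLeft X q π t θ f
  simp only [Function.comp_apply, Iso.homCongr_symm, Iso.homCongr_apply, Iso.symm_inv,
    Iso.symm_hom, Iso.app_hom, Iso.app_inv, Functor.map_comp, Category.assoc]
  rw [← reassoc_of% (resComp_hom_naturality (D := D) f π h), reassoc_of% h2]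
  simp

end Generated

/-! ### The comma-square formula and fully faithful Kan extensions -/

section Pointwise

variable (D : Prederivator.{w, v, u})
variable {A B C K K' : Type w} [SmallCategory A] [SmallCategory B] [SmallCategory C]
  [SmallCategory K] [SmallCategory K']

lemma resSquare_comma_left (u : A ⥤ B) (b : B) (X : D.Dia B) :
    (D.resSquare (Comma.natTrans u (pt b))).app X = (D.resComp (Comma.fst u (pt b)) u).inv.app X ≫
      D.coconeMap X (Comma.fst u (pt b) ⋙ u) (Comma.snd u (pt b)) b (Comma.natTrans u (pt b)) :=
  rfl

lemma resSquare_comma_right (u : A ⥤ B) (b : B) (X : D.Dia B) :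
    (D.resSquare (Comma.natTrans (pt b) u)).app X =
      D.coneMap X (Comma.snd (pt b) u ⋙ u) (Comma.fst (pt b) u) b (Comma.natTrans (pt b) u) ≫
        (D.resComp (Comma.snd (pt b) u) u).hom.app X := by
  simp [resSquare, coneMap]

lemma isIso_res_map_coconeMap {K K' : Type w} [SmallCategory K] [SmallCategory K'] {X : D.Dia B}
    {q : K ⥤ B} {π : K ⥤ Pt.{w}} {t : B} (θ : q ⟶ π ⋙ pt t) (f : K' ⥤ K)
    [IsIso ((D.resMap (Functor.whiskerLeft f θ)).app X)] :
    IsIso ((D.res f).map (D.coconeMap X q π t θ)) := by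
  rw [← isIso_comp_left_iff ((D.resComp f q).hom.app X), ← coconeMap_whiskerLeft, coconeMap]
  infer_instance

lemma isIso_res_map_coneMap {K K' : Type w} [SmallCategory K] [SmallCategory K'] {X : D.Dia B}
    {q : K ⥤ B} {π : K ⥤ Pt.{w}} {t : B} (θ : π ⋙ pt t ⟶ q) (f : K' ⥤ K)
    [IsIso ((D.resMap (Functor.whiskerLeft f θ)).app X)] :
    IsIso ((D.res f).map (D.coneMap X q π t θ)) := by
  rw [← isIso_comp_left_iff ((D.resComp f π).hom.app _), coneMap_whiskerLeft, coneMap]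
  infer_instance

lemma isIso_whiskerLeft_pt {K : Type w} [SmallCategory K] {q q' : K ⥤ B} (θ : q ⟶ q') (k : K)
    [h : IsIso (θ.app k)] : IsIso (Functor.whiskerLeft (pt k) θ) := by
  rw [NatTrans.isIso_iff_isIso_app]
  exact fun _ => h

variable [D.HasKanExtensions]

lemma isLeft_iff_isIso_counit (u : A ⥤ B) (X : D.Dia B) :
    D.IsLeft u X ↔ IsIso ((D.lanAdj u).counit.app X) :=
  ((D.lanAdj u).isIso_counit_app_iff_bijective X).symm

lemma isRight_iff_isIso_unit (u : A ⥤ B) (X : D.Dia B) :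
    D.IsRight u X ↔ IsIso ((D.ranAdj u).unit.app X) :=
  ((D.ranAdj u).isIso_unit_app_iff_bijective X).symm

lemma unit_lanMate (u : A ⥤ B) (b : B) (Z : D.Dia A) :
    (D.res (Comma.fst u (pt b))).map ((D.lanAdj u).unit.app Z) ≫
      (D.resSquare (Comma.natTrans u (pt b))).app ((D.lan u).obj Z) =
    (D.lanAdj (Comma.snd u (pt b))).unit.app _ ≫
      (D.res (Comma.snd u (pt b))).map ((D.lanMate u b).app Z) :=
  unit_mateEquiv_symm (D.lanAdj u) (D.lanAdj (Comma.snd u (pt b)))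
    (TwoSquare.mk _ _ _ _ (D.resSquare (Comma.natTrans u (pt b)))) Z

lemma ranMate_counit (u : A ⥤ B) (b : B) (Z : D.Dia A) :
    (D.res (Comma.fst (pt b) u)).map ((D.ranMate u b).app Z) ≫
      (D.ranAdj (Comma.fst (pt b) u)).counit.app _ =
    (D.resSquare (Comma.natTrans (pt b) u)).app ((D.ran u).obj Z) ≫
      (D.res (Comma.snd (pt b) u)).map ((D.ranAdj u).counit.app Z) :=
  mateEquiv_counit (D.ranAdj u) (D.ranAdj (Comma.fst (pt b) u))
    (TwoSquare.mk _ _ _ _ (D.resSquare (Comma.natTrans (pt b) u))) Z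

end Pointwise

section Derivator

variable (D : Prederivator.{w, v, u}) [D.IsDerivator]
variable {A B : Type w} [SmallCategory A] [SmallCategory B]

instance (u : A ⥤ B) (b : B) : IsIso (D.lanMate u b) := IsDerivator.der4_left u b

instance (u : A ⥤ B) (b : B) : IsIso (D.ranMate u b) := IsDerivator.der4_right u b

/-- Left generated diagrams are computed pointwise by homotopy colimits. -/
theorem isLeft_iff_isColim (u : A ⥤ B) (X : D.Dia B) :
    D.IsLeft u X ↔ ∀ b, D.IsColim X (Comma.fst u (pt b) ⋙ u) (Comma.snd u (pt b)) b
      (Comma.natTrans u (pt b)) := by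
  rw [isLeft_iff_isIso_counit, IsDerivator.der2]
  refine forall_congr' fun b => ?_
  -- The adjunct of the comma cocone is the mate of (Der4), an isomorphism, followed by the counit
  -- at `b`. So the counit is invertible at `b` iff the cocone is universal.
  have h1 : ((D.lanAdj (Comma.snd u (pt b))).homEquiv _ _).symm
      ((D.resSquare (Comma.natTrans u (pt b))).app X) =
      (D.lanMate u b).app ((D.res u).obj X) ≫ (D.ev b).map ((D.lanAdj u).counit.app X) := by
    rw [Equiv.symm_apply_eq, Adjunction.homEquiv_unit, Functor.map_comp, ← Category.assoc]
    erw [← D.unit_lanMate u b ((D.res u).obj X)]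
    have h := (D.resSquare (Comma.natTrans u (pt b))).naturality ((D.lanAdj u).counit.app X)
    rw [Category.assoc]
    erw [← h]
    rw [Functor.comp_map, ← Functor.map_comp_assoc]
    simp
  have h2 := (D.lanAdj (Comma.snd u (pt b))).isIso_homEquiv_symm_iff
    ((D.resSquare (Comma.natTrans u (pt b))).app X)
  rw [h1, isIso_comp_left_iff] at h2
  rw [h2]
  refine forall_congr' fun Y => ?_
  rw [resSquare_comma_left]
  exact (Function.Bijective.of_comp_iff' (Adjunction.bijective_precomp_of_isIso
    ((D.resComp (Comma.fst u (pt b)) u).inv.app X)) _).symm.trans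
      (iff_of_eq (congrArg _ (funext fun h => by simp))) |>.symm

/-- Right generated diagrams are computed pointwise by homotopy limits. -/
theorem isRight_iff_isLim (u : A ⥤ B) (X : D.Dia B) :
    D.IsRight u X ↔ ∀ b, D.IsLim X (Comma.snd (pt b) u ⋙ u) (Comma.fst (pt b) u) b
      (Comma.natTrans (pt b) u) := by
  rw [isRight_iff_isIso_unit, IsDerivator.der2]
  refine forall_congr' fun b => ?_
  have h1 : ((D.ranAdj (Comma.fst (pt b) u)).homEquiv _ _)
      ((D.resSquare (Comma.natTrans (pt b) u)).app X) =
      (D.ev b).map ((D.ranAdj u).unit.app X) ≫ (D.ranMate u b).app ((D.res u).obj X) := by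
    rw [← Equiv.eq_symm_apply, Adjunction.homEquiv_counit, Functor.map_comp, Category.assoc]
    erw [D.ranMate_counit u b ((D.res u).obj X)]
    have h := (D.resSquare (Comma.natTrans (pt b) u)).naturality ((D.ranAdj u).unit.app X)
    erw [reassoc_of% h]
    rw [← Functor.map_comp]
    simp
  have h2 := (D.ranAdj (Comma.fst (pt b) u)).isIso_homEquiv_iff
    ((D.resSquare (Comma.natTrans (pt b) u)).app X)
  rw [h1, isIso_comp_right_iff] at h2
  rw [h2]
  refine forall_congr' fun Y => ?_
  rw [resSquare_comma_right]
  exact (Function.Bijective.of_comp_iff' (Adjunction.bijective_comp_of_isIso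
    ((D.resComp (Comma.snd (pt b) u) u).hom.app X)) _).symm.trans
      (iff_of_eq (congrArg _ (funext fun h => by simp))) |>.symm

/-- The value of a Kan extension unit at a terminal object is invertible. -/
lemma isIso_res_map_unit_of_isTerminal {K : Type w} [SmallCategory K] {k : K} (hk : IsTerminal k)
    (π : K ⥤ Pt.{w}) (W : D.Dia K) :
    IsIso ((D.res (pt k)).map ((D.lanAdj π).unit.app W)) := by
  -- Evaluation at `k` is itself a left adjoint of `π^*`, because `π ⊣ pt k`. Its unit is visibly
  -- invertible at `k`, and uniqueness of left adjoints transfers this to the chosen one.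
  let adj := D.resAdj (terminalAdj hk π)
  have h1 : IsIso adj.counit := by
    dsimp [adj, resAdj, Adjunction.mkOfUnitCounit]; infer_instance
  have h2 : (D.res (pt k)).map (adj.unit.app W) ≫ adj.counit.app _ = 𝟙 _ :=
    adj.left_triangle_components W
  have h3 : IsIso ((D.res (pt k)).map (adj.unit.app W)) := by
    rw [← isIso_comp_right_iff _ (adj.counit.app ((D.res (pt k)).obj W)), h2]
    infer_instance
  rw [← Adjunction.unit_leftAdjointUniq_hom_app (D.lanAdj π) adj W, Functor.map_comp,
    isIso_comp_right_iff] at h3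
  exact h3

/-- The value of a Kan extension counit at an initial object is invertible. -/
lemma isIso_res_map_counit_of_isInitial {K : Type w} [SmallCategory K] {k : K} (hk : IsInitial k)
    (π : K ⥤ Pt.{w}) (W : D.Dia K) :
    IsIso ((D.res (pt k)).map ((D.ranAdj π).counit.app W)) := by
  let adj := D.resAdj (initialAdj hk π)
  have h1 : IsIso adj.unit := by
    dsimp [adj, resAdj, Adjunction.mkOfUnitCounit]; infer_instance
  have h2 : adj.unit.app _ ≫ (D.res (pt k)).map (adj.counit.app W) = 𝟙 _ :=
    adj.right_triangle_components W
  have h3 : IsIso ((D.res (pt k)).map (adj.counit.app W)) := by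
    rw [← isIso_comp_left_iff (adj.unit.app ((D.res (pt k)).obj W)), h2]
    infer_instance
  rw [← Adjunction.rightAdjointUniq_hom_app_counit adj (D.ranAdj π) W, Functor.map_comp,
    isIso_comp_left_iff] at h3
  exact h3

/-- The left Kan extension along a fully faithful functor is fully faithful. -/
instance isIso_lanAdj_unit (u : A ⥤ B) [u.Full] [u.Faithful] : IsIso (D.lanAdj u).unit := by
  rw [NatTrans.isIso_iff_isIso_app]
  intro Z
  rw [IsDerivator.der2]
  intro a
  -- Full faithfulness of `u` makes the identity of `u.obj a` a terminal object of the comma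
  -- category, so the colimit there is the value at `a`.
  let k : Comma u (pt.{w} (u.obj a)) := ⟨a, ⟨⟨⟩⟩, 𝟙 _⟩
  have hk : IsTerminal k := IsTerminal.ofUniqueHom
    (fun x => { left := u.preimage x.hom, right := eqToHom (Subsingleton.elim _ _) })
    fun x m => by
      ext
      · refine u.map_injective ?_
        have := m.w
        simpa [k] using this
      · exact Subsingleton.elim _ _
  -- The defining square of the mate, evaluated at `k`. All its maps other than the desired unit are
  -- invertible: the mate by (Der4), the unit along `π` by terminality of `k`, the comma cell since
  -- it is an identity at `k`.
  have h1 := congrArg (D.res (pt k)).map (D.unit_lanMate u (u.obj a) Z)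
  have h2 := D.isIso_res_map_unit_of_isTerminal hk (Comma.snd u (pt (u.obj a)))
    ((D.res (Comma.fst u (pt (u.obj a)))).obj Z)
  have h3 : IsIso ((Comma.natTrans u (pt.{w} (u.obj a))).app k) := by
    change IsIso (𝟙 _); infer_instance
  have h4 := isIso_whiskerLeft_pt (Comma.natTrans u (pt (u.obj a))) k
  rw [resSquare_comma_left, Functor.map_comp, Functor.map_comp, Functor.map_comp] at h1
  have h5 := D.isIso_res_map_coconeMap (X := (D.lan u).obj Z)
    (Comma.natTrans u (pt.{w} (u.obj a))) (pt k)
  have h6 : IsIso ((D.res (pt k)).map ((D.res (Comma.fst u (pt (u.obj a)))).map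
      ((D.lanAdj u).unit.app Z))) := by
    rw [← isIso_comp_right_iff _ ((D.res (pt k)).map
      ((D.resComp (Comma.fst u (pt (u.obj a))) u).inv.app ((D.lan u).obj Z)) ≫
      (D.res (pt k)).map (D.coconeMap ((D.lan u).obj Z) _ _ _
        (Comma.natTrans u (pt.{w} (u.obj a)))))]
    erw [h1]
    infer_instance
  change IsIso ((D.res (pt k ⋙ Comma.fst u (pt (u.obj a)))).map ((D.lanAdj u).unit.app Z))
  rw [← isIso_comp_right_iff _ ((D.resComp _ _).hom.app _), resComp_hom_naturality]
  infer_instance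

/-- The right Kan extension along a fully faithful functor is fully faithful. -/
instance isIso_ranAdj_counit (u : A ⥤ B) [u.Full] [u.Faithful] : IsIso (D.ranAdj u).counit := by
  rw [NatTrans.isIso_iff_isIso_app]
  intro Z
  rw [IsDerivator.der2]
  intro a
  let k : Comma (pt.{w} (u.obj a)) u := ⟨⟨⟨⟩⟩, a, 𝟙 _⟩
  have hk : IsInitial k := IsInitial.ofUniqueHom
    (fun x => { left := eqToHom (Subsingleton.elim _ _), right := u.preimage x.hom })
    fun x m => by
      ext
      · exact Subsingleton.elim _ _
      · refine u.map_injective ?_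
        have := m.w
        simpa [k] using this.symm
  have h1 := congrArg (D.res (pt k)).map (D.ranMate_counit u (u.obj a) Z)
  have h2 := D.isIso_res_map_counit_of_isInitial hk (Comma.fst (pt (u.obj a)) u)
    ((D.res (Comma.snd (pt (u.obj a)) u)).obj Z)
  have h3 : IsIso ((Comma.natTrans (pt.{w} (u.obj a)) u).app k) := by
    change IsIso (𝟙 _); infer_instance
  have h4 := isIso_whiskerLeft_pt (Comma.natTrans (pt (u.obj a)) u) k
  rw [resSquare_comma_right, Functor.map_comp, Functor.map_comp, Functor.map_comp] at h1
  have h5 := D.isIso_res_map_coneMap (X := (D.ran u).obj Z)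
    (Comma.natTrans (pt.{w} (u.obj a)) u) (pt k)
  have h6 : IsIso ((D.res (pt k)).map ((D.res (Comma.snd (pt (u.obj a)) u)).map
      ((D.ranAdj u).counit.app Z))) := by
    rw [← isIso_comp_left_iff ((D.res (pt k)).map (D.coneMap ((D.ran u).obj Z) _ _ _
        (Comma.natTrans (pt.{w} (u.obj a)) u)) ≫ (D.res (pt k)).map
      ((D.resComp (Comma.snd (pt (u.obj a)) u) u).hom.app ((D.ran u).obj Z)))]
    erw [← h1]
    infer_instance
  change IsIso ((D.res (pt k ⋙ Comma.snd (pt (u.obj a)) u)).map ((D.ranAdj u).counit.app Z))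
  rw [← isIso_comp_right_iff _ ((D.resComp _ _).hom.app _), resComp_hom_naturality]
  infer_instance

instance (u : A ⥤ B) [u.Full] [u.Faithful] : (D.lan u).Full :=
  (D.lanAdj u).fullyFaithfulLOfIsIsoUnit.full

instance (u : A ⥤ B) [u.Full] [u.Faithful] : (D.lan u).Faithful :=
  (D.lanAdj u).fullyFaithfulLOfIsIsoUnit.faithful

instance (u : A ⥤ B) [u.Full] [u.Faithful] : (D.ran u).Full :=
  (D.ranAdj u).fullyFaithfulROfIsIsoCounit.full

instance (u : A ⥤ B) [u.Full] [u.Faithful] : (D.ran u).Faithful :=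
  (D.ranAdj u).fullyFaithfulROfIsIsoCounit.faithful

/-- The essential image of `u_!` for a fully faithful functor `u`. -/
lemma essImage_lan_iff (u : A ⥤ B) [u.Full] [u.Faithful] (X : D.Dia B) :
    (D.lan u).essImage X ↔ D.IsLeft u X := by
  rw [isLeft_iff_isIso_counit]
  exact ((D.lanAdj u).isIso_counit_app_iff_mem_essImage).symm

/-- The essential image of `u_*` for a fully faithful functor `u`. -/
lemma essImage_ran_iff (u : A ⥤ B) [u.Full] [u.Faithful] (X : D.Dia B) :
    (D.ran u).essImage X ↔ D.IsRight u X := by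
  rw [isRight_iff_isIso_unit]
  exact ((D.ranAdj u).isIso_unit_app_iff_mem_essImage).symm

lemma isRight_ran_obj (j : A ⥤ B) [j.Full] [j.Faithful] (x : D.Dia A) :
    D.IsRight j ((D.ran j).obj x) :=
  (D.essImage_ran_iff j _).1 ((D.ran j).obj_mem_essImage x)

lemma isLeft_lan_obj (j : A ⥤ B) [j.Full] [j.Faithful] (x : D.Dia A) :
    D.IsLeft j ((D.lan j).obj x) :=
  (D.essImage_lan_iff j _).1 ((D.lan j).obj_mem_essImage x)

end Derivator

end Prederivator

namespace Prederivator

/-! ### Homotopy (co)limits over shapes with an extremal object and over the empty shape -/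

section Point

variable {D : Prederivator.{w, v, u}}
variable {B K : Type w} [SmallCategory B] [SmallCategory K]

lemma bijective_res_endofunctor_pt (π : Pt.{w} ⥤ Pt.{w}) (X Y : D.Dia Pt.{w}) :
    Function.Bijective (fun h : X ⟶ Y => (D.res π).map h) := by
  obtain rfl : π = 𝟭 _ := Functor.punit_ext' _ _
  exact ((Functor.FullyFaithful.id _).ofIso (D.resId Pt).symm).map_bijective X Y

lemma isColim_pt_iff (X : D.Dia B) (q : Pt.{w} ⥤ B) (π : Pt.{w} ⥤ Pt.{w}) (t : B)
    (θ : q ⟶ π ⋙ pt t) : D.IsColim X q π t θ ↔ IsIso ((D.resMap θ).app X) := by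
  rw [← isIso_comp_right_iff _ ((D.resComp π (pt t)).hom.app X)]
  change _ ↔ IsIso (D.coconeMap X q π t θ)
  rw [isIso_iff_coyoneda_map_bijective]
  have h (Y : D.Dia Pt.{w}) : Function.Bijective
      (fun h : (D.ev t).obj X ⟶ Y => D.coconeMap X q π t θ ≫ (D.res π).map h) ↔
      Function.Bijective (fun h : (D.res π).obj ((D.ev t).obj X) ⟶ (D.res π).obj Y =>
        D.coconeMap X q π t θ ≫ h) :=
    Function.Bijective.of_comp_iff
      (fun h : (D.res π).obj ((D.ev t).obj X) ⟶ (D.res π).obj Y => D.coconeMap X q π t θ ≫ h)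
      (bijective_res_endofunctor_pt π ((D.ev t).obj X) Y)
  obtain rfl : π = 𝟭 _ := Functor.punit_ext' _ _
  refine ⟨fun H Z => ?_, fun H Y => (h Y).2 (H _)⟩
  have h1 := (h Z).1 (H Z)
  let e := (D.resId Pt).app Z
  have h2 := (Adjunction.bijective_comp_of_isIso (X := (D.res q).obj X) e.hom).comp
    (h1.comp (Adjunction.bijective_comp_of_isIso
      (X := (D.res (𝟭 Pt)).obj ((D.ev t).obj X)) e.inv))
  simpa [Function.comp_def] using h2

lemma isLim_pt_iff (X : D.Dia B) (q : Pt.{w} ⥤ B) (π : Pt.{w} ⥤ Pt.{w}) (t : B)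
    (θ : π ⋙ pt t ⟶ q) : D.IsLim X q π t θ ↔ IsIso ((D.resMap θ).app X) := by
  rw [← isIso_comp_left_iff ((D.resComp π (pt t)).inv.app X)]
  change _ ↔ IsIso (D.coneMap X q π t θ)
  rw [isIso_iff_yoneda_map_bijective]
  have h (Y : D.Dia Pt.{w}) : Function.Bijective
      (fun h : Y ⟶ (D.ev t).obj X => (D.res π).map h ≫ D.coneMap X q π t θ) ↔
      Function.Bijective (fun h : (D.res π).obj Y ⟶ (D.res π).obj ((D.ev t).obj X) =>
        h ≫ D.coneMap X q π t θ) :=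
    Function.Bijective.of_comp_iff
      (fun h : (D.res π).obj Y ⟶ (D.res π).obj ((D.ev t).obj X) => h ≫ D.coneMap X q π t θ)
      (bijective_res_endofunctor_pt π Y ((D.ev t).obj X))
  obtain rfl : π = 𝟭 _ := Functor.punit_ext' _ _
  refine ⟨fun H Z => ?_, fun H Y => (h Y).2 (H _)⟩
  have h1 := (h Z).1 (H Z)
  let e := (D.resId Pt).app Z
  have h2 := (Adjunction.bijective_precomp_of_isIso (Z := (D.res q).obj X) e.inv).comp
    (h1.comp (Adjunction.bijective_precomp_of_isIso
      (Z := (D.res (𝟭 Pt)).obj ((D.ev t).obj X)) e.hom))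
  simpa [Function.comp_def] using h2

lemma isColim_iff_of_isTerminal (X : D.Dia B) (q : K ⥤ B) (π : K ⥤ Pt.{w}) (t : B)
    (θ : q ⟶ π ⋙ pt t) {k : K} (hk : IsTerminal k) :
    D.IsColim X q π t θ ↔ IsIso ((D.resMap (Functor.whiskerLeft (pt k) θ)).app X) := by
  rw [← isColim_whiskerLeft_iff X q π t θ (terminalAdj hk π)]
  exact isColim_pt_iff ..

lemma isLim_iff_of_isInitial (X : D.Dia B) (q : K ⥤ B) (π : K ⥤ Pt.{w}) (t : B)
    (θ : π ⋙ pt t ⟶ q) {k : K} (hk : IsInitial k) :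
    D.IsLim X q π t θ ↔ IsIso ((D.resMap (Functor.whiskerLeft (pt k) θ)).app X) := by
  rw [← isLim_whiskerLeft_iff X q π t θ (initialAdj hk π)]
  exact isLim_pt_iff ..

end Point

section Empty

variable {D : Prederivator.{w, v, u}}
variable {B K K' : Type w} [SmallCategory B] [SmallCategory K] [SmallCategory K']

lemma bijective_res_of_isEquivalence (E : K ⥤ K') [E.IsEquivalence] (W V : D.Dia K') :
    Function.Bijective (fun h : W ⟶ V => (D.res E).map h) := by
  have h : D.IsRight E ((D.res E.inv).obj ((D.res E).obj V)) := fun W =>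
    bijective_res_map_of_leftAdjoint D E.asEquivalence.symm.toAdjunction W ((D.res E).obj V)
  exact h.of_iso ((D.resComp E.inv E).symm.app V ≪≫
    (D.resIso E.asEquivalence.counitIso).app V ≪≫ (D.resId K').app V) W

variable [D.IsDerivator]

/-- (Der1) for the empty family: an empty shape is equivalent to the empty coproduct, whose diagram
category is equivalent to an empty product of categories. -/
lemma nonempty_unique_hom_of_isEmpty [IsEmpty K] (W V : D.Dia K) : Nonempty (Unique (W ⟶ V)) := by
  let A : PEmpty.{w + 1} → Type w := fun _ => PEmpty.{w + 1}
  have (i : PEmpty.{w + 1}) : SmallCategory (A i) := i.elim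
  have h0 := IsDerivator.der1 (D := D) A
  have : IsEmpty (Σ i, A i) := ⟨fun x => x.1.elim⟩
  let E : (Σ i, A i) ⥤ K :=
    { obj := fun x => x.1.elim
      map := fun {x} => x.1.elim
      map_id := fun x => x.1.elim
      map_comp := fun {x} => x.1.elim }
  have : E.IsEquivalence :=
    { faithful := ⟨fun {x} => x.1.elim⟩
      full := ⟨fun {x} => x.1.elim⟩
      essSurj := ⟨fun x => isEmptyElim x⟩ }
  have h1 := bijective_res_of_isEquivalence (D := D) E W V
  have h2 := (Functor.FullyFaithful.ofFullyFaithful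
    (Functor.pi' fun i => D.res (Sigma.incl (C := A) i))).map_bijective ((D.res E).obj W)
      ((D.res E).obj V)
  have e := (Equiv.ofBijective _ h1).trans (Equiv.ofBijective _ h2)
  have : Unique ((Functor.pi' fun i => D.res (Sigma.incl (C := A) i)).obj ((D.res E).obj W) ⟶
      (Functor.pi' fun i => D.res (Sigma.incl (C := A) i)).obj ((D.res E).obj V)) :=
    { default := fun i => i.elim
      uniq := fun f => funext fun i => i.elim }
  exact ⟨e.unique⟩

lemma isColim_iff_of_isEmpty [IsEmpty K] (X : D.Dia B) (q : K ⥤ B) (π : K ⥤ Pt.{w}) (t : B)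
    (θ : q ⟶ π ⋙ pt t) : D.IsColim X q π t θ ↔ Nonempty (IsInitial ((D.ev t).obj X)) := by
  constructor
  · intro h
    refine ⟨IsInitial.ofUnique (h := fun Y => ?_) _⟩
    have := (nonempty_unique_hom_of_isEmpty ((D.res q).obj X) ((D.res π).obj Y)).some
    exact (Equiv.ofBijective _ (h Y)).unique
  · rintro ⟨h⟩ Y
    have := (nonempty_unique_hom_of_isEmpty ((D.res q).obj X) ((D.res π).obj Y)).some
    exact ⟨fun _ _ _ => h.hom_ext _ _, fun _ => ⟨h.to _, Subsingleton.elim _ _⟩⟩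

lemma isLim_iff_of_isEmpty [IsEmpty K] (X : D.Dia B) (q : K ⥤ B) (π : K ⥤ Pt.{w}) (t : B)
    (θ : π ⋙ pt t ⟶ q) : D.IsLim X q π t θ ↔ Nonempty (IsTerminal ((D.ev t).obj X)) := by
  constructor
  · intro h
    refine ⟨IsTerminal.ofUnique (h := fun Y => ?_) _⟩
    have := (nonempty_unique_hom_of_isEmpty ((D.res π).obj Y) ((D.res q).obj X)).some
    exact (Equiv.ofBijective _ (h Y)).unique
  · rintro ⟨h⟩ Y
    have := (nonempty_unique_hom_of_isEmpty ((D.res π).obj Y) ((D.res q).obj X)).some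
    exact ⟨fun _ _ _ => h.hom_ext _ _, fun _ => ⟨h.from _, Subsingleton.elim _ _⟩⟩

end Empty

end Prederivator

namespace Prederivator

/-! ### Colimits and limits over subsets of posets -/

section Transport

variable {D : Prederivator.{w, v, u}}
variable {P Q K : Type w} [PartialOrder P] [PartialOrder Q] [SmallCategory K]

/-- Parallel 2-cells into a poset coincide and functors to the point are unique, so only the diagram
`q` and the vertex `t` matter. -/
lemma isColim_congr (X : D.Dia P) {q q' : K ⥤ P} {π π' : K ⥤ Pt.{w}} {t : P}
    (θ : q ⟶ π ⋙ pt t) (θ' : q' ⟶ π' ⋙ pt t) (h : q = q') :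
    D.IsColim X q π t θ ↔ D.IsColim X q' π' t θ' := by
  subst h
  obtain rfl : π = π' := Functor.punit_ext' _ _
  obtain rfl : θ = θ' := by ext x; exact Subsingleton.elim _ _
  rfl

lemma isLim_congr (X : D.Dia P) {q q' : K ⥤ P} {π π' : K ⥤ Pt.{w}} {t : P}
    (θ : π ⋙ pt t ⟶ q) (θ' : π' ⋙ pt t ⟶ q') (h : q = q') :
    D.IsLim X q π t θ ↔ D.IsLim X q' π' t θ' := by
  subst h
  obtain rfl : π = π' := Functor.punit_ext' _ _
  obtain rfl : θ = θ' := by ext x; exact Subsingleton.elim _ _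
  rfl

lemma coconeMap_res (E : Q ⥤ P) (X : D.Dia P) (q : K ⥤ Q) (π : K ⥤ Pt.{w}) (t : Q)
    (θ : q ⟶ π ⋙ pt t) :
    (D.resComp q E).hom.app X ≫ D.coconeMap ((D.res E).obj X) q π t θ =
      D.coconeMap X (q ⋙ E) π (E.obj t) (Functor.whiskerRight θ E) ≫
        (D.res π).map ((D.resComp (pt t) E).hom.app X) := by
  have h1 := D.resMap_whiskerRight θ E X
  have h2 := D.resComp_assoc π (pt t) E X
  rw [coconeMap, ← reassoc_of% h1, h2]
  exact (Category.assoc _ _ _).symm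

lemma coneMap_res (E : Q ⥤ P) (X : D.Dia P) (q : K ⥤ Q) (π : K ⥤ Pt.{w}) (t : Q)
    (θ : π ⋙ pt t ⟶ q) :
    (D.res π).map ((D.resComp (pt t) E).hom.app X) ≫ D.coneMap ((D.res E).obj X) q π t θ =
      D.coneMap X (q ⋙ E) π (E.obj t) (Functor.whiskerRight θ E) ≫
        (D.resComp q E).hom.app X := by
  have h1 := D.resMap_whiskerRight θ E X
  have h2 := D.resComp_assoc π (pt t) E X
  rw [← cancel_epi ((D.resComp π (pt t ⋙ E)).hom.app X), ← reassoc_of% h2, coneMap,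
    Iso.hom_inv_id_app_assoc, ← h1, coneMap, Category.assoc]
  exact (Iso.hom_inv_id_app_assoc _ _ _).symm

lemma isColim_res_iff (E : Q ⥤ P) (X : D.Dia P) (q : K ⥤ Q) (π : K ⥤ Pt.{w}) (t : Q)
    (θ : q ⟶ π ⋙ pt t) :
    D.IsColim ((D.res E).obj X) q π t θ ↔
      D.IsColim X (q ⋙ E) π (E.obj t) (Functor.whiskerRight θ E) := by
  refine forall_congr' fun Y => ?_
  rw [← Function.Bijective.of_comp_iff' (Adjunction.bijective_precomp_of_isIso
    ((D.resComp q E).hom.app X)), ← Function.Bijective.of_comp_iff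
    (fun h : (D.ev (E.obj t)).obj X ⟶ Y => D.coconeMap X (q ⋙ E) π (E.obj t)
      (Functor.whiskerRight θ E) ≫ (D.res π).map h) (Adjunction.bijective_precomp_of_isIso
    ((D.resComp (pt t) E).hom.app X))]
  refine iff_of_eq (congrArg _ (funext fun h => ?_))
  have := coconeMap_res E X q π t θ
  simp only [Function.comp_apply]
  rw [reassoc_of% this, ← Functor.map_comp]

lemma isLim_res_iff (E : Q ⥤ P) (X : D.Dia P) (q : K ⥤ Q) (π : K ⥤ Pt.{w}) (t : Q)
    (θ : π ⋙ pt t ⟶ q) :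
    D.IsLim ((D.res E).obj X) q π t θ ↔
      D.IsLim X (q ⋙ E) π (E.obj t) (Functor.whiskerRight θ E) := by
  refine forall_congr' fun Y => ?_
  rw [← Function.Bijective.of_comp_iff (fun h : Y ⟶ (D.ev t).obj ((D.res E).obj X) =>
      (D.res π).map h ≫ D.coneMap ((D.res E).obj X) q π t θ)
    (Adjunction.bijective_comp_of_isIso ((D.resComp (pt t) E).hom.app X)),
    ← Function.Bijective.of_comp_iff' (Adjunction.bijective_comp_of_isIso
      ((D.resComp q E).hom.app X))]
  refine iff_of_eq (congrArg _ (funext fun h => ?_))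
  have := coneMap_res E X q π t θ
  simp only [Function.comp_apply, Category.assoc, Functor.map_comp]
  rw [this]

end Transport

section Below

variable {P Q : Type w} [PartialOrder P] [PartialOrder Q]

/-- The elements of `S` below `t`. -/
abbrev Below (S : Set P) (t : P) : Type w := {s : P // s ∈ S ∧ s ≤ t}

/-- The elements of `S` above `t`. -/
abbrev Above (S : Set P) (t : P) : Type w := {s : P // s ∈ S ∧ t ≤ s}

/-- The inclusion of `Below S t`. -/
def belowIncl (S : Set P) (t : P) : Below S t ⥤ P :=
  Monotone.functor (f := Subtype.val) fun _ _ h => h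

/-- The inclusion of `Above S t`. -/
def aboveIncl (S : Set P) (t : P) : Above S t ⥤ P :=
  Monotone.functor (f := Subtype.val) fun _ _ h => h

/-- The cocone on `Below S t` with vertex `t`. -/
def belowCocone (S : Set P) (t : P) : belowIncl S t ⟶ Functor.star.{w} _ ⋙ pt t where
  app s := homOfLE s.2.2
  naturality _ _ _ := Subsingleton.elim _ _

/-- The cone on `Above S t` with vertex `t`. -/
def aboveCone (S : Set P) (t : P) : Functor.star.{w} _ ⋙ pt t ⟶ aboveIncl S t where
  app s := homOfLE s.2.2
  naturality _ _ _ := Subsingleton.elim _ _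

variable (D : Prederivator.{w, v, u})

/-- The value of `X` at `t` is the homotopy colimit of its values on the part of `S` below `t`. -/
def IsColimAt (X : D.Dia P) (S : Set P) (t : P) : Prop :=
  D.IsColim X (belowIncl S t) (Functor.star _) t (belowCocone S t)

/-- The value of `X` at `t` is the homotopy limit of its values on the part of `S` above `t`. -/
def IsLimAt (X : D.Dia P) (S : Set P) (t : P) : Prop :=
  D.IsLim X (aboveIncl S t) (Functor.star _) t (aboveCone S t)

variable {D}

lemma isColimAt_of_isColim {K : Type w} [SmallCategory K] {X : D.Dia P} {S : Set P} {t : P}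
    {q : K ⥤ P} {π : K ⥤ Pt.{w}} {θ : q ⟶ π ⋙ pt t} (f : K ⥤ Below S t) {g : Below S t ⥤ K}
    (adj : g ⊣ f) [IsIso adj.counit] (h : q = f ⋙ belowIncl S t) :
    D.IsColim X q π t θ ↔ D.IsColimAt X S t := by
  rw [IsColimAt, ← isColim_whiskerLeft_iff _ _ _ _ _ adj]
  exact isColim_congr _ _ _ h

lemma isLimAt_of_isLim {K : Type w} [SmallCategory K] {X : D.Dia P} {S : Set P} {t : P}
    {q : K ⥤ P} {π : K ⥤ Pt.{w}} {θ : π ⋙ pt t ⟶ q} (f : K ⥤ Above S t) {g : Above S t ⥤ K}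
    (adj : f ⊣ g) [IsIso adj.unit] (h : q = f ⋙ aboveIncl S t) :
    D.IsLim X q π t θ ↔ D.IsLimAt X S t := by
  rw [IsLimAt, ← isLim_whiskerLeft_iff _ _ _ _ _ adj]
  exact isLim_congr _ _ _ h

lemma isColimAt_of_isEquivalence {K : Type w} [SmallCategory K] {X : D.Dia P} {S : Set P} {t : P}
    {q : K ⥤ P} {π : K ⥤ Pt.{w}} {θ : q ⟶ π ⋙ pt t} (f : K ⥤ Below S t) [f.IsEquivalence]
    (h : q = f ⋙ belowIncl S t) : D.IsColim X q π t θ ↔ D.IsColimAt X S t := by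
  let adj : f.inv ⊣ f := f.asEquivalence.symm.toAdjunction
  have : IsIso adj.counit := f.asEquivalence.symm.counitIso.isIso_hom
  exact isColimAt_of_isColim f adj h

lemma isLimAt_of_isEquivalence {K : Type w} [SmallCategory K] {X : D.Dia P} {S : Set P} {t : P}
    {q : K ⥤ P} {π : K ⥤ Pt.{w}} {θ : π ⋙ pt t ⟶ q} (f : K ⥤ Above S t) [f.IsEquivalence]
    (h : q = f ⋙ aboveIncl S t) : D.IsLim X q π t θ ↔ D.IsLimAt X S t := by
  let adj : f ⊣ f.inv := f.asEquivalence.toAdjunction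
  have : IsIso adj.unit := f.asEquivalence.unitIso.isIso_hom
  exact isLimAt_of_isLim f adj h

/-- Homotopy colimits may be computed on reflective subsets. -/
lemma isColimAt_iff_of_reflective {X : D.Dia P} {S S' : Set P} {t : P} (hS : S' ⊆ S)
    (h : ∀ s ∈ S, s ≤ t → ∃ r ∈ S', r ≤ t ∧ s ≤ r ∧ ∀ s' ∈ S', s' ≤ t → s ≤ s' → r ≤ s') :
    D.IsColimAt X S' t ↔ D.IsColimAt X S t := by
  choose! r h1 h2 h3 h4 using h
  -- The chosen `r s` is the least element of `S'` between `s` and `t`, so `r` is a left adjoint of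
  -- the inclusion of `Below S' t`.
  have gc : GaloisConnection
      (fun s : Below S t => (⟨r s, h1 s s.2.1 s.2.2, h2 s s.2.1 s.2.2⟩ : Below S' t))
      (fun s : Below S' t => (⟨s, hS s.2.1, s.2.2⟩ : Below S t)) := fun a b =>
    ⟨fun h => (h3 a a.2.1 a.2.2).trans h, fun h => h4 a a.2.1 a.2.2 b b.2.1 b.2.2 h⟩
  have : IsIso gc.adjunction.counit := by
    rw [NatTrans.isIso_iff_isIso_app]
    intro x
    exact ⟨homOfLE (h3 x (hS x.2.1) x.2.2), Subsingleton.elim _ _, Subsingleton.elim _ _⟩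
  exact isColimAt_of_isColim gc.monotone_u.functor gc.adjunction rfl

/-- Homotopy limits may be computed on coreflective subsets. -/
lemma isLimAt_iff_of_coreflective {X : D.Dia P} {S S' : Set P} {t : P} (hS : S' ⊆ S)
    (h : ∀ s ∈ S, t ≤ s → ∃ r ∈ S', t ≤ r ∧ r ≤ s ∧ ∀ s' ∈ S', t ≤ s' → s' ≤ s → s' ≤ r) :
    D.IsLimAt X S' t ↔ D.IsLimAt X S t := by
  choose! r h1 h2 h3 h4 using h
  have gc : GaloisConnection
      (fun s : Above S' t => (⟨s, hS s.2.1, s.2.2⟩ : Above S t))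
      (fun s : Above S t => (⟨r s, h1 s s.2.1 s.2.2, h2 s s.2.1 s.2.2⟩ : Above S' t)) :=
    fun a b =>
    ⟨fun h => h4 b b.2.1 b.2.2 a a.2.1 a.2.2 h, fun h => le_trans (b := r b) h (h3 b b.2.1 b.2.2)⟩
  have : IsIso gc.adjunction.unit := by
    rw [NatTrans.isIso_iff_isIso_app]
    intro x
    exact ⟨homOfLE (h3 x (hS x.2.1) x.2.2), Subsingleton.elim _ _, Subsingleton.elim _ _⟩
  exact isLimAt_of_isLim gc.monotone_l.functor gc.adjunction rfl

lemma isColimAt_res_iff (E : Q ⥤ P) (hE : ∀ a b, E.obj a ≤ E.obj b → a ≤ b) (X : D.Dia P)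
    (S : Set Q) (t : Q) :
    D.IsColimAt ((D.res E).obj X) S t ↔ D.IsColimAt X (E.obj '' S) (E.obj t) := by
  rw [IsColimAt, isColim_res_iff]
  let f : Below S t ⥤ Below (E.obj '' S) (E.obj t) :=
    { obj := fun s => ⟨E.obj s.1, ⟨s.1, s.2.1, rfl⟩, (E.map (homOfLE s.2.2)).le⟩
      map := fun {a b} h => homOfLE (E.map (X := a.1) (Y := b.1) (homOfLE h.le)).le }
  have : f.Faithful := ⟨fun _ => Subsingleton.elim _ _⟩
  have : f.Full := ⟨fun {a b} h => ⟨homOfLE (hE a.1 b.1 h.le), Subsingleton.elim _ _⟩⟩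
  have : f.EssSurj := ⟨by
    rintro ⟨_, ⟨a, ha, rfl⟩, hat⟩
    exact ⟨⟨a, ha, hE _ _ hat⟩, ⟨Iso.refl _⟩⟩⟩
  have : f.IsEquivalence := {}
  exact isColimAt_of_isEquivalence f rfl

lemma isLimAt_res_iff (E : Q ⥤ P) (hE : ∀ a b, E.obj a ≤ E.obj b → a ≤ b) (X : D.Dia P)
    (S : Set Q) (t : Q) :
    D.IsLimAt ((D.res E).obj X) S t ↔ D.IsLimAt X (E.obj '' S) (E.obj t) := by
  rw [IsLimAt, isLim_res_iff]
  let f : Above S t ⥤ Above (E.obj '' S) (E.obj t) :=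
    { obj := fun s => ⟨E.obj s.1, ⟨s.1, s.2.1, rfl⟩, (E.map (homOfLE s.2.2)).le⟩
      map := fun {a b} h => homOfLE (E.map (X := a.1) (Y := b.1) (homOfLE h.le)).le }
  have : f.Faithful := ⟨fun _ => Subsingleton.elim _ _⟩
  have : f.Full := ⟨fun {a b} h => ⟨homOfLE (hE a.1 b.1 h.le), Subsingleton.elim _ _⟩⟩
  have : f.EssSurj := ⟨by
    rintro ⟨_, ⟨a, ha, rfl⟩, hat⟩
    exact ⟨⟨a, ha, hE _ _ hat⟩, ⟨Iso.refl _⟩⟩⟩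
  have : f.IsEquivalence := {}
  exact isLimAt_of_isEquivalence f rfl

/-- If `t` lies in `S`, it is the largest element of `Below S t`. -/
lemma isColimAt_of_mem {X : D.Dia P} {S : Set P} {t : P} (h : t ∈ S) : D.IsColimAt X S t := by
  have hk : IsTerminal (⟨t, h, le_rfl⟩ : Below S t) :=
    IsTerminal.ofUniqueHom (fun x => homOfLE x.2.2) fun _ _ => Subsingleton.elim _ _
  rw [IsColimAt, isColim_iff_of_isTerminal _ _ _ _ _ hk]
  have : IsIso ((belowCocone S t).app ⟨t, h, le_rfl⟩) := by
    exact ⟨𝟙 _, Subsingleton.elim _ _, Subsingleton.elim _ _⟩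
  have := isIso_whiskerLeft_pt (belowCocone S t) ⟨t, h, le_rfl⟩
  infer_instance

lemma isLimAt_of_mem {X : D.Dia P} {S : Set P} {t : P} (h : t ∈ S) : D.IsLimAt X S t := by
  have hk : IsInitial (⟨t, h, le_rfl⟩ : Above S t) :=
    IsInitial.ofUniqueHom (fun x => homOfLE x.2.2) fun _ _ => Subsingleton.elim _ _
  rw [IsLimAt, isLim_iff_of_isInitial _ _ _ _ _ hk]
  have : IsIso ((aboveCone S t).app ⟨t, h, le_rfl⟩) := by
    exact ⟨𝟙 _, Subsingleton.elim _ _, Subsingleton.elim _ _⟩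
  have := isIso_whiskerLeft_pt (aboveCone S t) ⟨t, h, le_rfl⟩
  infer_instance

end Below

section Zero

variable {D : Prederivator.{w, v, u}} [hD : D.IsPointed]

lemma isZero_of_isInitial {x : D.Dia Pt.{w}} (h : IsInitial x) : IsZero x := by
  obtain ⟨z, hz⟩ := hD.hasZeroObject.zero
  exact hz.of_iso (h.uniqueUpToIso hz.isInitial)

lemma isZero_of_isTerminal {x : D.Dia Pt.{w}} (h : IsTerminal x) : IsZero x := by
  obtain ⟨z, hz⟩ := hD.hasZeroObject.zero
  exact hz.of_iso (h.uniqueUpToIso hz.isTerminal)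

end Zero

/-! ### Generation by subsets of a poset, and extension by zero -/

section Extension

variable {P Q : Type w} [PartialOrder P] [PartialOrder Q]
variable {D : Prederivator.{w, v, u}} [D.IsDerivator]

/-- For fully faithful `j` the comma category over `t` is equivalent to the part of the image of `j`
below `t`; thus only the image matters. -/
lemma isLeft_iff_isColimAt {A : Type w} [SmallCategory A] (j : A ⥤ P) [j.Full] [j.Faithful]
    (X : D.Dia P) : D.IsLeft j X ↔ ∀ t, D.IsColimAt X (Set.range j.obj) t := by
  rw [isLeft_iff_isColim]
  refine forall_congr' fun t => ?_
  let f : Comma j (pt.{w} t) ⥤ Below (Set.range j.obj) t :=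
    { obj := fun x => ⟨j.obj x.left, ⟨x.left, rfl⟩, x.hom.le⟩
      map := fun g => homOfLE (j.map g.left).le }
  have : f.Faithful := ⟨fun {a b} g g' _ => by
    ext
    · exact j.map_injective (Subsingleton.elim _ _)
    · exact Subsingleton.elim _ _⟩
  have : f.Full := ⟨fun {a b} g => ⟨
    { left := j.preimage (homOfLE g.le)
      right := eqToHom (Subsingleton.elim _ _)
      w := Subsingleton.elim _ _ }, Subsingleton.elim _ _⟩⟩
  have : f.EssSurj := ⟨by
    rintro ⟨_, ⟨a, rfl⟩, hat⟩
    exact ⟨⟨a, ⟨⟨⟩⟩, homOfLE hat⟩, ⟨Iso.refl _⟩⟩⟩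
  have : f.IsEquivalence := {}
  exact isColimAt_of_isEquivalence f rfl

lemma isRight_iff_isLimAt {A : Type w} [SmallCategory A] (j : A ⥤ P) [j.Full] [j.Faithful]
    (X : D.Dia P) : D.IsRight j X ↔ ∀ t, D.IsLimAt X (Set.range j.obj) t := by
  rw [isRight_iff_isLim]
  refine forall_congr' fun t => ?_
  let f : Comma (pt.{w} t) j ⥤ Above (Set.range j.obj) t :=
    { obj := fun x => ⟨j.obj x.right, ⟨x.right, rfl⟩, x.hom.le⟩
      map := fun g => homOfLE (j.map g.right).le }
  have : f.Faithful := ⟨fun {a b} g g' _ => by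
    ext
    · exact Subsingleton.elim _ _
    · exact j.map_injective (Subsingleton.elim _ _)⟩
  have : f.Full := ⟨fun {a b} g => ⟨
    { left := eqToHom (Subsingleton.elim _ _)
      right := j.preimage (homOfLE g.le)
      w := Subsingleton.elim _ _ }, Subsingleton.elim _ _⟩⟩
  have : f.EssSurj := ⟨by
    rintro ⟨_, ⟨a, rfl⟩, hat⟩
    exact ⟨⟨⟨⟨⟩⟩, a, homOfLE hat⟩, ⟨Iso.refl _⟩⟩⟩
  have : f.IsEquivalence := {}
  exact isLimAt_of_isEquivalence f rfl

/-- The inclusion between subsets of a poset. -/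
def subsetIncl {S T : Set P} (h : S ⊆ T) : S ⥤ T :=
  Monotone.functor (f := Set.inclusion h) fun _ _ h => h

/-- The inclusion of a subset of a poset. -/
def subsetVal (S : Set P) : S ⥤ P :=
  Monotone.functor (f := Subtype.val) fun _ _ h => h

instance {S T : Set P} (h : S ⊆ T) : (subsetIncl h).Full :=
  ⟨fun {_ _} g => ⟨homOfLE g.le, Subsingleton.elim _ _⟩⟩

instance {S T : Set P} (h : S ⊆ T) : (subsetIncl h).Faithful := ⟨fun _ => Subsingleton.elim _ _⟩

instance (S : Set P) : (subsetVal S).Full :=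
  ⟨fun {_ _} g => ⟨homOfLE g.le, Subsingleton.elim _ _⟩⟩

instance (S : Set P) : (subsetVal S).Faithful := ⟨fun _ => Subsingleton.elim _ _⟩

lemma isLeft_subsetIncl_iff {S T : Set P} (h : S ⊆ T) (X : D.Dia P) :
    D.IsLeft (subsetIncl h) ((D.res (subsetVal T)).obj X) ↔ ∀ t ∈ T, D.IsColimAt X S t := by
  rw [isLeft_iff_isColimAt]
  have h1 : (subsetVal T).obj '' (Set.range (subsetIncl h).obj) = S := by
    ext x
    constructor
    · rintro ⟨_, ⟨y, rfl⟩, rfl⟩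
      exact y.2
    · exact fun hx => ⟨⟨x, h hx⟩, ⟨⟨x, hx⟩, rfl⟩, rfl⟩
  have h2 (t : T) := isColimAt_res_iff (D := D) (subsetVal T) (fun _ _ h => h) X
    (Set.range (subsetIncl h).obj) t
  simp only [h2, h1]
  exact Subtype.forall

lemma isRight_subsetIncl_iff {S T : Set P} (h : S ⊆ T) (X : D.Dia P) :
    D.IsRight (subsetIncl h) ((D.res (subsetVal T)).obj X) ↔ ∀ t ∈ T, D.IsLimAt X S t := by
  rw [isRight_iff_isLimAt]
  have h1 : (subsetVal T).obj '' (Set.range (subsetIncl h).obj) = S := by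
    ext x
    constructor
    · rintro ⟨_, ⟨y, rfl⟩, rfl⟩
      exact y.2
    · exact fun hx => ⟨⟨x, h hx⟩, ⟨⟨x, hx⟩, rfl⟩, rfl⟩
  have h2 (t : T) := isLimAt_res_iff (D := D) (subsetVal T) (fun _ _ h => h) X
    (Set.range (subsetIncl h).obj) t
  simp only [h2, h1]
  exact Subtype.forall

/-- Homotopy colimits do not change when homotopy colimits are added to the diagram. -/
lemma isColimAt_iff_of_subset {X : D.Dia P} {S T : Set P} (h : S ⊆ T)
    (hT : ∀ t ∈ T, D.IsColimAt X S t) (t : P) : D.IsColimAt X S t ↔ D.IsColimAt X T t := by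
  -- The inclusions `S ⊆ T ⊆ insert t T` are compared. Over `T` the diagram is generated by `S`, so
  -- generation of the large piece by `S` and by `T` are equivalent, and `t` is the only vertex
  -- where this says something new.
  have hTU : T ⊆ insert t T := Set.subset_insert _ _
  have h1 := isLeft_subsetIncl_iff (h.trans hTU) X
  have h2 := isLeft_subsetIncl_iff hTU X
  have h3 : D.IsLeft (subsetIncl h) ((D.res (subsetIncl hTU)).obj
      ((D.res (subsetVal (insert t T))).obj X)) :=
    ((isLeft_subsetIncl_iff h X).2 hT).of_iso
      ((D.resComp (subsetIncl hTU) (subsetVal (insert t T))).app X)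
  have h4 := isLeft_comp_iff_of_isLeft_res h3
  rw [show subsetIncl h ⋙ subsetIncl hTU = subsetIncl (h.trans hTU) from rfl, h1, h2] at h4
  simp only [Set.forall_mem_insert] at h4
  exact ⟨fun H => (h4.1 ⟨H, hT⟩).1, fun H => (h4.2 ⟨H, fun t ht => isColimAt_of_mem ht⟩).1⟩

/-- Homotopy limits do not change when homotopy limits are added to the diagram. -/
lemma isLimAt_iff_of_subset {X : D.Dia P} {S T : Set P} (h : S ⊆ T)
    (hT : ∀ t ∈ T, D.IsLimAt X S t) (t : P) : D.IsLimAt X S t ↔ D.IsLimAt X T t := by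
  have hTU : T ⊆ insert t T := Set.subset_insert _ _
  have h1 := isRight_subsetIncl_iff (h.trans hTU) X
  have h2 := isRight_subsetIncl_iff hTU X
  have h3 : D.IsRight (subsetIncl h) ((D.res (subsetIncl hTU)).obj
      ((D.res (subsetVal (insert t T))).obj X)) :=
    ((isRight_subsetIncl_iff h X).2 hT).of_iso
      ((D.resComp (subsetIncl hTU) (subsetVal (insert t T))).app X)
  have h4 := isRight_comp_iff_of_isRight_res h3
  rw [show subsetIncl h ⋙ subsetIncl hTU = subsetIncl (h.trans hTU) from rfl, h1, h2] at h4
  simp only [Set.forall_mem_insert] at h4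
  exact ⟨fun H => (h4.1 ⟨H, hT⟩).1, fun H => (h4.2 ⟨H, fun t ht => isLimAt_of_mem ht⟩).1⟩

variable [D.IsPointed]

lemma isColimAt_iff_isZero {X : D.Dia P} {S : Set P} {t : P} (h : ∀ s ∈ S, ¬ s ≤ t) :
    D.IsColimAt X S t ↔ IsZero ((D.ev t).obj X) := by
  have : IsEmpty (Below S t) := ⟨fun s => h s s.2.1 s.2.2⟩
  rw [IsColimAt, isColim_iff_of_isEmpty]
  exact ⟨fun ⟨h⟩ => isZero_of_isInitial h, fun h => ⟨h.isInitial⟩⟩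

lemma isLimAt_iff_isZero {X : D.Dia P} {S : Set P} {t : P} (h : ∀ s ∈ S, ¬ t ≤ s) :
    D.IsLimAt X S t ↔ IsZero ((D.ev t).obj X) := by
  have : IsEmpty (Above S t) := ⟨fun s => h s s.2.1 s.2.2⟩
  rw [IsLimAt, isLim_iff_of_isEmpty]
  exact ⟨fun ⟨h⟩ => isZero_of_isTerminal h, fun h => ⟨h.isTerminal⟩⟩

end Extension

end Prederivator

/-! ### Gluing two adjunctions along a common category -/

section AdjunctionEquivalence

variable {C C' E N N' : Type*} [Category* C] [Category* C'] [Category* E] [Category* N]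
  [Category* N']

/-- The criterion involves only the left adjoint, which makes the choice of the adjunction
immaterial. -/
lemma adjunctionIsEquivalence_iff {F : C ⥤ E} {G : E ⥤ C} (adj : F ⊣ G) :
    AdjunctionIsEquivalence adj ↔ F.IsEquivalence := by
  constructor
  · rintro ⟨h1, h2⟩
    have (x : C) : IsIso (adj.unit.app x) := inferInstance
    have (x : E) : IsIso (adj.counit.app x) := inferInstance
    exact adj.toEquivalence.isEquivalence_functor
  · intro h
    exact ⟨inferInstance, inferInstance⟩

/-- Two adjunctions with a fully faithful outer adjoint each, glued along a category on which the
inner adjoints are jointly conservative, compose to an equivalence iff the essential images of the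
outer adjoints agree. -/
lemma isEquivalence_comp_iff_essImage {Q : C ⥤ E} {r : E ⥤ C} {Q' : C' ⥤ E} {r' : E ⥤ C'}
    (adj : Q ⊣ r) (adj' : r' ⊣ Q') [Q.Full] [Q.Faithful] [Q'.Full] [Q'.Faithful]
    (h : ∀ ⦃x y : E⦄ (f : x ⟶ y), IsIso (r.map f) → IsIso (r'.map f) → IsIso f) :
    (Q ⋙ r').IsEquivalence ↔ ∀ x, Q.essImage x ↔ Q'.essImage x := by
  -- The triangle identity and full faithfulness of `Q'` make the image of the unit under `r'`
  -- invertible in any case; joint conservativity leaves only the condition under `r`.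
  have h1 (x : E) : IsIso (r.map (adj'.unit.app x)) ↔ Q'.essImage x := by
    rw [← adj'.isIso_unit_app_iff_mem_essImage]
    refine ⟨fun H => h _ H ?_, fun H => inferInstance⟩
    rw [← isIso_comp_right_iff _ (adj'.counit.app (r'.obj x)), show _ = 𝟙 _ from adj'.left_triangle_components x]
    exact inferInstanceAs (IsIso (𝟙 (r'.obj x)))
  have h2 (x : E) : IsIso (r'.map (adj.counit.app x)) ↔ Q.essImage x := by
    rw [← adj.isIso_counit_app_iff_mem_essImage]
    refine ⟨fun H => h _ ?_ H, fun H => inferInstance⟩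
    rw [← isIso_comp_left_iff (adj.unit.app (r.obj x)), show _ = 𝟙 _ from adj.right_triangle_components x]
    exact inferInstanceAs (IsIso (𝟙 (r.obj x)))
  rw [← adjunctionIsEquivalence_iff (adj.comp adj'), AdjunctionIsEquivalence,
    NatTrans.isIso_iff_isIso_app, NatTrans.isIso_iff_isIso_app]
  -- The composite unit is the unit of `adj`, invertible since `Q` is fully faithful, followed by
  -- `r` of the unit of `adj'` at `Q.obj x`.
  have h3 (x : C) : IsIso ((adj.comp adj').unit.app x) ↔ Q'.essImage (Q.obj x) := by
    rw [Adjunction.comp_unit_app, isIso_comp_left_iff, h1]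
  have h4 (x : C') : IsIso ((adj.comp adj').counit.app x) ↔ Q.essImage (Q'.obj x) := by
    rw [Adjunction.comp_counit_app, isIso_comp_right_iff, h2]
  simp only [h3, h4]
  constructor
  · rintro ⟨h5, h6⟩ x
    exact ⟨fun ⟨y, ⟨e⟩⟩ => Functor.essImage.ofIso e (h5 y),
      fun ⟨y, ⟨e⟩⟩ => Functor.essImage.ofIso e (h6 y)⟩
  · intro H
    exact ⟨fun x => (H _).1 (Q.obj_mem_essImage x), fun x => (H _).2 (Q'.obj_mem_essImage x)⟩

/-- The adjunction given by universal morphisms `x ⟶ G (F x)`. -/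
def adjunctionOfUnit {F : C ⥤ E} {G : E ⥤ C} (η : 𝟭 C ⟶ F ⋙ G)
    (h : ∀ x y, Function.Bijective (fun f : F.obj x ⟶ y => η.app x ≫ G.map f)) : F ⊣ G :=
  Adjunction.mkOfHomEquiv
    { homEquiv := fun x y => Equiv.ofBijective _ (h x y)
      homEquiv_naturality_left_symm := fun {x x' y} f g => by
        rw [Equiv.symm_apply_eq]
        have h1 := (Equiv.ofBijective _ (h x' y)).apply_symm_apply g
        have h2 := η.naturality f
        simp only [Equiv.ofBijective_apply, Functor.id_map, Functor.comp_map] at h1 h2 ⊢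
        rw [Functor.map_comp, ← reassoc_of% h2, h1]
      homEquiv_naturality_right := fun f g => by simp }

/-- The adjunction given by universal morphisms `F (G y) ⟶ y`. -/
def adjunctionOfCounit {F : C ⥤ E} {G : E ⥤ C} (ε : G ⋙ F ⟶ 𝟭 E)
    (h : ∀ x y, Function.Bijective (fun f : x ⟶ G.obj y => F.map f ≫ ε.app y)) : F ⊣ G :=
  Adjunction.mkOfHomEquiv
    { homEquiv := fun x y => (Equiv.ofBijective _ (h x y)).symm
      homEquiv_naturality_left_symm := fun f g => by simp
      homEquiv_naturality_right := fun {x y y'} f g => by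
        rw [Equiv.symm_apply_eq]
        have h1 := (Equiv.ofBijective _ (h x y)).apply_symm_apply f
        have h2 := ε.naturality g
        simp only [Equiv.ofBijective_apply, Functor.id_map, Functor.comp_map] at h1 h2 ⊢
        rw [Functor.map_comp, Category.assoc, h2, reassoc_of% h1] }

section Restrict

variable (Z : ObjectProperty E)

/-- If the restrictions of the objects of a full subcategory lie in a reflective subcategory, then
the left adjoint of the restriction is defined on the reflective subcategory. -/
def leftRestrictAdj {L : N ⥤ E} {R : E ⥤ N} (adj : L ⊣ R) {J : N ⥤ C} {J' : C ⥤ N} (adjJ : J ⊣ J') [IsIso adjJ.counit]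
    (hZ : ∀ x, Z (L.obj (J'.obj x))) (h : ∀ m, Z m → IsIso (adjJ.unit.app (R.obj m))) :
    Z.lift (J' ⋙ L) hZ ⊣ Z.ι ⋙ R ⋙ J :=
  adjunctionOfUnit
    (inv adjJ.counit ≫ Functor.whiskerRight (Functor.whiskerLeft J' adj.unit) J) fun x m => by
      -- The universal property is a chain of bijections: morphisms `L (J' x) ⟶ m` correspond to `J'
      -- x ⟶ R m` by `adj`, then to `J (J' x) ⟶ J (R m)` as `R m` is in the reflective part, then to
      -- `x ⟶ J (R m)` by the counit.
      have h1 := (adjJ.isIso_unit_app_iff_bijective (R.obj m.obj)).1 (h _ m.property) (J'.obj x)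
      have h2 := Adjunction.bijective_precomp_of_isIso (Z := J.obj (R.obj m.obj))
        ((inv adjJ.counit).app x)
      refine (congrArg Function.Bijective ?_).mp (h2.comp (h1.comp
        ((adj.homEquiv (J'.obj x) m.obj).bijective.comp Z.fullyFaithfulι.homEquiv.bijective)))
      funext f
      simp [adj.homEquiv_unit]
      rfl

/-- If the restrictions of the objects of a full subcategory lie in a coreflective subcategory, then
the right adjoint of the restriction is defined on the coreflective subcategory. -/
def rightRestrictAdj {L : E ⥤ N} {R : N ⥤ E} (adj : L ⊣ R) {J : N ⥤ C} {J' : C ⥤ N}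
    (adjJ : J' ⊣ J) [IsIso adjJ.unit]
    (hZ : ∀ x, Z (R.obj (J'.obj x))) (h : ∀ m, Z m → IsIso (adjJ.counit.app (L.obj m))) :
    Z.ι ⋙ L ⋙ J ⊣ Z.lift (J' ⋙ R) hZ :=
  adjunctionOfCounit
    (Functor.whiskerRight (Functor.whiskerLeft J' adj.counit) J ≫ inv adjJ.unit) fun m x => by
      have h1 := (adjJ.isIso_counit_app_iff_bijective (L.obj m.obj)).1 (h _ m.property) (J'.obj x)
      have h2 := Adjunction.bijective_comp_of_isIso (X := J.obj (L.obj m.obj))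
        ((inv adjJ.unit).app x)
      refine (congrArg Function.Bijective ?_).mp (h2.comp (h1.comp
        ((adj.homEquiv m.obj (J'.obj x)).symm.bijective.comp
          Z.fullyFaithfulι.homEquiv.bijective)))
      funext f
      simp [adj.homEquiv_counit]
      rfl

end Restrict

end AdjunctionEquivalence

namespace Prederivator

/-! ### Diagrams with vanishing conditions -/

section Corners

variable (D : Prederivator.{w, v, u})
variable {P U U' : Type w} [PartialOrder P] [PartialOrder U] [PartialOrder U']
variable {A A' : Type w} [SmallCategory A] [SmallCategory A']

/-- The diagrams that vanish on `S`. -/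
def VanishesOn (S : Set P) : ObjectProperty (D.Dia P) :=
  fun X => ∀ t ∈ S, IsZero ((D.ev t).obj X)

variable {D}

lemma isIso_ev_map_of_isIso_res {i : U ⥤ P} {j : A ⥤ U} {X Y : D.Dia P} (f : X ⟶ Y)
    [IsIso ((D.res j).map ((D.res i).map f))] (a : A) :
    IsIso ((D.ev (i.obj (j.obj a))).map f) := by
  change IsIso ((D.res (pt a ⋙ j ⋙ i)).map f)
  rw [← isIso_comp_right_iff _ ((D.resComp (pt a) (j ⋙ i)).hom.app _), resComp_hom_naturality,
    isIso_comp_left_iff]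
  have : IsIso ((D.res (j ⋙ i)).map f) := by
    rw [← isIso_comp_right_iff _ ((D.resComp j i).hom.app _), resComp_hom_naturality]
    infer_instance
  infer_instance

variable [D.IsDerivator] [D.IsPointed]

/-- Right Kan extension along `j` is extension by zero here: nothing in the image of `j` lies above
a vertex outside it, so the limit there is over the empty shape. -/
lemma isRight_res_of_vanishesOn {i : U ⥤ P} {j : A ⥤ U} [j.Full] [j.Faithful] {S : Set P}
    (h : ∀ t, t ∉ Set.range j.obj → i.obj t ∈ S ∧ ∀ a, ¬ t ≤ j.obj a) {X : D.Dia P}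
    (hX : D.VanishesOn S X) : D.IsRight j ((D.res i).obj X) := by
  rw [isRight_iff_isLimAt]
  intro t
  by_cases ht : t ∈ Set.range j.obj
  · exact isLimAt_of_mem ht
  · rw [isLimAt_iff_isZero (by rintro _ ⟨a, rfl⟩; exact (h t ht).2 a)]
    exact (hX _ (h t ht).1).of_iso ((D.resComp (pt t) i).symm.app X)

lemma isLeft_res_of_vanishesOn {i : U ⥤ P} {j : A ⥤ U} [j.Full] [j.Faithful] {S : Set P}
    (h : ∀ t, t ∉ Set.range j.obj → i.obj t ∈ S ∧ ∀ a, ¬ j.obj a ≤ t) {X : D.Dia P}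
    (hX : D.VanishesOn S X) : D.IsLeft j ((D.res i).obj X) := by
  rw [isLeft_iff_isColimAt]
  intro t
  by_cases ht : t ∈ Set.range j.obj
  · exact isColimAt_of_mem ht
  · rw [isColimAt_iff_isZero (by rintro _ ⟨a, rfl⟩; exact (h t ht).2 a)]
    exact (hX _ (h t ht).1).of_iso ((D.resComp (pt t) i).symm.app X)

/-- The extension by `ran j` is zero at these vertices, again as a limit over the empty shape, and
the fully faithful `lan i` preserves values on `U`. -/
lemma vanishesOn_lan_ran (i : U ⥤ P) (j : A ⥤ U) [i.Full] [i.Faithful] [j.Full] [j.Faithful]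
    {S : Set P} (h : ∀ s ∈ S, ∃ t, i.obj t = s ∧ ∀ a, ¬ t ≤ j.obj a) (x : D.Dia A) :
    D.VanishesOn S ((D.lan i).obj ((D.ran j).obj x)) := by
  intro s hs
  obtain ⟨t, rfl, ht⟩ := h s hs
  have h1 := (isRight_iff_isLimAt j _).1 (D.isRight_ran_obj j x) t
  rw [isLimAt_iff_isZero (by rintro _ ⟨a, rfl⟩; exact ht a)] at h1
  exact h1.of_iso ((D.resComp (pt t) i).app _ ≪≫
    ((D.ev t).mapIso (asIso ((D.lanAdj i).unit.app ((D.ran j).obj x)))).symm)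

lemma vanishesOn_ran_lan (i : U ⥤ P) (j : A ⥤ U) [i.Full] [i.Faithful] [j.Full] [j.Faithful]
    {S : Set P} (h : ∀ s ∈ S, ∃ t, i.obj t = s ∧ ∀ a, ¬ j.obj a ≤ t) (x : D.Dia A) :
    D.VanishesOn S ((D.ran i).obj ((D.lan j).obj x)) := by
  intro s hs
  obtain ⟨t, rfl, ht⟩ := h s hs
  have h1 := (isLeft_iff_isColimAt j _).1 (D.isLeft_lan_obj j x) t
  rw [isColimAt_iff_isZero (by rintro _ ⟨a, rfl⟩; exact ht a)] at h1
  exact h1.of_iso ((D.resComp (pt t) i).app _ ≪≫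
    (D.ev t).mapIso (asIso ((D.ranAdj i).counit.app ((D.lan j).obj x))))

/-- Two composite constructions on a poset with vanishing conditions, extending from `A` and from
`A'` respectively: they are adjoint, and they are inverse equivalences iff the left generated and
right generated diagrams with the vanishing conditions agree. -/
theorem nonempty_adjunction_and_isEquivalence_iff (i : U ⥤ P) (i' : U' ⥤ P) (j : A ⥤ U)
    (j' : A' ⥤ U') [i.Full] [i.Faithful] [i'.Full] [i'.Faithful] [j.Full] [j.Faithful]
    [j'.Full] [j'.Faithful] (S : Set P)
    (h : ∀ t, t ∉ Set.range j.obj → i.obj t ∈ S ∧ ∀ a, ¬ t ≤ j.obj a)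
    (h' : ∀ t, t ∉ Set.range j'.obj → i'.obj t ∈ S ∧ ∀ a, ¬ j'.obj a ≤ t)
    (hS : ∀ s ∈ S, ∃ t, i.obj t = s ∧ ∀ a, ¬ t ≤ j.obj a)
    (hS' : ∀ s ∈ S, ∃ t, i'.obj t = s ∧ ∀ a, ¬ j'.obj a ≤ t)
    (hP : ∀ t, t ∈ S ∨ (∃ a, i.obj (j.obj a) = t) ∨ ∃ a, i'.obj (j'.obj a) = t) :
    Nonempty ((D.ran j ⋙ D.lan i ⋙ D.res (j' ⋙ i')) ⊣
      (D.lan j' ⋙ D.ran i' ⋙ D.res (j ⋙ i))) ∧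
    ((D.ran j ⋙ D.lan i ⋙ D.res (j' ⋙ i')).IsEquivalence ↔
      ∀ X : D.Dia P, D.VanishesOn S X → (D.IsLeft i X ↔ D.IsRight i' X)) := by
  -- Both constructions factor through `Z`. Over `Z` the restrictions to `U` and `U'` are extensions
  -- by zero, hence determined by their restrictions to `A` and `A'`; this gives the two adjunctions
  -- to be glued.
  let Z := D.VanishesOn S
  have hZ := vanishesOn_lan_ran (D := D) i j hS
  have hZ' := vanishesOn_ran_lan (D := D) i' j' hS'
  let adj := leftRestrictAdj Z (D.lanAdj i) (D.ranAdj j) hZ fun m hm =>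
    (D.isRight_iff_isIso_unit j _).1 (isRight_res_of_vanishesOn h hm)
  let adj' := rightRestrictAdj Z (D.ranAdj i') (D.lanAdj j') hZ' fun m hm =>
    (D.isLeft_iff_isIso_counit j' _).1 (isLeft_res_of_vanishesOn h' hm)
  -- Each vertex comes from `A`, comes from `A'`, or carries zero objects, so (Der2) gives joint
  -- conservativity.
  have hcons : ∀ ⦃X Y : Z.FullSubcategory⦄ (f : X ⟶ Y),
      IsIso ((Z.ι ⋙ D.res i ⋙ D.res j).map f) → IsIso ((Z.ι ⋙ D.res i' ⋙ D.res j').map f) →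
      IsIso f := by
    intro X Y f h1 h2
    rw [← ObjectProperty.isIso_hom_iff, IsDerivator.der2]
    have h1 : IsIso ((D.res j).map ((D.res i).map f.hom)) := h1
    have h2 : IsIso ((D.res j').map ((D.res i').map f.hom)) := h2
    intro t
    rcases hP t with ht | ⟨a, rfl⟩ | ⟨a, rfl⟩
    · exact ⟨(Y.property t ht).to_ _, (X.property t ht).eq_of_src _ _,
        (Y.property t ht).eq_of_src _ _⟩
    · exact isIso_ev_map_of_isIso_res f.hom a
    · exact isIso_ev_map_of_isIso_res f.hom a
  let e : D.ran j ⋙ D.lan i ⋙ D.res (j' ⋙ i') ≅ Z.lift (D.ran j ⋙ D.lan i) hZ ⋙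
      Z.ι ⋙ D.res i' ⋙ D.res j' :=
    Functor.isoWhiskerLeft (D.ran j ⋙ D.lan i) (D.resComp j' i')
  let e' : D.lan j' ⋙ D.ran i' ⋙ D.res (j ⋙ i) ≅ Z.lift (D.lan j' ⋙ D.ran i') hZ' ⋙
      Z.ι ⋙ D.res i ⋙ D.res j :=
    Functor.isoWhiskerLeft (D.lan j' ⋙ D.ran i') (D.resComp j i)
  refine ⟨⟨((adj.comp adj').ofNatIsoLeft e.symm).ofNatIsoRight e'.symm⟩, ?_⟩
  have h1 : (D.ran j ⋙ D.lan i ⋙ D.res (j' ⋙ i')).IsEquivalence ↔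
      (Z.lift (D.ran j ⋙ D.lan i) hZ ⋙ Z.ι ⋙ D.res i' ⋙ D.res j').IsEquivalence :=
    ⟨fun H => Functor.isEquivalence_of_iso e, fun H => Functor.isEquivalence_of_iso e.symm⟩
  -- An object of `Z` that is left generated along `i` is `lan i` of its restriction to `U`, and
  -- that restriction is `ran j` of something because of the vanishing conditions.
  have h2 (X : Z.FullSubcategory) : (Z.lift (D.ran j ⋙ D.lan i) hZ).essImage X ↔
      D.IsLeft i X.obj := by
    rw [← D.essImage_lan_iff]
    constructor
    · rintro ⟨x, ⟨f⟩⟩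
      exact ⟨_, ⟨Z.ι.mapIso f⟩⟩
    · intro H
      obtain ⟨x, ⟨f⟩⟩ := (D.essImage_ran_iff j _).2 (isRight_res_of_vanishesOn h X.property)
      have h3 := (D.isLeft_iff_isIso_counit i _).1 ((D.essImage_lan_iff i _).1 H)
      exact ⟨x, ⟨Z.isoMk ((D.lan i).mapIso f ≪≫ asIso ((D.lanAdj i).counit.app X.obj))⟩⟩
  have h3 (X : Z.FullSubcategory) : (Z.lift (D.lan j' ⋙ D.ran i') hZ').essImage X ↔
      D.IsRight i' X.obj := by
    rw [← D.essImage_ran_iff]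
    constructor
    · rintro ⟨x, ⟨f⟩⟩
      exact ⟨_, ⟨Z.ι.mapIso f⟩⟩
    · intro H
      obtain ⟨x, ⟨f⟩⟩ := (D.essImage_lan_iff j' _).2 (isLeft_res_of_vanishesOn h' X.property)
      have h3 := (D.isRight_iff_isIso_unit i' _).1 ((D.essImage_ran_iff i' _).1 H)
      exact ⟨x, ⟨Z.isoMk ((D.ran i').mapIso f ≪≫ (asIso ((D.ranAdj i').unit.app X.obj)).symm)⟩⟩
  rw [h1, isEquivalence_comp_iff_essImage adj adj' hcons]
  simp only [h2, h3]
  exact ⟨fun H X hX => H ⟨X, hX⟩, fun H X => H X.obj X.property⟩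

end Corners

end Prederivator

namespace Prederivator

/-! ### Suspensions, loops, cofibers and fibers as instances of the gluing -/

section Squares

namespace Arr

lemma eq_zero_or_one (a : Arr.{w}) : a = mk 0 ∨ a = mk 1 := by
  obtain ⟨a⟩ := a
  fin_cases a
  · exact Or.inl rfl
  · exact Or.inr rfl

lemma zero_le (a : Arr.{w}) : mk 0 ≤ a := Fin.zero_le a.down

lemma le_one (a : Arr.{w}) : a ≤ mk 1 := Fin.le_last a.down

lemma not_one_le_zero : ¬ (mk 1 : Arr.{w}) ≤ mk 0 :=
  fun h => absurd (show (1 : Fin 2) ≤ 0 from h) (by simp)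

lemma one_ne_zero : (mk 1 : Arr.{w}) ≠ mk 0 := fun h => not_one_le_zero h.le

@[simp] lemma val_mk (x : Fin 2) : (mk x : Arr.{w}).val = x := rfl

end Arr

lemma vertex_eta (t : Cube.{w} 2) : Cube.vertex (t 0) (t 1) = t := by
  funext i
  fin_cases i <;> rfl

lemma vertex_le_iff {a b a' b' : Arr.{w}} :
    Cube.vertex a b ≤ Cube.vertex a' b' ↔ a ≤ a' ∧ b ≤ b' :=
  ⟨fun h => ⟨h 0, h 1⟩, fun h => vertex_mono h.1 h.2⟩

lemma vertex_eq_iff {a b a' b' : Arr.{w}} :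
    Cube.vertex a b = Cube.vertex a' b' ↔ a = a' ∧ b = b' :=
  ⟨fun h => ⟨congrFun h 0, congrFun h 1⟩, by rintro ⟨rfl, rfl⟩; rfl⟩

/-- The four vertices of the square. -/
lemma cube_two_cases (t : Cube.{w} 2) : t = Cube.vertex (Arr.mk 0) (Arr.mk 0) ∨
    t = Cube.vertex (Arr.mk 1) (Arr.mk 0) ∨ t = Cube.vertex (Arr.mk 0) (Arr.mk 1) ∨
    t = Cube.vertex (Arr.mk 1) (Arr.mk 1) := by
  rw [← vertex_eta t]
  rcases Arr.eq_zero_or_one (t 0) with h | h <;> rcases Arr.eq_zero_or_one (t 1) with h' | h' <;>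
    simp [h, h']

instance (n k : ℕ) : (inclLE.{w} n k).Full :=
  ⟨fun {_ _} g => ⟨homOfLE g.le, Subsingleton.elim _ _⟩⟩

instance (n k : ℕ) : (inclLE.{w} n k).Faithful := ⟨fun _ => Subsingleton.elim _ _⟩

instance (n k : ℕ) : (inclGE.{w} n k).Full :=
  ⟨fun {_ _} g => ⟨homOfLE g.le, Subsingleton.elim _ _⟩⟩

instance (n k : ℕ) : (inclGE.{w} n k).Faithful := ⟨fun _ => Subsingleton.elim _ _⟩

instance : topSource.{w}.Full :=
  ⟨fun {_ _} g => ⟨homOfLE (vertex_le_iff.1 g.le).1, Subsingleton.elim _ _⟩⟩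

instance : topSource.{w}.Faithful := ⟨fun _ => Subsingleton.elim _ _⟩

instance : rightSink.{w}.Full :=
  ⟨fun {_ _} g => ⟨homOfLE (vertex_le_iff.1 g.le).2, Subsingleton.elim _ _⟩⟩

instance : rightSink.{w}.Faithful := ⟨fun _ => Subsingleton.elim _ _⟩

instance {P : Type w} [PartialOrder P] (t : P) : (pt.{w} t).Full :=
  ⟨fun {_ _} _ => ⟨eqToHom (Subsingleton.elim _ _), Subsingleton.elim _ _⟩⟩

instance {P : Type w} [PartialOrder P] (t : P) : (pt.{w} t).Faithful :=
  ⟨fun _ => Subsingleton.elim _ _⟩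

variable (D : Prederivator.{w, v, u}) [D.IsDerivator] [D.IsPointed]

theorem nonempty_suspLoopAdjunction_and_isEquivalence_susp_iff :
    Nonempty (D.susp ⊣ D.loop) ∧ (D.susp.IsEquivalence ↔ ∀ X : D.Dia (Cube.{w} 2),
      D.VanishesOn {Cube.vertex (Arr.mk 1) (Arr.mk 0), Cube.vertex (Arr.mk 0) (Arr.mk 1)} X →
      (D.IsLeft (inclLE 2 1) X ↔ D.IsRight (inclGE 2 1) X)) := by
  -- The sets to be glued are the single vertices `(0,0)` and `(1,1)`; the two remaining vertices
  -- carry zeros. Evaluation at `(1,1)` is definitionally restriction along `pt sink11 ⋙ inclGE 2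
  -- 1`, and similarly at `(0,0)`.
  refine nonempty_adjunction_and_isEquivalence_iff (inclLE.{w} 2 1) (inclGE.{w} 2 1)
    (pt source00.{w}) (pt sink11.{w}) _ ?_ ?_ ?_ ?_ ?_
  · rintro ⟨t, ht⟩ h
    rcases cube_two_cases t with rfl | rfl | rfl | rfl
    · exact absurd ⟨⟨⟨⟩⟩, rfl⟩ h
    · exact ⟨Or.inl rfl, fun _ H => Arr.not_one_le_zero (vertex_le_iff.1 H).1⟩
    · exact ⟨Or.inr rfl, fun _ H => Arr.not_one_le_zero (vertex_le_iff.1 H).2⟩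
    · simp [d_vertex] at ht
  · rintro ⟨t, ht⟩ h
    rcases cube_two_cases t with rfl | rfl | rfl | rfl
    · simp [d_vertex] at ht
    · exact ⟨Or.inl rfl, fun _ H => Arr.not_one_le_zero (vertex_le_iff.1 H).2⟩
    · exact ⟨Or.inr rfl, fun _ H => Arr.not_one_le_zero (vertex_le_iff.1 H).1⟩
    · exact absurd ⟨⟨⟨⟩⟩, rfl⟩ h
  · rintro _ (rfl | rfl)
    · exact ⟨⟨Cube.vertex (Arr.mk 1) (Arr.mk 0), by simp [d_vertex]⟩, rfl,
      fun _ H => Arr.not_one_le_zero (vertex_le_iff.1 H).1⟩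
    · exact ⟨⟨Cube.vertex (Arr.mk 0) (Arr.mk 1), by simp [d_vertex]⟩, rfl,
      fun _ H => Arr.not_one_le_zero (vertex_le_iff.1 H).2⟩
  · rintro _ (rfl | rfl)
    · exact ⟨⟨Cube.vertex (Arr.mk 1) (Arr.mk 0), by simp [d_vertex]⟩, rfl,
      fun _ H => Arr.not_one_le_zero (vertex_le_iff.1 H).2⟩
    · exact ⟨⟨Cube.vertex (Arr.mk 0) (Arr.mk 1), by simp [d_vertex]⟩, rfl,
      fun _ H => Arr.not_one_le_zero (vertex_le_iff.1 H).1⟩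
  · intro t
    rcases cube_two_cases t with rfl | rfl | rfl | rfl
    · exact Or.inr (Or.inl ⟨⟨⟨⟩⟩, rfl⟩)
    · exact Or.inl (Or.inl rfl)
    · exact Or.inl (Or.inr rfl)
    · exact Or.inr (Or.inr ⟨⟨⟨⟩⟩, rfl⟩)

theorem nonempty_cofFibAdjunction_and_isEquivalence_cof_iff :
    Nonempty (D.cof ⊣ D.fib) ∧ (D.cof.IsEquivalence ↔ ∀ X : D.Dia (Cube.{w} 2),
      D.VanishesOn {Cube.vertex (Arr.mk 0) (Arr.mk 1)} X →
      (D.IsLeft (inclLE 2 1) X ↔ D.IsRight (inclGE 2 1) X)) := by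
  -- The two edges share the vertex `(1,0)`, which is harmless: together with the zero at `(0,1)`
  -- they only have to cover the square.
  refine nonempty_adjunction_and_isEquivalence_iff (inclLE.{w} 2 1) (inclGE.{w} 2 1)
    topSource.{w} rightSink.{w} _ ?_ ?_ ?_ ?_ ?_
  · rintro ⟨t, ht⟩ h
    rcases cube_two_cases t with rfl | rfl | rfl | rfl
    · exact absurd ⟨Arr.mk 0, rfl⟩ h
    · exact absurd ⟨Arr.mk 1, rfl⟩ h
    · exact ⟨rfl, fun _ H => Arr.not_one_le_zero (vertex_le_iff.1 H).2⟩
    · simp [d_vertex] at ht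
  · rintro ⟨t, ht⟩ h
    rcases cube_two_cases t with rfl | rfl | rfl | rfl
    · simp [d_vertex] at ht
    · exact absurd ⟨Arr.mk 0, rfl⟩ h
    · exact ⟨rfl, fun _ H => Arr.not_one_le_zero (vertex_le_iff.1 H).1⟩
    · exact absurd ⟨Arr.mk 1, rfl⟩ h
  · rintro _ rfl
    exact ⟨⟨Cube.vertex (Arr.mk 0) (Arr.mk 1), by simp [d_vertex]⟩, rfl,
      fun _ H => Arr.not_one_le_zero (vertex_le_iff.1 H).2⟩
  · rintro _ rfl
    exact ⟨⟨Cube.vertex (Arr.mk 0) (Arr.mk 1), by simp [d_vertex]⟩, rfl,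
      fun _ H => Arr.not_one_le_zero (vertex_le_iff.1 H).1⟩
  · intro t
    rcases cube_two_cases t with rfl | rfl | rfl | rfl
    · exact Or.inr (Or.inl ⟨Arr.mk 0, rfl⟩)
    · exact Or.inr (Or.inl ⟨Arr.mk 1, rfl⟩)
    · exact Or.inl rfl
    · exact Or.inr (Or.inr ⟨Arr.mk 1, rfl⟩)

end Squares

end Prederivator

namespace Prederivator

/-! ### Degenerate squares are cartesian and cocartesian -/

section Criteria

variable {D : Prederivator.{w, v, u}}
variable {P Q : Type w} [PartialOrder P] [PartialOrder Q]

lemma isColimAt_res_singleton (E : Q ⥤ P) (X : D.Dia P) {s t : Q} (h : s ≤ t)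
    (hE : E.obj s = E.obj t) : D.IsColimAt ((D.res E).obj X) {s} t := by
  have hk : IsTerminal (⟨s, rfl, h⟩ : Below {s} t) :=
    IsTerminal.ofUniqueHom (fun x => homOfLE (show x.1 ≤ s from le_of_eq x.2.1))
      fun _ _ => Subsingleton.elim _ _
  rw [IsColimAt, isColim_res_iff, isColim_iff_of_isTerminal _ _ _ _ _ hk]
  have : IsIso ((Functor.whiskerRight (belowCocone {s} t) E).app ⟨s, rfl, h⟩) :=
    ⟨homOfLE hE.ge, Subsingleton.elim _ _, Subsingleton.elim _ _⟩
  have := isIso_whiskerLeft_pt (Functor.whiskerRight (belowCocone {s} t) E) ⟨s, rfl, h⟩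
  infer_instance

lemma isLimAt_res_singleton (E : Q ⥤ P) (X : D.Dia P) {s t : Q} (h : t ≤ s)
    (hE : E.obj t = E.obj s) : D.IsLimAt ((D.res E).obj X) {s} t := by
  have hk : IsInitial (⟨s, rfl, h⟩ : Above {s} t) :=
    IsInitial.ofUniqueHom (fun x => homOfLE (show s ≤ x.1 from ge_of_eq x.2.1))
      fun _ _ => Subsingleton.elim _ _
  rw [IsLimAt, isLim_res_iff, isLim_iff_of_isInitial _ _ _ _ _ hk]
  have : IsIso ((Functor.whiskerRight (aboveCone {s} t) E).app ⟨s, rfl, h⟩) :=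
    ⟨homOfLE hE.ge, Subsingleton.elim _ _, Subsingleton.elim _ _⟩
  have := isIso_whiskerLeft_pt (Functor.whiskerRight (aboveCone {s} t) E) ⟨s, rfl, h⟩
  infer_instance

variable [D.IsDerivator]

lemma isLeft_subsetVal_iff (S : Set P) (X : D.Dia P) :
    D.IsLeft (subsetVal S) X ↔ ∀ t, D.IsColimAt X S t := by
  rw [isLeft_iff_isColimAt, show Set.range (subsetVal S).obj = S from Subtype.range_coe]

lemma isRight_subsetVal_iff (S : Set P) (X : D.Dia P) :
    D.IsRight (subsetVal S) X ↔ ∀ t, D.IsLimAt X S t := by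
  rw [isRight_iff_isLimAt, show Set.range (subsetVal S).obj = S from Subtype.range_coe]

lemma isLeft_inclLE_iff {n k : ℕ} (X : D.Dia (Cube.{w} n)) :
    D.IsLeft (inclLE n k) X ↔ ∀ t, D.IsColimAt X {m | m.d ≤ k} t :=
  isLeft_subsetVal_iff {m : Cube.{w} n | m.d ≤ k} X

lemma isRight_inclGE_iff {n k : ℕ} (X : D.Dia (Cube.{w} n)) :
    D.IsRight (inclGE n k) X ↔ ∀ t, D.IsLimAt X {m | k ≤ m.d} t :=
  isRight_subsetVal_iff {m : Cube.{w} n | k ≤ m.d} X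

/-- A square two parallel edges of which are isomorphisms is a pushout. -/
lemma isColimAt_of_parallel {X : D.Dia P} {a b c t : P} (hb : b ≤ t) (hab : a ≤ b)
    (hcb : ¬ b ≤ c) (h1 : D.IsColimAt X {b} t) (h2 : D.IsColimAt X {a} c) :
    D.IsColimAt X {a, b, c} t := by
  have h3 : ({a, b} : Set P) ⊆ {a, b, c} := by
    rintro x (rfl | rfl) <;> simp
  -- The vertex `c` is redundant, being already the colimit of `{a, b}`: only `a` lies below it. In
  -- `{a, b}` the element `b` is the largest, so it alone computes the colimit at `t`.
  rw [← isColimAt_iff_of_subset h3, ← isColimAt_iff_of_reflective (S' := {b}) (by simp)]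
  · exact h1
  · rintro s (rfl | rfl) _
    · exact ⟨b, rfl, hb, hab, by rintro _ rfl _ _; exact le_rfl⟩
    · exact ⟨s, rfl, hb, le_rfl, by rintro _ rfl _ _; exact le_rfl⟩
  · rintro s (rfl | rfl | rfl)
    · exact isColimAt_of_mem (by simp)
    · exact isColimAt_of_mem (by simp)
    · rw [← isColimAt_iff_of_reflective (S' := {a}) (by simp)]
      · exact h2
      · rintro x (rfl | rfl) hx
        · exact ⟨x, rfl, hx, le_rfl, by rintro _ rfl _ _; exact le_rfl⟩
        · exact absurd hx hcb

/-- A square two parallel edges of which are isomorphisms is a pullback. -/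
lemma isLimAt_of_parallel {X : D.Dia P} {a b c t : P} (hb : t ≤ b) (hab : b ≤ a)
    (hcb : ¬ c ≤ b) (h1 : D.IsLimAt X {b} t) (h2 : D.IsLimAt X {a} c) :
    D.IsLimAt X {a, b, c} t := by
  have h3 : ({a, b} : Set P) ⊆ {a, b, c} := by
    rintro x (rfl | rfl) <;> simp
  rw [← isLimAt_iff_of_subset h3, ← isLimAt_iff_of_coreflective (S' := {b}) (by simp)]
  · exact h1
  · rintro s (rfl | rfl) _
    · exact ⟨b, rfl, hb, hab, by rintro _ rfl _ _; exact le_rfl⟩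
    · exact ⟨s, rfl, hb, le_rfl, by rintro _ rfl _ _; exact le_rfl⟩
  · rintro s (rfl | rfl | rfl)
    · exact isLimAt_of_mem (by simp)
    · exact isLimAt_of_mem (by simp)
    · rw [← isLimAt_iff_of_coreflective (S' := {a}) (by simp)]
      · exact h2
      · rintro x (rfl | rfl) hx
        · exact ⟨x, rfl, hx, le_rfl, by rintro _ rfl _ _; exact le_rfl⟩
        · exact absurd hx hcb

end Criteria

section SquareCriteria

/-- The vertex `(0,0)`. -/
abbrev v00 : Cube.{w} 2 := Cube.vertex (Arr.mk 0) (Arr.mk 0)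
/-- The vertex `(1,0)`. -/
abbrev v10 : Cube.{w} 2 := Cube.vertex (Arr.mk 1) (Arr.mk 0)
/-- The vertex `(0,1)`. -/
abbrev v01 : Cube.{w} 2 := Cube.vertex (Arr.mk 0) (Arr.mk 1)
/-- The vertex `(1,1)`. -/
abbrev v11 : Cube.{w} 2 := Cube.vertex (Arr.mk 1) (Arr.mk 1)

lemma v00_le (t : Cube.{w} 2) : v00 ≤ t := by
  rw [← vertex_eta t]; exact vertex_mono (Arr.zero_le _) (Arr.zero_le _)

lemma le_v11 (t : Cube.{w} 2) : t ≤ v11 := by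
  rw [← vertex_eta t]; exact vertex_mono (Arr.le_one _) (Arr.le_one _)

lemma not_v10_le_v01 : ¬ (v10.{w} ≤ v01) := fun h => Arr.not_one_le_zero (vertex_le_iff.1 h).1

lemma not_v01_le_v10 : ¬ (v01.{w} ≤ v10) := fun h => Arr.not_one_le_zero (vertex_le_iff.1 h).2

lemma setOf_d_le_one : {m : Cube.{w} 2 | m.d ≤ 1} = {v00, v10, v01} := by
  ext m
  rcases cube_two_cases m with rfl | rfl | rfl | rfl <;>
    simp [d_vertex, vertex_eq_iff, Arr.one_ne_zero, Arr.one_ne_zero.symm]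

lemma setOf_one_le_d : {m : Cube.{w} 2 | 1 ≤ m.d} = {v11, v10, v01} := by
  ext m
  rcases cube_two_cases m with rfl | rfl | rfl | rfl <;>
    simp [d_vertex, vertex_eq_iff, Arr.one_ne_zero, Arr.one_ne_zero.symm]

lemma eq_v11_of_not_d_le_one {m : Cube.{w} 2} (h : ¬ m.d ≤ 1) : m = v11 := by
  rcases cube_two_cases m with rfl | rfl | rfl | rfl <;> simp [d_vertex] at h ⊢

lemma eq_v00_of_not_one_le_d {m : Cube.{w} 2} (h : ¬ 1 ≤ m.d) : m = v00 := by
  rcases cube_two_cases m with rfl | rfl | rfl | rfl <;> simp [d_vertex] at h ⊢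

variable {D : Prederivator.{w, v, u}} [D.IsDerivator] {P : Type w} [PartialOrder P]

lemma isLeft_inclLE_two_iff (X : D.Dia (Cube.{w} 2)) :
    D.IsLeft (inclLE 2 1) X ↔ D.IsColimAt X {m | m.d ≤ 1} v11 := by
  rw [isLeft_inclLE_iff]
  refine ⟨fun h => h _, fun h t => ?_⟩
  by_cases ht : t.d ≤ 1
  · exact isColimAt_of_mem ht
  · rwa [eq_v11_of_not_d_le_one ht]

lemma isRight_inclGE_two_iff (X : D.Dia (Cube.{w} 2)) :
    D.IsRight (inclGE 2 1) X ↔ D.IsLimAt X {m | 1 ≤ m.d} v00 := by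
  rw [isRight_inclGE_iff]
  refine ⟨fun h => h _, fun h t => ?_⟩
  by_cases ht : 1 ≤ t.d
  · exact isLimAt_of_mem ht
  · rwa [eq_v00_of_not_one_le_d ht]

lemma isColimAt_res_of_collapse (φ : Cube.{w} 2 ⥤ P) (X : D.Dia P)
    (h : (φ.obj v00 = φ.obj v10 ∧ φ.obj v01 = φ.obj v11) ∨
      (φ.obj v00 = φ.obj v01 ∧ φ.obj v10 = φ.obj v11)) :
    D.IsColimAt ((D.res φ).obj X) {m | m.d ≤ 1} v11 := by
  rw [setOf_d_le_one]
  rcases h with ⟨h1, h2⟩ | ⟨h1, h2⟩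
  · rw [Set.pair_comm v10 v01]
    exact isColimAt_of_parallel (le_v11 _) (v00_le _) not_v01_le_v10
      (isColimAt_res_singleton φ X (le_v11 _) h2) (isColimAt_res_singleton φ X (v00_le _) h1)
  · exact isColimAt_of_parallel (le_v11 _) (v00_le _) not_v10_le_v01
      (isColimAt_res_singleton φ X (le_v11 _) h2) (isColimAt_res_singleton φ X (v00_le _) h1)

lemma isLimAt_res_of_collapse (φ : Cube.{w} 2 ⥤ P) (X : D.Dia P)
    (h : (φ.obj v00 = φ.obj v10 ∧ φ.obj v01 = φ.obj v11) ∨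
      (φ.obj v00 = φ.obj v01 ∧ φ.obj v10 = φ.obj v11)) :
    D.IsLimAt ((D.res φ).obj X) {m | 1 ≤ m.d} v00 := by
  rw [setOf_one_le_d]
  rcases h with ⟨h1, h2⟩ | ⟨h1, h2⟩
  · exact isLimAt_of_parallel (v00_le _) (le_v11 _) not_v01_le_v10
      (isLimAt_res_singleton φ X (v00_le _) h1) (isLimAt_res_singleton φ X (le_v11 _) h2)
  · rw [Set.pair_comm v10 v01]
    exact isLimAt_of_parallel (v00_le _) (le_v11 _) not_v10_le_v01
      (isLimAt_res_singleton φ X (v00_le _) h1) (isLimAt_res_singleton φ X (le_v11 _) h2)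

end SquareCriteria

end Prederivator

/-! ### The retract argument on pairs of vertices -/

namespace Prederivator

/-- The join of two vertices of a square. -/
def vertexJoin (a b : Cube.{w} 2) : Cube.{w} 2 := fun i => ⟨max (a i).down (b i).down⟩

/-- The meet of two vertices of a square. -/
def vertexMeet (a b : Cube.{w} 2) : Cube.{w} 2 := fun i => ⟨min (a i).down (b i).down⟩

lemma vertexJoin_mono {a b a' b' : Cube.{w} 2} (h : a ≤ a') (h' : b ≤ b') :
    vertexJoin a b ≤ vertexJoin a' b' :=
  fun i => max_le_max (α := Fin 2) (h i) (h' i)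

lemma vertexMeet_mono {a b a' b' : Cube.{w} 2} (h : a ≤ a') (h' : b ≤ b') :
    vertexMeet a b ≤ vertexMeet a' b' :=
  fun i => min_le_min (α := Fin 2) (h i) (h' i)

lemma vertexJoin_v00 (a : Cube.{w} 2) : vertexJoin a v00 = a := by
  rcases cube_two_cases a with rfl | rfl | rfl | rfl <;> funext i <;> fin_cases i <;> rfl

lemma v00_vertexJoin (a : Cube.{w} 2) : vertexJoin v00 a = a := by
  rcases cube_two_cases a with rfl | rfl | rfl | rfl <;> funext i <;> fin_cases i <;> rfl

lemma vertexMeet_v11 (a : Cube.{w} 2) : vertexMeet a v11 = a := by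
  rcases cube_two_cases a with rfl | rfl | rfl | rfl <;> funext i <;> fin_cases i <;> rfl

lemma v11_vertexMeet (a : Cube.{w} 2) : vertexMeet v11 a = a := by
  rcases cube_two_cases a with rfl | rfl | rfl | rfl <;> funext i <;> fin_cases i <;> rfl

lemma vertexJoin_comm (a b : Cube.{w} 2) : vertexJoin a b = vertexJoin b a :=
  funext fun _ => congrArg ULift.up (max_comm _ _)

lemma vertexMeet_comm (a b : Cube.{w} 2) : vertexMeet a b = vertexMeet b a :=
  funext fun _ => congrArg ULift.up (min_comm _ _)

/-- A vertex other than `(0,0)` has a coordinate `1`, and joining with it makes the square constant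
in that direction. -/
lemma vertexJoin_collapse {a : Cube.{w} 2} (ha : a ≠ v00) :
    (vertexJoin a v00 = vertexJoin a v10 ∧ vertexJoin a v01 = vertexJoin a v11) ∨
      (vertexJoin a v00 = vertexJoin a v01 ∧ vertexJoin a v10 = vertexJoin a v11) := by
  rcases cube_two_cases a with rfl | rfl | rfl | rfl
  · exact absurd rfl ha
  · left; constructor <;> funext i <;> fin_cases i <;> rfl
  · right; constructor <;> funext i <;> fin_cases i <;> rfl
  · left; constructor <;> funext i <;> fin_cases i <;> rfl

lemma vertexMeet_collapse {a : Cube.{w} 2} (ha : a ≠ v11) :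
    (vertexMeet a v00 = vertexMeet a v10 ∧ vertexMeet a v01 = vertexMeet a v11) ∨
      (vertexMeet a v00 = vertexMeet a v01 ∧ vertexMeet a v10 = vertexMeet a v11) := by
  rcases cube_two_cases a with rfl | rfl | rfl | rfl
  · left; constructor <;> funext i <;> fin_cases i <;> rfl
  · right; constructor <;> funext i <;> fin_cases i <;> rfl
  · left; constructor <;> funext i <;> fin_cases i <;> rfl
  · exact absurd rfl ha

/-- The poset of pairs of vertices of a square. -/
def SquarePair : Type w := Cube.{w} 2 × Cube.{w} 2

namespace SquarePair

instance : PartialOrder SquarePair.{w} := inferInstanceAs (PartialOrder (Cube.{w} 2 × Cube.{w} 2))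

/-- The inclusion of the square with fixed first component. -/
def fixLeft (a : Cube.{w} 2) : Cube.{w} 2 ⥤ SquarePair.{w} :=
  Monotone.functor (f := fun b => (a, b)) fun _ _ h => ⟨le_rfl, h⟩

/-- The inclusion of the square with fixed second component. -/
def fixRight (b : Cube.{w} 2) : Cube.{w} 2 ⥤ SquarePair.{w} :=
  Monotone.functor (f := fun a => (a, b)) fun _ _ h => ⟨h, le_rfl⟩

lemma fixLeft_le {a b c : Cube.{w} 2} (h : (fixLeft a).obj b ≤ (fixLeft a).obj c) : b ≤ c := h.2

lemma fixRight_le {a b c : Cube.{w} 2} (h : (fixRight a).obj b ≤ (fixRight a).obj c) : b ≤ c := h.1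

/-- The join, as a functor. -/
def join : SquarePair.{w} ⥤ Cube.{w} 2 :=
  Monotone.functor (f := fun p => vertexJoin p.1 p.2) fun _ _ h => vertexJoin_mono h.1 h.2

/-- The meet, as a functor. -/
def meet : SquarePair.{w} ⥤ Cube.{w} 2 :=
  Monotone.functor (f := fun p => vertexMeet p.1 p.2) fun _ _ h => vertexMeet_mono h.1 h.2

/-- The pairs the second component of which is not `(1,1)`. -/
def sourcePart : Set SquarePair.{w} := {p | p.2.d ≤ 1}

/-- The pairs the second component of which is not `(0,0)`. -/
def sinkPart : Set SquarePair.{w} := {p | 1 ≤ p.2.d}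

/-- The pairs with second component `(0,0)`. -/
def sourceEdge : Cube.{w} 2 ⥤ sourcePart.{w} :=
  Monotone.functor (f := fun a => ⟨(a, v00), show v00.d ≤ 1 by simp [d_vertex]⟩)
    fun _ _ h => ⟨h, le_rfl⟩

/-- The pairs with second component `(1,1)`. -/
def sinkEdge : Cube.{w} 2 ⥤ sinkPart.{w} :=
  Monotone.functor (f := fun a => ⟨(a, v11), show 1 ≤ v11.d by simp [d_vertex]⟩)
    fun _ _ h => ⟨h, le_rfl⟩

instance : sourceEdge.{w}.Full := ⟨fun {_ _} g => ⟨homOfLE g.le.1, Subsingleton.elim _ _⟩⟩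

instance : sourceEdge.{w}.Faithful := ⟨fun _ => Subsingleton.elim _ _⟩

instance : sinkEdge.{w}.Full := ⟨fun {_ _} g => ⟨homOfLE g.le.1, Subsingleton.elim _ _⟩⟩

instance : sinkEdge.{w}.Faithful := ⟨fun _ => Subsingleton.elim _ _⟩

variable {D : Prederivator.{w, v, u}}

/-- Below `(a,(1,1))` a pair `(b,c)` is reflected to `(a,c)`. So pushouts in the second variable can
be tested one row at a time. -/
lemma isColimAt_fixLeft_iff (X : D.Dia SquarePair.{w}) (a : Cube.{w} 2) :
    D.IsColimAt ((D.res (fixLeft a)).obj X) {m | m.d ≤ 1} v11 ↔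
      D.IsColimAt X sourcePart ((a, v11) : Cube.{w} 2 × Cube.{w} 2) := by
  rw [isColimAt_res_iff _ fun _ _ => fixLeft_le]
  refine isColimAt_iff_of_reflective ?_ ?_
  · rintro _ ⟨m, hm, rfl⟩
    exact hm
  · rintro ⟨b, c⟩ hs hle
    refine ⟨_, ⟨c, hs, rfl⟩, ⟨le_rfl, le_v11 _⟩, ⟨hle.1, le_rfl⟩, ?_⟩
    rintro _ ⟨m, hm, rfl⟩ _ h
    exact ⟨le_rfl, h.2⟩

lemma isLimAt_fixLeft_iff (X : D.Dia SquarePair.{w}) (a : Cube.{w} 2) :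
    D.IsLimAt ((D.res (fixLeft a)).obj X) {m | 1 ≤ m.d} v00 ↔
      D.IsLimAt X sinkPart ((a, v00) : Cube.{w} 2 × Cube.{w} 2) := by
  rw [isLimAt_res_iff _ fun _ _ => fixLeft_le]
  refine isLimAt_iff_of_coreflective ?_ ?_
  · rintro _ ⟨m, hm, rfl⟩
    exact hm
  · rintro ⟨b, c⟩ hs hle
    refine ⟨_, ⟨c, hs, rfl⟩, ⟨le_rfl, v00_le _⟩, ⟨hle.1, le_rfl⟩, ?_⟩
    rintro _ ⟨m, hm, rfl⟩ _ h
    exact ⟨le_rfl, h.2⟩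

/-- Restrictions along isomorphic functors between posets. -/
def resIsoOfObjEq {P Q : Type w} [PartialOrder P] [PartialOrder Q] {f g : Q ⥤ P}
    (h : ∀ x, f.obj x = g.obj x) (X : D.Dia P) : (D.res f).obj X ≅ (D.res g).obj X :=
  (D.resIso (NatIso.ofComponents (fun x => eqToIso (h x))
    fun _ => Subsingleton.elim _ _)).app X

/-- Restricting along `g` and then along a section `f` of `g` gives back `X`. -/
def resFixJoinIso (X : D.Dia (Cube.{w} 2)) {f : Cube.{w} 2 ⥤ SquarePair.{w}}
    {g : SquarePair.{w} ⥤ Cube.{w} 2} (h : ∀ x, g.obj (f.obj x) = x) :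
    (D.res f).obj ((D.res g).obj X) ≅ X :=
  (D.resComp f g).symm.app X ≪≫ resIsoOfObjEq (g := 𝟭 _) h X ≪≫ (D.resId _).app X

variable [D.IsDerivator]

lemma isLeft_sourcePart_iff (X : D.Dia SquarePair.{w}) :
    D.IsLeft (subsetVal sourcePart) X ↔
      ∀ a, D.IsLeft (inclLE 2 1) ((D.res (fixLeft a)).obj X) := by
  simp only [isLeft_inclLE_two_iff, isColimAt_fixLeft_iff, isLeft_subsetVal_iff]
  refine ⟨fun h a => h _, fun h p => ?_⟩
  by_cases hp : p.2.d ≤ 1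
  · exact isColimAt_of_mem hp
  · obtain ⟨a, b⟩ := p
    obtain rfl := eq_v11_of_not_d_le_one hp
    exact h a

lemma isRight_sinkPart_iff (X : D.Dia SquarePair.{w}) :
    D.IsRight (subsetVal sinkPart) X ↔
      ∀ a, D.IsRight (inclGE 2 1) ((D.res (fixLeft a)).obj X) := by
  simp only [isRight_inclGE_two_iff, isLimAt_fixLeft_iff, isRight_subsetVal_iff]
  refine ⟨fun h a => h _, fun h p => ?_⟩
  by_cases hp : 1 ≤ p.2.d
  · exact isLimAt_of_mem hp
  · obtain ⟨a, b⟩ := p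
    obtain rfl := eq_v00_of_not_one_le_d hp
    exact h a

/-- Row `(0,0)` of the join diagram is `X` itself; every other row is degenerate, hence a pushout
without any hypothesis on `X`. -/
lemma isLeft_join {X : D.Dia (Cube.{w} 2)} (hX : D.IsLeft (inclLE 2 1) X) :
    D.IsLeft (subsetVal sourcePart) ((D.res join).obj X) := by
  rw [isLeft_sourcePart_iff]
  intro a
  by_cases ha : a = v00
  · subst ha
    exact hX.of_iso (resFixJoinIso X v00_vertexJoin).symm
  · refine IsLeft.of_iso ?_ ((D.resComp (fixLeft a) join).app X)
    rw [isLeft_inclLE_two_iff]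
    exact isColimAt_res_of_collapse _ _ (vertexJoin_collapse ha)

lemma isRight_meet {X : D.Dia (Cube.{w} 2)} (hX : D.IsRight (inclGE 2 1) X) :
    D.IsRight (subsetVal sinkPart) ((D.res meet).obj X) := by
  rw [isRight_sinkPart_iff]
  intro a
  by_cases ha : a = v11
  · subst ha
    exact hX.of_iso (resFixJoinIso X v11_vertexMeet).symm
  · refine IsRight.of_iso ?_ ((D.resComp (fixLeft a) meet).app X)
    rw [isRight_inclGE_two_iff]
    exact isLimAt_res_of_collapse _ _ (vertexMeet_collapse ha)

/-- If the squares in direction of the first component are pullbacks over the sink part, then the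
same holds over `(0,0)` for a diagram that is right generated along the sink part. -/
lemma isRight_fixRight_v00 {M : D.Dia SquarePair.{w}} (hM : D.IsRight (subsetVal sinkPart) M)
    (h : ∀ b : Cube.{w} 2, 1 ≤ b.d → D.IsRight (inclGE 2 1) ((D.res (fixRight b)).obj M)) :
    D.IsRight (inclGE 2 1) ((D.res (fixRight v00)).obj M) := by
  rw [isRight_subsetVal_iff] at hM
  simp only [isRight_inclGE_two_iff, isLimAt_res_iff (fixRight _) fun _ _ => fixRight_le] at h ⊢
  -- Limits commute with limits: the value at `((0,0),(0,0))` is the limit over pairs with both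
  -- components nonzero, computed first along one variable and then along the other.
  let T : Set SquarePair.{w} := {p | 1 ≤ p.1.d ∧ 1 ≤ p.2.d}
  have h1 : ∀ p ∈ sinkPart, D.IsLimAt M T p := by
    rintro ⟨a, b⟩ hp
    by_cases ha : 1 ≤ a.d
    · exact isLimAt_of_mem ⟨ha, hp⟩
    · obtain rfl := eq_v00_of_not_one_le_d ha
      refine (isLimAt_iff_of_coreflective ?_ ?_).1 (h b hp)
      · rintro _ ⟨m, hm, rfl⟩
        exact ⟨hm, hp⟩
      · rintro ⟨c, d⟩ hs hle
        refine ⟨_, ⟨c, hs.1, rfl⟩, ⟨v00_le _, le_rfl⟩, ⟨le_rfl, hle.2⟩, ?_⟩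
        rintro _ ⟨m, hm, rfl⟩ _ h
        exact ⟨h.1, le_rfl⟩
  have h2 (p : SquarePair.{w}) : D.IsLimAt M T p :=
    (isLimAt_iff_of_subset (fun _ h => h.2) h1 p).2 (hM p)
  refine (isLimAt_iff_of_coreflective (S := {p : SquarePair.{w} | 1 ≤ p.1.d}) ?_ ?_).2
    ((isLimAt_iff_of_subset (fun _ h => h.1) (fun p _ => h2 p) _).1 (h2 _))
  · rintro _ ⟨m, hm, rfl⟩
    exact hm
  · rintro ⟨c, d⟩ hs hle
    refine ⟨_, ⟨c, hs, rfl⟩, ⟨v00_le _, le_rfl⟩, ⟨le_rfl, hle.2⟩, ?_⟩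
    rintro _ ⟨m, hm, rfl⟩ _ h
    exact ⟨h.1, le_rfl⟩

/-- If the squares in direction of the first component are pushouts over the source part, then the
same holds over `(1,1)` for a diagram that is left generated along the source part. -/
lemma isLeft_fixRight_v11 {M : D.Dia SquarePair.{w}} (hM : D.IsLeft (subsetVal sourcePart) M)
    (h : ∀ b : Cube.{w} 2, b.d ≤ 1 → D.IsLeft (inclLE 2 1) ((D.res (fixRight b)).obj M)) :
    D.IsLeft (inclLE 2 1) ((D.res (fixRight v11)).obj M) := by
  rw [isLeft_subsetVal_iff] at hM
  simp only [isLeft_inclLE_two_iff, isColimAt_res_iff (fixRight _) fun _ _ => fixRight_le] at h ⊢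
  let T : Set SquarePair.{w} := {p | p.1.d ≤ 1 ∧ p.2.d ≤ 1}
  have h1 : ∀ p ∈ sourcePart, D.IsColimAt M T p := by
    rintro ⟨a, b⟩ hp
    by_cases ha : a.d ≤ 1
    · exact isColimAt_of_mem ⟨ha, hp⟩
    · obtain rfl := eq_v11_of_not_d_le_one ha
      refine (isColimAt_iff_of_reflective ?_ ?_).1 (h b hp)
      · rintro _ ⟨m, hm, rfl⟩
        exact ⟨hm, hp⟩
      · rintro ⟨c, d⟩ hs hle
        refine ⟨_, ⟨c, hs.1, rfl⟩, ⟨le_v11 _, le_rfl⟩, ⟨le_rfl, hle.2⟩, ?_⟩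
        rintro _ ⟨m, hm, rfl⟩ _ h
        exact ⟨h.1, le_rfl⟩
  have h2 (p : SquarePair.{w}) : D.IsColimAt M T p :=
    (isColimAt_iff_of_subset (fun _ h => h.2) h1 p).2 (hM p)
  refine (isColimAt_iff_of_reflective (S := {p : SquarePair.{w} | p.1.d ≤ 1}) ?_ ?_).2
    ((isColimAt_iff_of_subset (fun _ h => h.1) (fun p _ => h2 p) _).1 (h2 _))
  · rintro _ ⟨m, hm, rfl⟩
    exact hm
  · rintro ⟨c, d⟩ hs hle
    refine ⟨_, ⟨c, hs, rfl⟩, ⟨le_v11 _, le_rfl⟩, ⟨le_rfl, hle.2⟩, ?_⟩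
    rintro _ ⟨m, hm, rfl⟩ _ h
    exact ⟨h.1, le_rfl⟩

variable [D.IsPointed]

/-- If pushout squares with vanishing corners are pullback squares, then all pushout squares are
pullback squares: the pullback hull of `join^* X` lies between `join^* X` and a diagram of
suspension squares, so `X` is a retract of a pullback square. -/
theorem isRight_of_isLeft
    (H : ∀ X : D.Dia (Cube.{w} 2), D.VanishesOn {v10, v01} X → D.IsLeft (inclLE 2 1) X →
      D.IsRight (inclGE 2 1) X)
    (X : D.Dia (Cube.{w} 2)) (hX : D.IsLeft (inclLE 2 1) X) : D.IsRight (inclGE 2 1) X := by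
  let ι := subsetVal sourcePart.{w}
  let κ := subsetVal sinkPart.{w}
  let M := (D.res join).obj X
  have hM : D.IsLeft ι M := isLeft_join hX
  -- `N` keeps the values `X(a)` at `(a,(0,0))` and is zero on the rest of the source part. Its left
  -- Kan extension `S` therefore has suspension squares as rows, and `H` applies to them.
  let N := (D.ran sourceEdge).obj ((D.res sourceEdge).obj ((D.res ι).obj M))
  let η : (D.res ι).obj M ⟶ N := (D.ranAdj sourceEdge).unit.app ((D.res ι).obj M)
  let S := (D.lan ι).obj N
  have hS : D.IsRight κ S := by
    rw [isRight_sinkPart_iff]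
    intro a
    refine H _ ?_ ((isLeft_sourcePart_iff S).1 (D.isLeft_lan_obj ι N) a)
    have h1 : D.VanishesOn {p : SquarePair.{w} | p.2 = v10 ∨ p.2 = v01} S := by
      refine vanishesOn_lan_ran ι sourceEdge ?_ _
      rintro ⟨b, c⟩ (rfl | rfl : c = v10 ∨ c = v01)
      · exact ⟨⟨(b, v10), show v10.d ≤ 1 by simp [d_vertex]⟩, rfl,
          fun _ h => Arr.not_one_le_zero (vertex_le_iff.1 h.2).1⟩
      · exact ⟨⟨(b, v01), show v01.d ≤ 1 by simp [d_vertex]⟩, rfl,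
          fun _ h => Arr.not_one_le_zero (vertex_le_iff.1 h.2).2⟩
    exact fun t ht => (h1 ((fixLeft a).obj t) ht).of_iso ((D.resComp (pt t) (fixLeft a)).symm.app S)
  -- `M` is generated by the source part, so the map from `M` to its truncation by zero extends to
  -- `g : M ⟶ S`.
  obtain ⟨g, hg⟩ := (hM S).2 (η ≫ (D.lanAdj ι).unit.app N)
  dsimp only at hg
  let M' := (D.ran κ).obj ((D.res κ).obj M)
  let m : M ⟶ M' := (D.ranAdj κ).unit.app M
  have hM' : D.IsRight κ M' := D.isRight_ran_obj κ _
  have hm : IsIso ((D.res κ).map m) := by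
    have := (D.ranAdj κ).left_triangle_components M
    exact (isIso_comp_right_iff _ ((D.ranAdj κ).counit.app ((D.res κ).obj M))).1
      (this ▸ inferInstanceAs (IsIso (𝟙 ((D.res κ).obj M))))
  -- `M` and `M'` agree on the sink part, and `S` is right generated by it; so `g` factors through
  -- `m`.
  obtain ⟨g', hg'⟩ := (hS M').2 (inv ((D.res κ).map m) ≫ (D.res κ).map g)
  dsimp only at hg'
  have hmg : m ≫ g' = g := (hS M).1 (by simp [hg'])
  have hη : IsIso ((D.res sourceEdge).map η) := by
    have := (D.ranAdj sourceEdge).left_triangle_components ((D.res ι).obj M)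
    exact (isIso_comp_right_iff _ ((D.ranAdj sourceEdge).counit.app _)).1
      (this ▸ inferInstanceAs (IsIso (𝟙 ((D.res sourceEdge).obj ((D.res ι).obj M)))))
  -- At the pairs `(a,(0,0))` the truncation changes nothing, so `g` is invertible there and `m`
  -- acquires a left inverse.
  have hiso : IsIso ((D.res (fixRight v00)).map g) := by
    change IsIso ((D.res (sourceEdge ⋙ ι)).map g)
    rw [← isIso_comp_right_iff _ ((D.resComp sourceEdge ι).hom.app _), resComp_hom_naturality, hg,
      Functor.map_comp]
    infer_instance
  have hr : Retract ((D.res (fixRight v00)).obj M) ((D.res (fixRight v00)).obj M') :=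
    { i := (D.res (fixRight v00)).map m
      r := (D.res (fixRight v00)).map g' ≫ inv ((D.res (fixRight v00)).map g)
      retract := by
        rw [← Category.assoc, ← Functor.map_comp, hmg]
        simp }
  refine IsRight.of_iso (IsRight.of_retract ?_ hr) (resFixJoinIso X vertexJoin_v00)
  -- It remains to treat `b ≠ (0,0)`, where `M'` agrees with `M` and the square `X(- ∨ b)` is
  -- degenerate.
  refine isRight_fixRight_v00 hM' fun b hb => ?_
  have hb0 : b ≠ v00 := by
    rintro rfl
    simp [d_vertex] at hb
  let f : Cube.{w} 2 ⥤ sinkPart.{w} := Monotone.functor (f := fun a => ⟨(a, b), hb⟩)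
    fun _ _ h => ⟨h, le_rfl⟩
  have h1 : D.IsRight (inclGE 2 1) ((D.res (fixRight b)).obj M) := by
    refine IsRight.of_iso ?_ ((D.resComp (fixRight b) join).app X)
    rw [isRight_inclGE_two_iff]
    refine isLimAt_res_of_collapse _ _ ?_
    change vertexJoin v00 b = vertexJoin v10 b ∧ vertexJoin v01 b = vertexJoin v11 b ∨
      vertexJoin v00 b = vertexJoin v01 b ∧ vertexJoin v10 b = vertexJoin v11 b
    simp only [vertexJoin_comm _ b]
    exact vertexJoin_collapse hb0
  exact h1.of_iso ((D.resComp f κ).app M ≪≫ (D.res f).mapIso (asIso ((D.res κ).map m)) ≪≫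
    (D.resComp f κ).symm.app M')

/-- If pullback squares with vanishing corners are pushout squares, then all pullback squares are
pushout squares. -/
theorem isLeft_of_isRight
    (H : ∀ X : D.Dia (Cube.{w} 2), D.VanishesOn {v10, v01} X → D.IsRight (inclGE 2 1) X →
      D.IsLeft (inclLE 2 1) X)
    (X : D.Dia (Cube.{w} 2)) (hX : D.IsRight (inclGE 2 1) X) : D.IsLeft (inclLE 2 1) X := by
  let ι := subsetVal sinkPart.{w}
  let κ := subsetVal sourcePart.{w}
  let M := (D.res meet).obj X
  have hM : D.IsRight ι M := isRight_meet hX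
  -- Dually, the rows of the right Kan extension of `N` are loop squares on the values `X(a)`, now
  -- placed at `(a,(1,1))`.
  let N := (D.lan sinkEdge).obj ((D.res sinkEdge).obj ((D.res ι).obj M))
  let η : N ⟶ (D.res ι).obj M := (D.lanAdj sinkEdge).counit.app ((D.res ι).obj M)
  let S := (D.ran ι).obj N
  have hS : D.IsLeft κ S := by
    rw [isLeft_sourcePart_iff]
    intro a
    refine H _ ?_ ((isRight_sinkPart_iff S).1 (D.isRight_ran_obj ι N) a)
    have h1 : D.VanishesOn {p : SquarePair.{w} | p.2 = v10 ∨ p.2 = v01} S := by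
      refine vanishesOn_ran_lan ι sinkEdge ?_ _
      rintro ⟨b, c⟩ (rfl | rfl : c = v10 ∨ c = v01)
      · exact ⟨⟨(b, v10), show 1 ≤ v10.d by simp [d_vertex]⟩, rfl,
          fun _ h => Arr.not_one_le_zero (vertex_le_iff.1 h.2).2⟩
      · exact ⟨⟨(b, v01), show 1 ≤ v01.d by simp [d_vertex]⟩, rfl,
          fun _ h => Arr.not_one_le_zero (vertex_le_iff.1 h.2).1⟩
    exact fun t ht => (h1 ((fixLeft a).obj t) ht).of_iso ((D.resComp (pt t) (fixLeft a)).symm.app S)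
  obtain ⟨g, hg⟩ := (hM S).2 ((D.ranAdj ι).counit.app N ≫ η)
  dsimp only at hg
  let M' := (D.lan κ).obj ((D.res κ).obj M)
  let m : M' ⟶ M := (D.lanAdj κ).counit.app M
  have hM' : D.IsLeft κ M' := D.isLeft_lan_obj κ _
  have hm : IsIso ((D.res κ).map m) := by
    have := (D.lanAdj κ).right_triangle_components M
    exact (isIso_comp_left_iff ((D.lanAdj κ).unit.app ((D.res κ).obj M)) _).1
      (this ▸ inferInstanceAs (IsIso (𝟙 ((D.res κ).obj M))))
  obtain ⟨g', hg'⟩ := (hS M').2 ((D.res κ).map g ≫ inv ((D.res κ).map m))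
  dsimp only at hg'
  have hmg : g' ≫ m = g := (hS M).1 (by simp [hg'])
  have hη : IsIso ((D.res sinkEdge).map η) := by
    have := (D.lanAdj sinkEdge).right_triangle_components ((D.res ι).obj M)
    exact (isIso_comp_left_iff ((D.lanAdj sinkEdge).unit.app _) _).1
      (this ▸ inferInstanceAs (IsIso (𝟙 ((D.res sinkEdge).obj ((D.res ι).obj M)))))
  have hiso : IsIso ((D.res (fixRight v11)).map g) := by
    change IsIso ((D.res (sinkEdge ⋙ ι)).map g)
    rw [← isIso_comp_right_iff _ ((D.resComp sinkEdge ι).hom.app _), resComp_hom_naturality, hg,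
      Functor.map_comp]
    infer_instance
  have hr : Retract ((D.res (fixRight v11)).obj M) ((D.res (fixRight v11)).obj M') :=
    { i := inv ((D.res (fixRight v11)).map g) ≫ (D.res (fixRight v11)).map g'
      r := (D.res (fixRight v11)).map m
      retract := by
        rw [Category.assoc, ← Functor.map_comp, hmg]
        simp }
  refine IsLeft.of_iso (IsLeft.of_retract ?_ hr) (resFixJoinIso X vertexMeet_v11)
  refine isLeft_fixRight_v11 hM' fun b hb => ?_
  have hb0 : b ≠ v11 := by
    rintro rfl
    simp [d_vertex] at hb
  let f : Cube.{w} 2 ⥤ sourcePart.{w} := Monotone.functor (f := fun a => ⟨(a, b), hb⟩)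
    fun _ _ h => ⟨h, le_rfl⟩
  have h1 : D.IsLeft (inclLE 2 1) ((D.res (fixRight b)).obj M) := by
    refine IsLeft.of_iso ?_ ((D.resComp (fixRight b) meet).app X)
    rw [isLeft_inclLE_two_iff]
    refine isColimAt_res_of_collapse _ _ ?_
    change vertexMeet v00 b = vertexMeet v10 b ∧ vertexMeet v01 b = vertexMeet v11 b ∨
      vertexMeet v00 b = vertexMeet v01 b ∧ vertexMeet v10 b = vertexMeet v11 b
    simp only [vertexMeet_comm _ b]
    exact vertexMeet_collapse hb0
  exact h1.of_iso ((D.resComp f κ).app M ≪≫ (D.res f).mapIso (asIso ((D.res κ).map m)).symm ≪≫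
    (D.resComp f κ).symm.app M')

end SquarePair

end Prederivator

/-! ### Pasting of squares in a cube -/

namespace Prederivator

/-- The properties of a relation "the value at `t` is the colimit of the values on `S`" that
allow to paste and cancel cocartesian squares. -/
structure IsColimRelation {P : Type*} [PartialOrder P] (C : Set P → P → Prop) : Prop where
  of_mem : ∀ {S : Set P} {t : P}, t ∈ S → C S t
  of_reflective : ∀ {S S' : Set P} {t : P}, S' ⊆ S →
    (∀ s ∈ S, s ≤ t → ∃ r ∈ S', r ≤ t ∧ s ≤ r ∧ ∀ s' ∈ S', s' ≤ t → s ≤ s' → r ≤ s') →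
    (C S' t ↔ C S t)
  of_subset : ∀ {S T : Set P}, S ⊆ T → (∀ t ∈ T, C S t) → ∀ t, C S t ↔ C T t

namespace IsColimRelation

variable {α : Type*} [DecidableEq α] {C : Set (Finset α) → Finset α → Prop}

/-- Pasting along a chain: elements are added to `m` one at a time, and each addition glues one more
pushout face to the rectangle spanned by `∅`, `m` and `{j}`. -/
lemma rectangle (hC : IsColimRelation C)
    (h : ∀ i j s, i ≠ j → i ∉ s → j ∉ s → C {s, insert i s, insert j s} (insert i (insert j s)))
    (j : α) (m : Finset α) (hj : j ∉ m) : C {∅, m, {j}} (insert j m) := by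
  induction m using Finset.induction_on with
  | empty => exact hC.of_mem (by simp)
  | insert a m ha ih =>
    have haj : a ≠ j := by rintro rfl; simp at hj
    have hjm : j ∉ m := fun h => hj (Finset.mem_insert_of_mem h)
    -- Adjoining `m` to the corner is harmless, since it reflects to `insert a m`, or to `∅` when
    -- `m` is empty.
    have h1 : C {∅, insert a m, {j}} (insert j (insert a m)) ↔
        C {∅, m, insert a m, {j}} (insert j (insert a m)) := by
      refine hC.of_reflective (by intro; simp; tauto) ?_
      rintro s (rfl | rfl | rfl | rfl) hs
      · exact ⟨∅, by simp, by simp, by simp, by simp⟩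
      · rcases s.eq_empty_or_nonempty with rfl | ⟨x, hx⟩
        · exact ⟨∅, by simp, by simp, by simp, by simp⟩
        · refine ⟨insert a s, by simp, by simp, by simp, ?_⟩
          rintro _ (rfl | rfl | rfl) _ h2
          · exact absurd (h2 hx) (by simp)
          · exact le_rfl
          · have := h2 hx
            simp only [Finset.mem_singleton] at this
            exact absurd (this ▸ hx) hjm
      · exact ⟨insert a m, by simp, hs, le_rfl, fun _ _ _ h => h⟩
      · exact ⟨{j}, by simp, hs, le_rfl, fun _ _ _ h => h⟩
    have h2 : C {∅, m, {j}} (insert j m) ↔ C {∅, m, insert a m, {j}} (insert j m) := by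
      refine hC.of_reflective (by intro; simp; tauto) ?_
      rintro s (rfl | rfl | rfl | rfl) hs
      · exact ⟨∅, by simp, by simp, by simp, by simp⟩
      · exact ⟨s, by simp, hs, le_rfl, fun _ _ _ h => h⟩
      · have := hs (Finset.mem_insert_self a m)
        simp [haj, ha] at this
      · exact ⟨{j}, by simp, hs, le_rfl, fun _ _ _ h => h⟩
    -- The vertex `insert j m` is already a colimit by induction, so it may be adjoined. Then `∅`
    -- reflects to `m` and `{j}` to `insert j m`, which leaves the corner of the last face.
    have h3 := hC.of_subset (Set.subset_insert (insert j m) {∅, m, insert a m, {j}})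
      (by
        rintro t (rfl | ht)
        · exact h2.1 (ih hjm)
        · exact hC.of_mem ht) (insert j (insert a m))
    rw [h1, h3, ← hC.of_reflective (S' := {m, insert j m, insert a m})]
    · rw [Finset.insert_comm]
      have := h a j m haj ha hjm
      rwa [Set.pair_comm] at this
    · intro; simp; tauto
    · rintro s (rfl | rfl | rfl | rfl | rfl) hs
      · exact ⟨insert j m, by simp, hs, le_rfl, fun _ _ _ h => h⟩
      · refine ⟨m, by simp, (Finset.subset_insert _ _).trans (Finset.subset_insert _ _), by simp,
          ?_⟩
        rintro _ (rfl | rfl | rfl) _ _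
        · exact le_rfl
        · exact Finset.subset_insert _ _
        · exact Finset.subset_insert _ _
      · exact ⟨s, by simp, hs, le_rfl, fun _ _ _ h => h⟩
      · exact ⟨insert a m, by simp, hs, le_rfl, fun _ _ _ h => h⟩
      · refine ⟨insert j m, by simp, Finset.insert_subset_insert _ (Finset.subset_insert _ _),
          by simp, ?_⟩
        rintro _ (rfl | rfl | rfl) _ h4
        · simp [hjm] at h4
        · exact le_rfl
        · simp [hjm, haj.symm] at h4

/-- A cube is determined by its edges at the initial vertex if and only if all its
two-dimensional faces are cocartesian. -/
theorem star_iff_faces (hC : IsColimRelation C) :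
    (∀ m, C {s | s.card ≤ 1} m) ↔
      ∀ i j s, i ≠ j → i ∉ s → j ∉ s →
        C {s, insert i s, insert j s} (insert i (insert j s)) := by
  constructor
  · intro h i j s hij hi hj
    -- The corner of the face is adjoined to the star of `∅`, which generates everything, and is
    -- reflective in the union below the final vertex: `∅` goes to `s`, a singleton `{x}` to `s` or
    -- to `insert x s`.
    rw [hC.of_reflective (S := {s, insert i s, insert j s} ∪ {s | s.card ≤ 1})
      Set.subset_union_left, ← hC.of_subset Set.subset_union_right]
    · exact h _
    · rintro t -
      exact h t
    · rintro t (ht | ht) hs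
      · exact ⟨t, ht, hs, le_rfl, fun _ _ _ h => h⟩
      · rcases t.eq_empty_or_nonempty with rfl | hne
        · refine ⟨s, by simp, (Finset.subset_insert _ _).trans (Finset.subset_insert _ _), by simp,
            ?_⟩
          rintro _ (rfl | rfl | rfl) _ _
          · exact le_rfl
          · exact Finset.subset_insert _ _
          · exact Finset.subset_insert _ _
        · obtain ⟨x, rfl⟩ := Finset.card_eq_one.1 (le_antisymm ht hne.card_pos)
          simp only [Finset.singleton_subset_iff, Finset.mem_insert] at hs ⊢
          by_cases hx : x ∈ s
          · refine ⟨s, by simp, (Finset.subset_insert _ _).trans (Finset.subset_insert _ _), hx,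
              ?_⟩
            rintro _ (rfl | rfl | rfl) _ _
            · exact subset_rfl
            · exact Finset.subset_insert _ _
            · exact Finset.subset_insert _ _
          · rcases hs with rfl | rfl | hs
            · refine ⟨insert x s, by simp,
                Finset.insert_subset_insert _ (Finset.subset_insert _ _), by simp, ?_⟩
              rintro _ (rfl | rfl | rfl) _ h4
              · exact absurd h4 hx
              · exact subset_rfl
              · simp [hx, hij] at h4
            · refine ⟨insert x s, by simp, Finset.subset_insert _ _, by simp, ?_⟩
              rintro _ (rfl | rfl | rfl) _ h4
              · exact absurd h4 hx
              · simp [hx, hij.symm] at h4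
              · exact subset_rfl
            · exact absurd hs hx
  · intro h m
    induction m using Finset.induction_on with
    | empty => exact hC.of_mem (by simp)
    | insert j m hj ih =>
      -- By induction `m` may be adjoined to the star. Every singleton below `insert j m` other than
      -- `{j}` then reflects to `m`, which reduces the claim to a rectangle.
      rw [hC.of_subset (Set.subset_insert m _)
        (by
          rintro t (rfl | ht)
          · exact ih
          · exact hC.of_mem ht),
        ← hC.of_reflective (S' := {∅, m, {j}})]
      · exact hC.rectangle h j m hj
      · rintro _ (rfl | rfl | rfl) <;> simp
      · rintro t (rfl | ht) hs
        · exact ⟨t, by simp, hs, le_rfl, fun _ _ _ h => h⟩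
        · rcases t.eq_empty_or_nonempty with rfl | hne
          · exact ⟨∅, by simp, by simp, by simp, by simp⟩
          · obtain ⟨x, rfl⟩ := Finset.card_eq_one.1 (le_antisymm ht hne.card_pos)
            by_cases hx : x = j
            · subst hx
              exact ⟨{x}, by simp, hs, le_rfl, fun _ _ _ h => h⟩
            · simp only [Finset.singleton_subset_iff, Finset.mem_insert, hx,
                false_or] at hs ⊢
              refine ⟨m, by simp, Finset.subset_insert _ _, hs, ?_⟩
              rintro _ (rfl | rfl | rfl) _ h4
              · simp at h4
              · exact subset_rfl
              · exact absurd (Finset.mem_singleton.1 h4) hx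

end IsColimRelation

/-! ### Strongly (co)cartesian cubes and their two-dimensional faces -/

section Faces

variable {n : ℕ}

/-- The vertex of the cube that is the characteristic function of `s`. -/
def ind (s : Finset (Fin n)) : Cube.{w} n := fun i => Arr.mk (if i ∈ s then 1 else 0)

lemma ind_le_iff {s t : Finset (Fin n)} : ind.{w} s ≤ ind t ↔ s ≤ t := by
  refine ⟨fun h i hi => ?_, fun h i => ?_⟩
  · by_contra hi'
    have := h i
    simp only [ind, hi, hi', if_true, if_false] at this
    exact Arr.not_one_le_zero this
  · by_cases hi : i ∈ s
    · simp [ind, hi, h hi]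
    · simpa [ind, hi] using Arr.zero_le _

lemma ind_surjective (m : Cube.{w} n) : ∃ s, ind s = m := by
  classical
  refine ⟨Finset.univ.filter fun i => m i = Arr.mk 1, funext fun i => ?_⟩
  rcases Arr.eq_zero_or_one (m i) with h | h
  · simp [ind, h, Arr.one_ne_zero.symm]
  · simp [ind, h]

lemma d_ind (s : Finset (Fin n)) : (ind.{w} s).d = s.card := by
  simp [Cube.d, ind, apply_ite]

/-- The two-dimensional face of the cube at the vertex `ind s`, in the directions `i` and `j`. -/
def face (i j : Fin n) (s : Finset (Fin n)) : Cube.{w} 2 ⥤ Cube.{w} n :=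
  Monotone.functor
    (f := fun m k => if k = i then m 0 else if k = j then m 1 else ind s k)
    fun m m' h k => by
      show (if k = i then m 0 else if k = j then m 1 else ind s k) ≤
        if k = i then m' 0 else if k = j then m' 1 else ind s k
      split_ifs
      exacts [h 0, h 1, le_rfl]

lemma face_obj (i j k : Fin n) (s : Finset (Fin n)) (m : Cube.{w} 2) :
    (face i j s).obj m k = if k = i then m 0 else if k = j then m 1 else ind s k := rfl

lemma le_of_face_obj_le {i j : Fin n} (hij : i ≠ j) (s : Finset (Fin n)) (m m' : Cube.{w} 2)
    (h : (face i j s).obj m ≤ (face i j s).obj m') : m ≤ m' := by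
  have h0 := h i
  have h1 := h j
  simp only [face_obj, if_true, hij.symm, if_false] at h0 h1
  intro k
  fin_cases k
  exacts [h0, h1]

lemma face_vertex {i j : Fin n} {s t : Finset (Fin n)} {a b : Arr.{w}}
    (hi : a = ind t i) (hj : b = ind t j) (h : ∀ k, k ≠ i → k ≠ j → (k ∈ s ↔ k ∈ t)) :
    (face i j s).obj (Cube.vertex a b) = ind t := by
  funext k
  rw [face_obj]
  split_ifs with h1 h2
  · subst h1; exact hi
  · subst h2; exact hj
  · simp [ind, h k h1 h2]

variable {i j : Fin n} {s : Finset (Fin n)}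

lemma face_v00 (hi : i ∉ s) (hj : j ∉ s) : (face.{w} i j s).obj v00 = ind s :=
  face_vertex (by simp [ind, hi]) (by simp [ind, hj]) fun _ _ _ => Iff.rfl

lemma face_v10 (hij : i ≠ j) (hj : j ∉ s) : (face.{w} i j s).obj v10 = ind (insert i s) :=
  face_vertex (by simp [ind]) (by simp [ind, hj, hij.symm]) fun k h _ => by simp [h]

lemma face_v01 (hij : i ≠ j) (hi : i ∉ s) : (face.{w} i j s).obj v01 = ind (insert j s) :=
  face_vertex (by simp [ind, hi, hij]) (by simp [ind]) fun k _ h => by simp [h]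

lemma face_v11 : (face.{w} i j s).obj v11 = ind (insert i (insert j s)) :=
  face_vertex (by simp [ind]) (by simp [ind]) fun k h h' => by simp [h, h']

variable {D : Prederivator.{w, v, u}} [D.IsDerivator]

lemma isColimRelation_isColimAt (X : D.Dia (Cube.{w} n)) :
    IsColimRelation fun (S : Set (Finset (Fin n))) t => D.IsColimAt X (ind '' S) (ind t) where
  of_mem h := isColimAt_of_mem (Set.mem_image_of_mem _ h)
  of_reflective hS h := by
    refine isColimAt_iff_of_reflective (Set.image_mono hS) ?_
    rintro _ ⟨s, hs, rfl⟩ hst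
    obtain ⟨r, hr, h1, h2, h3⟩ := h s hs (ind_le_iff.1 hst)
    refine ⟨ind r, Set.mem_image_of_mem _ hr, ind_le_iff.2 h1, ind_le_iff.2 h2, ?_⟩
    rintro _ ⟨s', hs', rfl⟩ h4 h5
    exact ind_le_iff.2 (h3 s' hs' (ind_le_iff.1 h4) (ind_le_iff.1 h5))
  of_subset h hT t := isColimAt_iff_of_subset (Set.image_mono h) (Set.forall_mem_image.2 hT) _

lemma ind_compl_le_iff {s t : Finset (Fin n)} : ind.{w} sᶜ ≤ ind tᶜ ↔ t ≤ s := by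
  rw [ind_le_iff, compl_le_compl_iff_le]

/-- Taking complements reverses the order, so limits in the cube obey the rules of colimits and the
combinatorics above serves both cases. -/
lemma isColimRelation_isLimAt (X : D.Dia (Cube.{w} n)) :
    IsColimRelation fun (S : Set (Finset (Fin n))) t =>
      D.IsLimAt X ((fun s => ind sᶜ) '' S) (ind tᶜ) where
  of_mem {S t} h := isLimAt_of_mem (Set.mem_image_of_mem (fun s => ind sᶜ) h)
  of_reflective hS h := by
    refine isLimAt_iff_of_coreflective (Set.image_mono hS) ?_
    rintro _ ⟨s, hs, rfl⟩ hst
    obtain ⟨r, hr, h1, h2, h3⟩ := h s hs (ind_compl_le_iff.1 hst)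
    refine ⟨ind rᶜ, Set.mem_image_of_mem (fun s => ind sᶜ) hr, ind_compl_le_iff.2 h1,
      ind_compl_le_iff.2 h2, ?_⟩
    rintro _ ⟨s', hs', rfl⟩ h4 h5
    exact ind_compl_le_iff.2 (h3 s' hs' (ind_compl_le_iff.1 h4) (ind_compl_le_iff.1 h5))
  of_subset h hT t := isLimAt_iff_of_subset (Set.image_mono h) (Set.forall_mem_image.2 hT) _

lemma isLeft_res_face_iff (hij : i ≠ j) (hi : i ∉ s) (hj : j ∉ s) (X : D.Dia (Cube.{w} n)) :
    D.IsLeft (inclLE 2 1) ((D.res (face i j s)).obj X) ↔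
      D.IsColimAt X (ind '' {s, insert i s, insert j s}) (ind (insert i (insert j s))) := by
  rw [isLeft_inclLE_two_iff, isColimAt_res_iff _ (le_of_face_obj_le hij s), setOf_d_le_one]
  simp only [Set.image_insert_eq, Set.image_singleton, face_v00 hi hj, face_v10 hij hj,
    face_v01 hij hi, face_v11]

lemma isRight_res_face_iff (hij : i ≠ j) (hi : i ∉ s) (hj : j ∉ s) (X : D.Dia (Cube.{w} n)) :
    D.IsRight (inclGE 2 1) ((D.res (face i j s)).obj X) ↔
      D.IsLimAt X (ind '' {insert i (insert j s), insert i s, insert j s}) (ind s) := by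
  rw [isRight_inclGE_two_iff, isLimAt_res_iff _ (le_of_face_obj_le hij s), setOf_one_le_d]
  simp only [Set.image_insert_eq, Set.image_singleton, face_v00 hi hj, face_v10 hij hj,
    face_v01 hij hi, face_v11]

lemma isLeft_inclLE_one_iff_faces (X : D.Dia (Cube.{w} n)) :
    D.IsLeft (inclLE n 1) X ↔ ∀ i j s, i ≠ j → i ∉ s → j ∉ s →
      D.IsLeft (inclLE 2 1) ((D.res (face i j s)).obj X) := by
  have h : {m : Cube.{w} n | m.d ≤ 1} = ind '' {s | s.card ≤ 1} := by
    ext m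
    obtain ⟨s, rfl⟩ := ind_surjective m
    refine ⟨fun h => ⟨s, by simpa [d_ind] using h, rfl⟩, ?_⟩
    rintro ⟨t, ht, h⟩
    rw [← h]
    simpa [d_ind] using ht
  rw [isLeft_inclLE_iff, h]
  trans ∀ s, D.IsColimAt X (ind '' {s | s.card ≤ 1}) (ind s)
  · refine ⟨fun h s => h _, fun h t => ?_⟩
    obtain ⟨s, rfl⟩ := ind_surjective t
    exact h s
  · rw [(isColimRelation_isColimAt X).star_iff_faces]
    refine forall₃_congr fun i j s => forall₃_congr fun hij hi hj => ?_
    rw [isLeft_res_face_iff hij hi hj]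

lemma isRight_inclGE_iff_faces (hn : 1 ≤ n) (X : D.Dia (Cube.{w} n)) :
    D.IsRight (inclGE n (n - 1)) X ↔ ∀ i j s, i ≠ j → i ∉ s → j ∉ s →
      D.IsRight (inclGE 2 1) ((D.res (face i j s)).obj X) := by
  have h1 (s : Finset (Fin n)) : n - 1 ≤ (ind.{w} sᶜ).d ↔ s.card ≤ 1 := by
    have := s.card_le_univ
    rw [d_ind, Finset.card_compl]
    simp only [Fintype.card_fin] at this ⊢
    omega
  have h2 (m : Cube.{w} n) : ∃ s, ind sᶜ = m := by
    obtain ⟨s, rfl⟩ := ind_surjective m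
    exact ⟨sᶜ, by rw [compl_compl]⟩
  have h : {m : Cube.{w} n | n - 1 ≤ m.d} = (fun s => ind sᶜ) '' {s | s.card ≤ 1} := by
    ext m
    obtain ⟨s, rfl⟩ := h2 m
    refine ⟨fun h => ⟨s, (h1 s).1 h, rfl⟩, ?_⟩
    rintro ⟨t, ht, h⟩
    rw [← h]
    exact (h1 t).2 ht
  rw [isRight_inclGE_iff, h]
  trans ∀ s, D.IsLimAt X ((fun s => ind sᶜ) '' {s | s.card ≤ 1}) (ind sᶜ)
  · refine ⟨fun h s => h _, fun h t => ?_⟩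
    obtain ⟨s, rfl⟩ := h2 t
    exact h s
  · rw [(isColimRelation_isLimAt X).star_iff_faces]
    -- Complementation turns a face upside down: its new initial vertex is the complement of the old
    -- final vertex. This is an involution on the faces in the directions `i` and `j`, so all of
    -- them are reached.
    have h3 : ∀ i j (s : Finset (Fin n)), i ≠ j → i ∉ s → j ∉ s →
        (D.IsRight (inclGE 2 1) ((D.res (face i j (insert i (insert j s))ᶜ)).obj X) ↔
          D.IsLimAt X ((fun s => ind sᶜ) '' {s, insert i s, insert j s})
            (ind (insert i (insert j s))ᶜ)) := by
      intro i j s hij hi hj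
      rw [isRight_res_face_iff hij (by simp) (by simp)]
      have e1 : insert i (insert j (insert i (insert j s))ᶜ) = sᶜ := by
        ext k; simp; grind
      have e2 : insert i (insert i (insert j s))ᶜ = (insert j s)ᶜ := by
        ext k; simp; grind
      have e3 : insert j (insert i (insert j s))ᶜ = (insert i s)ᶜ := by
        ext k; simp; grind
      rw [e1, e2, e3]
      simp only [Set.image_insert_eq, Set.image_singleton]
      rw [Set.pair_comm]
    constructor
    · intro H i j s hij hi hj
      have := (h3 i j (insert i (insert j s))ᶜ hij (by simp) (by simp)).2
        (H i j _ hij (by simp) (by simp))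
      have e : (insert i (insert j (insert i (insert j s))ᶜ))ᶜ = s := by
        ext k; simp; grind
      rwa [e] at this
    · intro H i j s hij hi hj
      exact (h3 i j s hij hi hj).1 (H i j _ hij (by simp) (by simp))

end Faces

/-! ### Stability and the main theorem -/

section Stable

variable (D : Prederivator.{w, v, u}) [D.IsDerivator]

lemma isStable_iff : D.IsStable ↔
    ∀ X : D.Dia (Cube.{w} 2), D.IsLeft (inclLE 2 1) X ↔ D.IsRight (inclGE 2 1) X := by
  refine forall_congr' fun X => ?_
  rw [IsCartesian, IsCocartesian, D.essImage_ran_iff, D.essImage_lan_iff]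
  exact iff_comm

/-- In a stable derivator, strongly cartesian and strongly cocartesian cubes agree. -/
theorem IsStable.isStronglyCartesian_iff {D : Prederivator.{w, v, u}} [D.IsDerivator]
    (h : D.IsStable) {n : ℕ} (hn : 1 ≤ n) (X : D.Dia (Cube.{w} n)) :
    D.IsStronglyCartesian X ↔ D.IsStronglyCocartesian X := by
  rw [isStable_iff] at h
  rw [IsStronglyCartesian, IsStronglyCocartesian, D.essImage_ran_iff, D.essImage_lan_iff,
    isRight_inclGE_iff_faces hn, isLeft_inclLE_one_iff_faces]
  refine forall₃_congr fun i j s => forall₃_congr fun hij hi hj => ?_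
  exact (h _).symm

end Stable

end Prederivator

end

theorem mainTheorem4 (D : Prederivator.{w, v, u}) [D.IsDerivator] [D.IsPointed] :
    Nonempty (D.susp ⊣ D.loop) ∧ Nonempty (D.cof ⊣ D.fib) ∧
    ∀ (suspLoop : D.susp ⊣ D.loop) (cofFib : D.cof ⊣ D.fib),
      List.TFAE [
        AdjunctionIsEquivalence suspLoop,
        AdjunctionIsEquivalence cofFib,
        D.IsStable,
        ∀ n : ℕ, 2 ≤ n → ∀ X : D.Dia (Prederivator.Cube.{w} n),
          D.IsStronglyCartesian X ↔ D.IsStronglyCocartesian X] := by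
  refine ⟨D.nonempty_suspLoopAdjunction_and_isEquivalence_susp_iff.1,
    D.nonempty_cofFibAdjunction_and_isEquivalence_cof_iff.1, fun suspLoop cofFib => ?_⟩
  -- Conditions 1 and 2 become comparisons of left and right generated squares with zeros at two
  -- vertices and at one vertex.
  rw [adjunctionIsEquivalence_iff, adjunctionIsEquivalence_iff,
    D.nonempty_suspLoopAdjunction_and_isEquivalence_susp_iff.2,
    D.nonempty_cofFibAdjunction_and_isEquivalence_cof_iff.2]
  tfae_have 2 → 1 := fun h X hX => h X fun s hs => hX s (by
    rw [Set.mem_singleton_iff] at hs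
    simp [hs])
  tfae_have 1 → 3 := fun h => by
    rw [D.isStable_iff]
    exact fun X => ⟨Prederivator.SquarePair.isRight_of_isLeft (fun Y hY => (h Y hY).1) X,
      Prederivator.SquarePair.isLeft_of_isRight (fun Y hY => (h Y hY).2) X⟩
  tfae_have 3 → 2 := fun h X _ => D.isStable_iff.1 h X
  tfae_have 3 → 4 := fun h n hn X => h.isStronglyCartesian_iff (by omega) X
  -- For `n = 2` both `n - 1` and `1` are the same bound, so the strong notions unfold to the
  -- notions for squares.
  tfae_have 4 → 3 := fun h X => h 2 le_rfl X
  tfae_finish
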